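/- **Setting.** Let $P$ be the law of a unit $(X,S(0),S(1),Y(0),Y(1))$, with covariates $X\in\mathbb R^d$, surrogates $S=(S(0),S(1))$ and potential outcomes $Y(0),Y(1)$. Assume the joint linear model: for $z\in\{0,1\}$, $$Y(z)=\alpha_{Y,z}^{\mathsf T}X+\varepsilon_Y(z),\qquad S(z)=\alpha_{S,z}^{\mathsf T}X+\varepsilon_S(z),\qquad \varepsilon_Y(z)=\gamma_z\varepsilon_S(z)+\varepsilon(z),$$ where $\mathbb E[\varepsilon_Y(z)\mid X]=\mathbb E[\varepsilon_S(z)\mid X]=\mathbb E[\varepsilon_S(0)\varepsilon_S(1)\mid X]=0$, $\operatorname{var}(\varepsilon_Y(z)\mid X)=\sigma_{Y,z}^2>0$, $\operatorname{var}(\varepsilon_S(z)\mid X)=\sigma_{S,z}^2>0$, $\mathbb E[\varepsilon(z)\mid X,S(0),S(1)]=0$ and $\operatorname{var}(\varepsilon(z)\mid X,S(z))=\sigma_z^2>0$. Hence $\mu_z(X,S):=(\alpha_{Y,z}-\gamma_z\alpha_{S,z})^{\mathsf T}X+\gamma_zS(z)$ is the conditional mean of $Y(z)$ given $(X,S)$.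 Assume that the errors are sub-Gaussian: for some constants $v>0$ and $K>0$ and each $\varepsilon\in\{\varepsilon_Y(z),\varepsilon_S(z)\}$, $\mathbb E[e^{\lambda\varepsilon}\mid X]\le e^{v^2\lambda^2/2}$ for all $\lambda\in\mathbb R$, and $\|\varepsilon\|_{\psi_2}\le K$. Assume that $X$ takes values in a compact set and that $\lambda_{\min}(\mathbb E XX^{\mathsf T})>0$. **Design.** Fix a clipping rate $\eta>0$, a horizon $T$ and an initialization length $T_0$. At stage $t=1,\dots,T$ a unit $(X_t,S_t,Y_t(0),Y_t(1))$ is drawn from $P$, the units being i.i.d. and the unit of stage $t$ being independent of the history $\mathcal F_{t-1}=\sigma(X_j,Z_j,S_j,Y_j:j<t)$. A treatment $Z_t\in\{0,1\}$ is assigned, and $X_t,Z_t,S_t$ and $Y_t=Y_t(Z_t)$ are observed. Let $G_{z,t}=\{j\le t:Z_j=z\}$. Let $\hat\alpha_{S,z,t}$ be the least squares coefficient of $S_j(z)$ on $X_j$ over $j\le t$, let $\hat\alpha_{Y,z,t}$ be that of $Y_j$ on $X_j$ over $j\in G_{z,t}$, and put $$\hat\gamma_{z,t}=\frac{\sum_{j\in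 G_{z,t}}(Y_j-\hat\alpha_{Y,z,t}^{\mathsf T}X_j)(S_j(z)-\hat\alpha_{S,z,t}^{\mathsf T}X_j)}{\sum_{j\in G_{z,t}}(S_j(z)-\hat\alpha_{S,z,t}^{\mathsf T}X_j)^2},\qquad \hat\mu_{z,t}(x,s)=(\hat\alpha_{Y,z,t}-\hat\gamma_{z,t}\hat\alpha_{S,z,t})^{\mathsf T}x+\hat\gamma_{z,t}s(z),$$ $$\hat\sigma_{z,t}^2=|G_{z,t}|^{-1}\sum_{j\in G_{z,t}}\{Y_j-\hat\mu_{z,t}(X_j,S_j)\}^2,$$ where inverses of singular matrices and quotients by $0$ are read as $0$. For $t\le T_0$, $Z_t=0$ if $t$ is odd and $Z_t=1$ if $t$ is even, and the action is $a_t=(1/2,0,0)$. For $T_0<t\le T$ the action is $a_t=(\pi_t,\hat\mu_{0,t-1},\hat\mu_{1,t-1})$ with $$\pi_t=\zeta_t\vee\Big\{\frac{\hat\sigma_{1,t-1}}{\hat\sigma_{1,t-1}+\hat\sigma_{0,t-1}}\wedge(1-\zeta_t)\Big\},\qquad \zeta_t=\tfrac12t^{-\eta},$$ and $Z_t=1$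 with conditional probability $\pi_t$ given $\mathcal F_{t-1}$ and the unit of stage $t$. **Regret.** For an action $a=(\pi,g_0,g_1)$ the loss $\ell(a)$ is the variance of $$g_1(X,S)-g_0(X,S)+\pi^{-1}I(Z=1)\{Y(1)-g_1(X,S)\}-(1-\pi)^{-1}I(Z=0)\{Y(0)-g_0(X,S)\},$$ where the unit has law $P$ and, independently, $Z=1$ with probability $\pi$ and $Z=0$ otherwise. Let $\pi^*=\sigma_1/(\sigma_0+\sigma_1)$, $\underline\pi=\pi^*\wedge(1-\pi^*)$ and $a^*=(\pi^*,\mu_0,\mu_1)$. The regret is $\mathcal R_T=\sum_{t=1}^T\ell(a_t)-T\,\ell(a^*)$. **Length of the initialization phase.** Let $\delta=T^{-1}$ and $$T_0=\left\lceil\frac{8C_4^2}{\sigma_0^4\wedge\sigma_1^4\wedge(2^{-5}\sigma_0^2\sigma_1^2\underline\pi)}\vee\frac{16C_0^2}{\underline\pi^2}\vee\frac1{(2\underline\pi)^{1/\eta}}\right\rceil,\qquad C_0=0.85\sqrt{\log\log T+0.72\log(5.2/\delta)},$$ where $c_0\sqrt{\log T+\log(T/\delta)}\le C_4\le c_1\sqrt{\log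 T+\log(T/\delta)}$, so that $T_0\asymp\log(T/\delta)$. **Theorem.** There is a constant $c_0>0$, depending only on $P$ and the model parameters, such that for all $\eta>0$ and $c_1$ there are constants $C$ and $k\in\mathbb N$, depending only on $P$, the model parameters, $\eta$ and $c_1$, with the following property. For every $T\ge3$, every $C_4$ and $T_0$ as above, every realization of the design with horizon $T$, and every number $\ell_{\max}\ge\ell(a^*)$ such that almost surely $\max_{1\le t\le T}\ell(a_t)\le\ell_{\max}$, the regret $\mathcal R_T$ is integrable and $$\mathbb E\,\mathcal R_T\le C(\log T)^2\{\log((\log T)^2)\}^k+2\{\ell_{\max}-\ell(a^*)\}.$$ In particular $\mathbb E\,\mathcal R_T=\widetilde O((\log T)^2)$ whenever $\ell_{\max}$ does not depend on $T$; here $a_T=\widetilde O(b_T)$ means $a_T=O(b_T\log^k b_T)$ for some $k\ge0$. -/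

import Mathlib

open MeasureTheory ProbabilityTheory
open scoped Matrix

noncomputable section

namespace SLOACI

/-! ### The superpopulation and the joint linear model -/

/-- A unit `(x, s, y)`: covariates `x`, the pair of surrogates `s = (s(0), s(1))` and the pair of
potential outcomes `y = (y(0), y(1))`.  The arms are `0, 1 : Fin 2`. -/
abbrev Subject (d : ℕ) := (Fin d → ℝ) × (Fin 2 → ℝ) × (Fin 2 → ℝ)

/-- Covariates of a unit. -/
def Subject.x {d : ℕ} (w : Subject d) : Fin d → ℝ := w.1

/-- Surrogates of a unit (both are observable). -/
def Subject.s {d : ℕ} (w : Subject d) : Fin 2 → ℝ := w.2.1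

/-- Potential primary outcomes of a unit. -/
def Subject.y {d : ℕ} (w : Subject d) : Fin 2 → ℝ := w.2.2

/-- Parameters of the joint linear model. -/
structure Params (d : ℕ) where
  /-- regression coefficients of the primary outcomes -/
  αY : Fin 2 → Fin d → ℝ
  /-- regression coefficients of the surrogates -/
  αS : Fin 2 → Fin d → ℝ
  /-- linear coefficients of the surrogate errors in the outcome errors -/
  γ : Fin 2 → ℝ
  /-- standard deviations of `ε_Y(z)` given the covariates -/
  σY : Fin 2 → ℝ
  /-- standard deviations of `ε_S(z)` given the covariates -/
  σS : Fin 2 → ℝ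
  /-- standard deviations of the remaining noises `ε(z)` -/
  σ : Fin 2 → ℝ

namespace Params

variable {d : ℕ} (θ : Params d)

/-- `ε_Y(z) = Y(z) - α_{Y,z}ᵀ X`. -/
def εY (z : Fin 2) (w : Subject d) : ℝ := w.y z - θ.αY z ⬝ᵥ w.x

/-- `ε_S(z) = S(z) - α_{S,z}ᵀ X`. -/
def εS (z : Fin 2) (w : Subject d) : ℝ := w.s z - θ.αS z ⬝ᵥ w.x

/-- `ε(z) = ε_Y(z) - γ_z ε_S(z)`. -/
def ε (z : Fin 2) (w : Subject d) : ℝ := θ.εY z w - θ.γ z * θ.εS z w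

/-- `μ_z(x, s) = (α_{Y,z} - γ_z α_{S,z})ᵀ x + γ_z s(z)`. -/
def condMean (z : Fin 2) (x : Fin d → ℝ) (s : Fin 2 → ℝ) : ℝ :=
  (θ.αY z - θ.γ z • θ.αS z) ⬝ᵥ x + θ.γ z * s z

/-- The oracle allocation `π* = σ₁ / (σ₀ + σ₁)`. -/
def πStar : ℝ := θ.σ 1 / (θ.σ 0 + θ.σ 1)

/-- `π* ∧ (1 - π*)`. -/
def πLow : ℝ := min θ.πStar (1 - θ.πStar)

end Params

/-- The σ-algebra on units generated by the covariates. -/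
abbrev sigmaX (d : ℕ) : MeasurableSpace (Subject d) :=
  MeasurableSpace.comap (fun w : Subject d => w.x) inferInstance

/-- The σ-algebra generated by the covariates and the surrogate of arm `z`. -/
abbrev sigmaXSz (d : ℕ) (z : Fin 2) : MeasurableSpace (Subject d) :=
  MeasurableSpace.comap (fun w : Subject d => (w.x, w.s z)) inferInstance

/-- The σ-algebra generated by the covariates and both surrogates. -/
abbrev sigmaXS (d : ℕ) : MeasurableSpace (Subject d) :=
  MeasurableSpace.comap (fun w : Subject d => (w.x, w.s)) inferInstance

/-- The joint linear model for the law `P` of a unit, with parameters `θ`. -/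
structure LinearModel {d : ℕ} (P : Measure (Subject d)) (θ : Params d) : Prop where
  σY_pos : ∀ z, 0 < θ.σY z
  σS_pos : ∀ z, 0 < θ.σS z
  σ_pos : ∀ z, 0 < θ.σ z
  /-- `E{ε_Y(z) | X} = 0` -/
  mean_εY : ∀ z, P[θ.εY z | sigmaX d] =ᵐ[P] fun _ => 0
  /-- `E{ε_S(z) | X} = 0` -/
  mean_εS : ∀ z, P[θ.εS z | sigmaX d] =ᵐ[P] fun _ => 0
  /-- `var{ε_Y(z) | X} = σ_{Y,z}²` -/
  var_εY : ∀ z, Var[θ.εY z; P | sigmaX d] =ᵐ[P] fun _ => θ.σY z ^ 2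
  /-- `var{ε_S(z) | X} = σ_{S,z}²` -/
  var_εS : ∀ z, Var[θ.εS z; P | sigmaX d] =ᵐ[P] fun _ => θ.σS z ^ 2
  /-- `E{ε_S(0) ε_S(1) | X} = 0` -/
  uncorr_εS : P[fun w => θ.εS 0 w * θ.εS 1 w | sigmaX d] =ᵐ[P] fun _ => 0
  /-- `E{ε(z) | X, S(0), S(1)} = 0`, that is, `μ_z(X, S)` is the conditional mean of `Y(z)`
  given `(X, S)` -/
  mean_ε : ∀ z, P[θ.ε z | sigmaXS d] =ᵐ[P] fun _ => 0
  /-- `var{ε(z) | X, S(z)} = σ_z²` -/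
  var_ε : ∀ z, Var[θ.ε z; P | sigmaXSz d z] =ᵐ[P] fun _ => θ.σ z ^ 2

/-- `E[exp(lam * e) | X] ≤ exp(v² lam² / 2)` for all real `lam`, for some `v > 0`. -/
def CondSubGaussian {d : ℕ} (P : Measure (Subject d)) (e : Subject d → ℝ) : Prop :=
  ∃ v : ℝ, 0 < v ∧ ∀ lam : ℝ, Integrable (fun w => Real.exp (lam * e w)) P ∧
    P[fun w => Real.exp (lam * e w) | sigmaX d] ≤ᵐ[P] fun _ => Real.exp (v ^ 2 * lam ^ 2 / 2)

/-- Finite sub-Gaussian (`ψ₂`) norm: `E exp(e² / K²) ≤ 2` for some `K > 0`. -/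
def FinitePsiTwo {d : ℕ} (P : Measure (Subject d)) (e : Subject d → ℝ) : Prop :=
  ∃ K : ℝ, 0 < K ∧ ∫⁻ w, ENNReal.ofReal (Real.exp (e w ^ 2 / K ^ 2)) ∂P ≤ 2

/-- Sub-Gaussian model errors. -/
structure SubGaussianErrors {d : ℕ} (P : Measure (Subject d)) (θ : Params d) : Prop where
  cond_εY : ∀ z, CondSubGaussian P (θ.εY z)
  cond_εS : ∀ z, CondSubGaussian P (θ.εS z)
  psi_εY : ∀ z, FinitePsiTwo P (θ.εY z)
  psi_εS : ∀ z, FinitePsiTwo P (θ.εS z)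

/-- The second moment matrix `E X Xᵀ`. -/
def secondMoment {d : ℕ} (P : Measure (Subject d)) : Matrix (Fin d) (Fin d) ℝ :=
  Matrix.of fun i j => ∫ w, w.x i * w.x j ∂P

theorem secondMoment_isHermitian {d : ℕ} (P : Measure (Subject d)) :
    (secondMoment P).IsHermitian := by
  ext i j
  simp [secondMoment, mul_comm]

/-- The smallest eigenvalue of `E X Xᵀ` (it is `0` in the excluded case `d = 0`). -/
def lambdaMin {d : ℕ} (P : Measure (Subject d)) : ℝ :=
  ⨅ i, (secondMoment_isHermitian P).eigenvalues i

/-- Compact covariate domain and `λ_min(E X Xᵀ) > 0`. -/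
structure CovariateCondition {d : ℕ} (P : Measure (Subject d)) : Prop where
  compact : ∃ K : Set (Fin d → ℝ), IsCompact K ∧ ∀ᵐ w ∂P, w.x ∈ K
  lambdaMin_pos : 0 < lambdaMin P

/-! ### Actions, loss -/

/-- An action `(π, g₀, g₁)`: an allocation and a pair of (estimated) conditional mean functions. -/
structure Action (d : ℕ) where
  prob : ℝ
  mean : Fin 2 → (Fin d → ℝ) → (Fin 2 → ℝ) → ℝ

/-- The single-stage AIPW estimate of the average treatment effect under the action `a`, for a unit
`w` with assigned treatment `z`. -/
def phi {d : ℕ} (a : Action d) (w : Subject d) (z : Fin 2) : ℝ :=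
  a.mean 1 w.x w.s - a.mean 0 w.x w.s
    + (if z = 1 then (w.y 1 - a.mean 1 w.x w.s) / a.prob else 0)
    - (if z = 0 then (w.y 0 - a.mean 0 w.x w.s) / (1 - a.prob) else 0)

/-- The law of a treatment that is `1` with probability `p` and `0` with probability `1 - p`. -/
def assignLaw (p : ℝ) : Measure (Fin 2) :=
  ENNReal.ofReal p • Measure.dirac 1 + ENNReal.ofReal (1 - p) • Measure.dirac 0

/-- The loss `ℓ(a)`: the variance of `phi` under the action `a`, where a unit is drawn from `P`
and, independently, its treatment is `1` with probability `a.prob`. -/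
def loss {d : ℕ} (P : Measure (Subject d)) (a : Action d) : ℝ :=
  Var[fun q : Subject d × Fin 2 => phi a q.1 q.2; P.prod (assignLaw a.prob)]

/-- The optimal action `a* = (π*, μ₀, μ₁)`. -/
def optAction {d : ℕ} (θ : Params d) : Action d where
  prob := θ.πStar
  mean := θ.condMean

/-! ### Estimators computed from the observed data

`D j = (x_j, z_j, s_j, y_j)` is the observation of stage `j`; stages are numbered from `1`.
An inverse of a singular matrix and a quotient by zero are read as zero. -/

/-- An observation `(x, z, s, y)`. -/
abbrev Obs (d : ℕ) := (Fin d → ℝ) × Fin 2 × (Fin 2 → ℝ) × ℝ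

/-- What is observed of a unit `w` under treatment `z`: the outcome is `w.y z`. -/
def observe {d : ℕ} (w : Subject d) (z : Fin 2) : Obs d := (w.x, z, w.s, w.y z)

section Estimators

variable {d : ℕ} (D : ℕ → Obs d)

/-- Covariates of stage `j`. -/
def xAt (j : ℕ) : Fin d → ℝ := (D j).1

/-- Treatment of stage `j`. -/
def zAt (j : ℕ) : Fin 2 := (D j).2.1

/-- Surrogates of stage `j`. -/
def sAt (j : ℕ) : Fin 2 → ℝ := (D j).2.2.1

/-- Observed outcome of stage `j`. -/
def yAt (j : ℕ) : ℝ := (D j).2.2.2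

/-- `G_{z,t}`: the stages up to `t` with treatment `z`. -/
def arm (z : Fin 2) (t : ℕ) : Finset ℕ := (Finset.Icc 1 t).filter fun j => zAt D j = z

/-- Least squares coefficients of the responses `r j` on the covariates, over the stages in `I`. -/
def ols (I : Finset ℕ) (r : ℕ → ℝ) : Fin d → ℝ :=
  (∑ j ∈ I, Matrix.vecMulVec (xAt D j) (xAt D j))⁻¹ *ᵥ ∑ j ∈ I, r j • xAt D j

/-- `α̂_{S,z,t}`, from all stages up to `t`. -/
def αSHat (z : Fin 2) (t : ℕ) : Fin d → ℝ := ols D (Finset.Icc 1 t) fun j => sAt D j z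

/-- `α̂_{Y,z,t}`, from the stages up to `t` with treatment `z`. -/
def αYHat (z : Fin 2) (t : ℕ) : Fin d → ℝ := ols D (arm D z t) (yAt D)

/-- `γ̂_{z,t}`. -/
def γHat (z : Fin 2) (t : ℕ) : ℝ :=
  (∑ j ∈ arm D z t, (yAt D j - αYHat D z t ⬝ᵥ xAt D j) * (sAt D j z - αSHat D z t ⬝ᵥ xAt D j)) /
    ∑ j ∈ arm D z t, (sAt D j z - αSHat D z t ⬝ᵥ xAt D j) ^ 2

/-- `μ̂_{z,t}(x, s)`. -/
def μHat (z : Fin 2) (t : ℕ) (x : Fin d → ℝ) (s : Fin 2 → ℝ) : ℝ :=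
  (αYHat D z t - γHat D z t • αSHat D z t) ⬝ᵥ x + γHat D z t * s z

/-- `σ̂_{z,t}`, the square root of the mean squared residual. -/
def σHat (z : Fin 2) (t : ℕ) : ℝ :=
  Real.sqrt ((∑ j ∈ arm D z t, (yAt D j - μHat D z t (xAt D j) (sAt D j)) ^ 2) / (arm D z t).card)

/-- `π̃_t = σ̂_{1,t-1} / (σ̂_{1,t-1} + σ̂_{0,t-1})`. -/
def πTilde (t : ℕ) : ℝ := σHat D 1 (t - 1) / (σHat D 1 (t - 1) + σHat D 0 (t - 1))

/-- The clipping threshold `ζ_t = t^{-η} / 2`. -/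
def ζ (η : ℝ) (t : ℕ) : ℝ := 1 / 2 * (t : ℝ) ^ (-η)

/-- `CLIP(π̃_t, ζ_t, 1 - ζ_t)`. -/
def πClip (η : ℝ) (t : ℕ) : ℝ := max (ζ η t) (min (πTilde D t) (1 - ζ η t))

/-- The action `a_t = (π_t, μ̂_{0,t-1}, μ̂_{1,t-1})` of the design: `(1/2, 0, 0)` in the
initialization phase `t ≤ T₀`, and the clipped estimated Neyman allocation with the current
estimators in the concentration phase `t > T₀`.  It depends on `D 1, …, D (t - 1)` only. -/
def action (η : ℝ) (T₀ t : ℕ) : Action d :=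
  if t ≤ T₀ then ⟨1 / 2, fun _ _ _ => 0⟩ else ⟨πClip D η t, fun z => μHat D z (t - 1)⟩

end Estimators

/-! ### The design as a stochastic process -/

section Design

variable {d : ℕ} {Ω : Type*}

/-- The observed data sequence. -/
def data (W : ℕ → Ω → Subject d) (Z : ℕ → Ω → Fin 2) (ω : Ω) (j : ℕ) : Obs d :=
  observe (W j ω) (Z j ω)

/-- `F_t`, the σ-algebra generated by the observations of stages `1, …, t`. -/
abbrev history (W : ℕ → Ω → Subject d) (Z : ℕ → Ω → Fin 2) (t : ℕ) : MeasurableSpace Ω :=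
  ⨆ j ∈ Finset.Icc 1 t, MeasurableSpace.comap (fun ω => data W Z ω j) inferInstance

/-- The design with horizon `T`, initialization length `T₀` and clipping rate `η`, run on units
`W 1, …, W T` drawn from `P` with assigned treatments `Z 1, …, Z T`. -/
structure IsDesign [MeasurableSpace Ω] (μ : Measure Ω) (P : Measure (Subject d)) (η : ℝ)
    (T T₀ : ℕ) (W : ℕ → Ω → Subject d) (Z : ℕ → Ω → Fin 2) : Prop where
  meas_W : ∀ t ∈ Finset.Icc 1 T, Measurable (W t)
  meas_Z : ∀ t ∈ Finset.Icc 1 T, Measurable (Z t)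
  /-- the units are identically distributed -/
  law : ∀ t ∈ Finset.Icc 1 T, μ.map (W t) = P
  /-- the units are independent -/
  iIndep : iIndepFun (fun t : Fin T => W (t + 1)) μ
  /-- the unit of stage `t` is drawn independently of the history -/
  indep_history : ∀ t ∈ Finset.Icc 1 T,
    Indep (MeasurableSpace.comap (W t) inferInstance) (history W Z (t - 1)) μ
  /-- initialization: control at odd stages, treatment at even stages -/
  init : ∀ t ∈ Finset.Icc 1 T, t ≤ T₀ → ∀ ω, Z t ω = if Odd t then 0 else 1
  /-- concentration: given the history and the unit, the treatment is `1` with probability `π_t` -/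
  assign : ∀ t ∈ Finset.Icc 1 T, T₀ < t →
    μ[(Z t ⁻¹' {1}).indicator (fun _ => (1 : ℝ)) |
      history W Z (t - 1) ⊔ MeasurableSpace.comap (W t) inferInstance]
      =ᵐ[μ] fun ω => (action (data W Z ω) η T₀ t).prob

/-- The regret `R_T = ∑_{t ≤ T} ℓ(a_t) - T ℓ(a*)`. -/
def regret (P : Measure (Subject d)) (θ : Params d) (η : ℝ) (T T₀ : ℕ)
    (W : ℕ → Ω → Subject d) (Z : ℕ → Ω → Fin 2) (ω : Ω) : ℝ :=
  ∑ t ∈ Finset.Icc 1 T, loss P (action (data W Z ω) η T₀ t) - T * loss P (optAction θ)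

end Design

/-! ### The length of the initialization phase -/

/-- `C_{δ,T,0} = 0.85 √(log log T + 0.72 log(5.2/δ))`. -/
def C0 (δ : ℝ) (T : ℕ) : ℝ :=
  0.85 * Real.sqrt (Real.log (Real.log T) + 0.72 * Real.log (5.2 / δ))

/-- The order `√(log T + log(T/δ))` of the constant `C_{δ,T,4}`. -/
def C4Order (δ : ℝ) (T : ℕ) : ℝ := Real.sqrt (Real.log T + Real.log (T / δ))

/-- The length of the initialization phase (rounded up), as a function of `C_{δ,T,0}` and
`C_{δ,T,4}`. -/
def initLength {d : ℕ} (θ : Params d) (η c0 c4 : ℝ) : ℕ :=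
  ⌈max (8 * c4 ^ 2 /
        min (min (θ.σ 0 ^ 4) (θ.σ 1 ^ 4)) (θ.σ 0 ^ 2 * θ.σ 1 ^ 2 * θ.πLow / 2 ^ 5))
      (max (16 * c0 ^ 2 / θ.πLow ^ 2) (1 / (2 * θ.πLow) ^ (1 / η)))⌉₊

end SLOACI

end

namespace SLOACI

/-! ### Exponential moments -/

/-! The excess loss is quadratic in the error of the action. Conditioning on the unit and applying
the law of total variance to the treatment, the loss is `Var(Y(1) - Y(0))` plus `E[((1-π)(Y(1)-g₁) +
π(Y(0)-g₀))²] / (π(1-π))` (`loss_eq`). The noises `ε(z)` are orthogonal to functions of `(X, S)`, so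
for mean functions linear in `x` and `s(z)` the excess over the oracle is `(σ₀+σ₁)²(π-π*)²/(π(1-π))`
plus a mean square of the errors of `g₀, g₁` (`loss_linMean`, `exists_loss_sub_le`). Errors of order
`√(log T / t)` thus cost `O(log T / t)` at stage `t`, which sums to `O((log T)²)`; the
initialization has `O(log T)` stages of constant cost.

The estimators depend on the data through the empirical second moments of covariates and model
errors: if within each arm these are within `ρ` of the population moments, then coefficients,
residual variances and plug-in allocation are accurate up to a constant times `ρ`
(`exists_accuracy`). To control the moments under adaptive assignment, note that the treatment
probability given history and unit is a function of the history alone, and that the unit is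
independent of the history. Centered products of features summed over one arm therefore form a
martingale with sub-exponential increments; arm size minus its compensator is another one.
Chernoff's bound with `λ = √(log T / n)` and a union bound keep all of them below `κ √(n log T)` for
all `n` in `[T₀, T]`, off an event of probability at most `2 / T` (`exists_concentration`).

Accuracy at time `n` requires arms of size linear in `n`, hence allocations bounded away from `0`
and `1`, hence accuracy at earlier times. This circle is broken by strong induction in
`exists_trajectory_bound`: the alternating initialization starts it, a large `c₀` makes `log T / T₀`
small enough for every threshold, and the last term in the definition of `T₀` makes clipping
harmless afterwards. On the exceptional event every stage costs at most `ℓmax - ℓ(a*)`, which yields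
the additive `2 (ℓmax - ℓ(a*))`. -/

theorem exp_le_one_add_add_sq_mul (x : ℝ) :
    Real.exp x ≤ 1 + x + x ^ 2 * Real.exp |x| := by
  rcases le_or_gt |x| 1 with h | h
  · have h1 := (abs_le.mp (Real.abs_exp_sub_one_sub_id_le h)).2
    have h2 : 1 ≤ Real.exp |x| := Real.one_le_exp (abs_nonneg x)
    nlinarith [sq_nonneg x]
  · have h2 : 1 ≤ Real.exp |x| := Real.one_le_exp (abs_nonneg x)
    have h3 : |x| ≤ x ^ 2 := by rw [← sq_abs]; nlinarith
    rcases le_total 0 x with hx | hx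
    · rw [abs_of_nonneg hx] at *
      nlinarith
    · rw [abs_of_nonpos hx] at *
      have : Real.exp x ≤ 1 := Real.exp_le_one_iff.mpr hx
      nlinarith

theorem sq_le_two_mul_exp {y : ℝ} (hy : 0 ≤ y) : y ^ 2 ≤ 2 * Real.exp y := by
  have := Real.quadratic_le_exp_of_nonneg hy
  nlinarith

/-- A centered variable with an exponential moment has a moment generating function with a
quadratic exponent near zero. -/
theorem exists_lintegral_exp_le {α : Type*} [MeasurableSpace α] (P : Measure α)
    [IsProbabilityMeasure P] {g : α → ℝ} (hg : AEMeasurable g P) {b : ℝ} (hb : 0 < b)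
    (hint : Integrable (fun w => Real.exp (b * |g w|)) P) (hmean : ∫ w, g w ∂P = 0) :
    ∃ V : ℝ, 0 ≤ V ∧ ∀ lam : ℝ, |lam| ≤ b / 2 →
      ∫⁻ w, ENNReal.ofReal (Real.exp (lam * g w)) ∂P ≤ ENNReal.ofReal (Real.exp (V * lam ^ 2)) := by
  have hgint : Integrable g P := by
    refine Integrable.mono' (hint.const_mul (1 / b)) hg.aestronglyMeasurable (ae_of_all _ fun w => ?_)
    have h1 := Real.add_one_le_exp (b * |g w|)
    rw [Real.norm_eq_abs, div_mul_eq_mul_div, one_mul, le_div_iff₀ hb]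
    linarith
  -- Half of the exponent `b` dominates `exp |lam * g|`, the other half absorbs the factor `g²` at
  -- the price `8 / b²`.
  refine ⟨8 / b ^ 2 * ∫ w, Real.exp (b * |g w|) ∂P, by positivity, fun lam hlam => ?_⟩
  have key : ∀ w, Real.exp (lam * g w)
      ≤ 1 + lam * g w + lam ^ 2 * (8 / b ^ 2) * Real.exp (b * |g w|) := by
    intro w
    have h1 := exp_le_one_add_add_sq_mul (lam * g w)
    have h2 : Real.exp |lam * g w| ≤ Real.exp (b / 2 * |g w|) := by
      rw [abs_mul]; gcongr
    have h3 := sq_le_two_mul_exp (y := b / 2 * |g w|) (by positivity)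
    have h4 : g w ^ 2 ≤ 8 / b ^ 2 * Real.exp (b / 2 * |g w|) := by
      rw [div_mul_eq_mul_div, le_div_iff₀ (by positivity)]
      rw [mul_pow, sq_abs] at h3
      nlinarith
    have h5 : Real.exp (b * |g w|) = Real.exp (b / 2 * |g w|) * Real.exp (b / 2 * |g w|) := by
      rw [← Real.exp_add]; ring_nf
    have h6 : (lam * g w) ^ 2 * Real.exp |lam * g w|
        ≤ lam ^ 2 * (8 / b ^ 2) * Real.exp (b * |g w|) := by
      calc (lam * g w) ^ 2 * Real.exp |lam * g w|
          ≤ (lam * g w) ^ 2 * Real.exp (b / 2 * |g w|) := by gcongr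
        _ = lam ^ 2 * g w ^ 2 * Real.exp (b / 2 * |g w|) := by ring
        _ ≤ lam ^ 2 * (8 / b ^ 2 * Real.exp (b / 2 * |g w|)) * Real.exp (b / 2 * |g w|) := by
            gcongr
        _ = _ := by rw [h5]; ring
    linarith
  have hint2 : Integrable
      (fun w => 1 + lam * g w + lam ^ 2 * (8 / b ^ 2) * Real.exp (b * |g w|)) P :=
    ((integrable_const 1).add (hgint.const_mul lam)).add (hint.const_mul _)
  calc ∫⁻ w, ENNReal.ofReal (Real.exp (lam * g w)) ∂P
      ≤ ∫⁻ w, ENNReal.ofReal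
          (1 + lam * g w + lam ^ 2 * (8 / b ^ 2) * Real.exp (b * |g w|)) ∂P :=
        lintegral_mono fun w => ENNReal.ofReal_le_ofReal (key w)
    _ = ENNReal.ofReal
          (∫ w, (1 + lam * g w + lam ^ 2 * (8 / b ^ 2) * Real.exp (b * |g w|)) ∂P) := by
        rw [ofReal_integral_eq_lintegral_ofReal hint2]
        exact ae_of_all _ fun w => (Real.exp_pos _).le.trans (key w)
    _ ≤ _ := by
        apply ENNReal.ofReal_le_ofReal
        have hint1 : Integrable (fun w => 1 + lam * g w) P :=
          (integrable_const 1).add (hgint.const_mul lam)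
        rw [integral_add hint1 (hint.const_mul _),
          integral_add (integrable_const 1) (hgint.const_mul lam), integral_const_mul,
          integral_const_mul, hmean]
        simp only [integral_const, probReal_univ, smul_eq_mul, mul_one, mul_zero, add_zero]
        have := Real.add_one_le_exp
          (8 / b ^ 2 * (∫ w, Real.exp (b * |g w|) ∂P) * lam ^ 2)
        linarith

/-- The moment generating function of a centered Bernoulli variable. -/
theorem bernoulli_exp_le {q lam : ℝ} (h0 : 0 ≤ q) (h1 : q ≤ 1) (hl : |lam| ≤ 1) :
    q * Real.exp (lam * (1 - q)) + (1 - q) * Real.exp (lam * (0 - q)) ≤ Real.exp (1 * lam ^ 2) := by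
  have e : ∀ x : ℝ, |x| ≤ 1 → Real.exp x ≤ 1 + x + x ^ 2 := fun x hx => by
    linarith [(abs_le.mp (Real.abs_exp_sub_one_sub_id_le hx)).2]
  have a1 : |lam * (1 - q)| ≤ 1 := by
    rw [abs_mul]
    exact mul_le_one₀ hl (abs_nonneg _) (by rw [abs_le]; constructor <;> linarith)
  have a2 : |lam * (0 - q)| ≤ 1 := by
    rw [abs_mul]
    exact mul_le_one₀ hl (abs_nonneg _) (by rw [abs_le]; constructor <;> linarith)
  have b1 := mul_le_mul_of_nonneg_left (e _ a1) h0
  have b2 := mul_le_mul_of_nonneg_left (e _ a2) (sub_nonneg.mpr h1)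
  have b3 := Real.add_one_le_exp (1 * lam ^ 2)
  have b4 : q * (1 - q) ≤ 1 := by nlinarith
  nlinarith [mul_le_mul_of_nonneg_left b4 (sq_nonneg lam)]

/-! ### Conditional probabilities under the lower integral -/

/-- Restriction to `A` and the density `q` define measures that agree on `m`, hence have the same
lower integrals of `m`-measurable functions. Working in `ENNReal` spares all integrability
conditions on `K`. -/
theorem setLIntegral_eq_of_condExp {Ω : Type*} {m m0 : MeasurableSpace Ω} (hm : m ≤ m0)
    (μ : Measure Ω) [IsProbabilityMeasure μ] {A : Set Ω} (hA : MeasurableSet A) {q : Ω → ℝ}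
    (hq : Measurable[m] q) (hq0 : ∀ ω, 0 ≤ q ω)
    (hc : μ[A.indicator (fun _ => (1 : ℝ)) | m] =ᵐ[μ] q)
    {K : Ω → ENNReal} (hK : Measurable[m] K) :
    ∫⁻ ω in A, K ω ∂μ = ∫⁻ ω, K ω * ENNReal.ofReal (q ω) ∂μ := by
  have hqm : Measurable fun ω => ENNReal.ofReal (q ω) := (hq.mono hm le_rfl).ennreal_ofReal
  have hqi : Integrable q μ := (integrable_congr hc).mp integrable_condExp
  have hmeas : (μ.restrict A).trim hm = (μ.withDensity fun ω => ENNReal.ofReal (q ω)).trim hm := by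
    refine @Measure.ext _ m _ _ fun B hB => ?_
    rw [trim_measurableSet_eq hm hB, trim_measurableSet_eq hm hB, withDensity_apply _ (hm _ hB),
      Measure.restrict_apply (hm _ hB),
      ← ofReal_integral_eq_lintegral_ofReal hqi.integrableOn (ae_of_all _ hq0)]
    have h1 : ∫ ω in B, A.indicator (fun _ => (1 : ℝ)) ω ∂μ = ∫ ω in B, q ω ∂μ := by
      rw [← setIntegral_condExp hm ((integrable_const (1 : ℝ)).indicator hA) hB]
      exact setIntegral_congr_ae (hm _ hB) (hc.mono fun ω h _ => h)
    rw [← h1, integral_indicator_const (1 : ℝ) hA, smul_eq_mul, mul_one, measureReal_def,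
      ENNReal.ofReal_toReal (measure_ne_top _ _), Measure.restrict_apply hA, Set.inter_comm]
  rw [← lintegral_trim hm hK, hmeas, lintegral_trim hm hK,
    lintegral_withDensity_eq_lintegral_mul _ hqm (hK.mono hm le_rfl)]
  simp [mul_comm]

theorem condExp_indicator_compl {Ω : Type*} {m m0 : MeasurableSpace Ω} (hm : m ≤ m0)
    (μ : Measure Ω) [IsProbabilityMeasure μ] {A : Set Ω} (hA : MeasurableSet A) {q : Ω → ℝ}
    (hc : μ[A.indicator (fun _ => (1 : ℝ)) | m] =ᵐ[μ] q) :
    μ[Aᶜ.indicator (fun _ => (1 : ℝ)) | m] =ᵐ[μ] fun ω => 1 - q ω := by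
  have h1 : Aᶜ.indicator (fun _ => (1 : ℝ)) = (fun _ => 1) - A.indicator (fun _ => (1 : ℝ)) := by
    ext ω; by_cases h : ω ∈ A <;> simp [h]
  rw [h1]
  refine (condExp_sub (integrable_const 1) ((integrable_const (1 : ℝ)).indicator hA) m).trans ?_
  filter_upwards [hc] with ω h
  simp [h, condExp_const hm]

theorem lintegral_mul_add_lintegral_mul_compl {Ω : Type*} {m0 : MeasurableSpace Ω}
    (μ : Measure Ω) {q : Ω → ℝ} (hqm : Measurable q) (hq0 : ∀ ω, 0 ≤ q ω) (hq1 : ∀ ω, q ω ≤ 1)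
    {H : Ω → ENNReal} (hH : Measurable H) :
    ∫⁻ ω, H ω * ENNReal.ofReal (q ω) ∂μ + ∫⁻ ω, H ω * ENNReal.ofReal (1 - q ω) ∂μ
      = ∫⁻ ω, H ω ∂μ := by
  have hm : Measurable fun ω => H ω * ENNReal.ofReal (q ω) := hH.mul hqm.ennreal_ofReal
  rw [← lintegral_add_left hm]
  refine lintegral_congr fun ω => ?_
  rw [← mul_add, ← ENNReal.ofReal_add (hq0 ω) (by linarith [hq1 ω])]
  simp

/-! ### One-step exponential estimates under adaptive assignment -/

section Step

variable {Ω S : Type*} {m₁ m0 : MeasurableSpace Ω} [MeasurableSpace S] {μ : Measure Ω}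
  [IsProbabilityMeasure μ] {W : Ω → S} {A : Set Ω} {q : Ω → ℝ}

/-- One step of a sum over the units assigned to an arm. -/
theorem lintegral_mul_ite_le (hm : m₁ ≤ m0) (hW : Measurable W)
    (hind : Indep (MeasurableSpace.comap W inferInstance) m₁ μ) (hA : MeasurableSet A)
    (hq : Measurable[m₁] q) (hq0 : ∀ ω, 0 ≤ q ω) (hq1 : ∀ ω, q ω ≤ 1)
    (hc : μ[A.indicator (fun _ => (1 : ℝ)) | m₁ ⊔ MeasurableSpace.comap W inferInstance] =ᵐ[μ] q)
    {G : S → ENNReal} (hG : Measurable G) {c : ENNReal} (hc1 : 1 ≤ c)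
    (hGc : ∫⁻ w, G w ∂(μ.map W) ≤ c) {H : Ω → ENNReal} (hH : Measurable[m₁] H) [DecidablePred (· ∈ A)] :
    ∫⁻ ω, H ω * (if ω ∈ A then G (W ω) else 1) ∂μ ≤ c * ∫⁻ ω, H ω ∂μ := by
  have hm2 : MeasurableSpace.comap W inferInstance ≤ m0 := hW.comap_le
  have hsup : m₁ ⊔ MeasurableSpace.comap W inferInstance ≤ m0 := sup_le hm hm2
  have hWm : Measurable[MeasurableSpace.comap W inferInstance] fun ω => G (W ω) :=
    hG.comp (comap_measurable W)
  have hK : Measurable[m₁ ⊔ MeasurableSpace.comap W inferInstance] fun ω => H ω * G (W ω) :=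
    (hH.mono le_sup_left le_rfl).mul (hWm.mono le_sup_right le_rfl)
  have hH' : Measurable[m₁ ⊔ MeasurableSpace.comap W inferInstance] H :=
    hH.mono le_sup_left le_rfl
  have hq' : Measurable[m₁ ⊔ MeasurableSpace.comap W inferInstance] q :=
    hq.mono le_sup_left le_rfl
  have e1 : ∫⁻ ω in A, H ω * (if ω ∈ A then G (W ω) else 1) ∂μ
      = ∫⁻ ω, H ω * G (W ω) * ENNReal.ofReal (q ω) ∂μ := by
    rw [← setLIntegral_eq_of_condExp hsup μ hA hq' hq0 hc hK]
    exact setLIntegral_congr_fun hA fun ω h => by simp [h]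
  have e2 : ∫⁻ ω in Aᶜ, H ω * (if ω ∈ A then G (W ω) else 1) ∂μ
      = ∫⁻ ω, H ω * ENNReal.ofReal (1 - q ω) ∂μ := by
    have hq1' : Measurable[m₁ ⊔ MeasurableSpace.comap W inferInstance] fun ω => 1 - q ω :=
      measurable_const.sub hq'
    rw [← setLIntegral_eq_of_condExp hsup μ hA.compl hq1'
      (fun ω => sub_nonneg.mpr (hq1 ω)) (condExp_indicator_compl hsup μ hA hc) hH']
    refine setLIntegral_congr_fun hA.compl fun ω h => ?_
    have : ω ∉ A := h
    simp [this]
  -- Since `q` is measurable for the history alone, `H * q` is independent of the unit: selection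
  -- into the arm does not bias its law.
  have e3 : ∫⁻ ω, H ω * G (W ω) * ENNReal.ofReal (q ω) ∂μ
      = (∫⁻ ω, H ω * ENNReal.ofReal (q ω) ∂μ) * ∫⁻ w, G w ∂(μ.map W) := by
    have hHq : Measurable[m₁] fun ω => H ω * ENNReal.ofReal (q ω) := hH.mul hq.ennreal_ofReal
    rw [lintegral_map hG hW, ← lintegral_mul_eq_lintegral_mul_lintegral_of_independent_measurableSpace
      hm hm2 hind.symm hHq hWm]
    exact lintegral_congr fun ω => by ring
  rw [← lintegral_add_compl _ hA, e1, e2, e3, ← lintegral_mul_add_lintegral_mul_compl μ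
    (hq.mono hm le_rfl) hq0 hq1 (hH.mono hm le_rfl), mul_add]
  -- Off `A` the factor is `1`, which is where `1 ≤ c` enters.
  refine add_le_add ?_ (le_mul_of_one_le_left' hc1)
  rw [mul_comm]
  gcongr

/-- One step of the difference between the size of an arm and its compensator. -/
theorem lintegral_mul_exp_indicator_sub_le (hm : m₁ ≤ m0) (hA : MeasurableSet A)
    {m : MeasurableSpace Ω} (h1 : m₁ ≤ m) (hm0 : m ≤ m0)
    (hq : Measurable[m₁] q) (hq0 : ∀ ω, 0 ≤ q ω) (hq1 : ∀ ω, q ω ≤ 1)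
    (hc : μ[A.indicator (fun _ => (1 : ℝ)) | m] =ᵐ[μ] q)
    {H : Ω → ENNReal} (hH : Measurable[m₁] H) {lam : ℝ} (hl : |lam| ≤ 1) [DecidablePred (· ∈ A)] :
    ∫⁻ ω, H ω * ENNReal.ofReal (Real.exp (lam * ((if ω ∈ A then 1 else 0) - q ω))) ∂μ
      ≤ ENNReal.ofReal (Real.exp (1 * lam ^ 2)) * ∫⁻ ω, H ω ∂μ := by
  have hH' : Measurable[m] H := hH.mono h1 le_rfl
  have hq' : Measurable[m] q := hq.mono h1 le_rfl
  have hK : ∀ a : ℝ, Measurable[m] fun ω => H ω * ENNReal.ofReal (Real.exp (lam * (a - q ω))) :=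
    fun a => hH'.mul (Real.measurable_exp.comp
      ((measurable_const.sub hq').const_mul lam)).ennreal_ofReal
  have e1 : ∫⁻ ω in A, H ω * ENNReal.ofReal (Real.exp (lam * ((if ω ∈ A then 1 else 0) - q ω))) ∂μ
      = ∫⁻ ω, H ω * ENNReal.ofReal (Real.exp (lam * (1 - q ω))) * ENNReal.ofReal (q ω) ∂μ := by
    rw [← setLIntegral_eq_of_condExp hm0 μ hA hq' hq0 hc (hK 1)]
    exact setLIntegral_congr_fun hA fun ω h => by simp [h]
  have e2 : ∫⁻ ω in Aᶜ, H ω * ENNReal.ofReal (Real.exp (lam * ((if ω ∈ A then 1 else 0) - q ω))) ∂μ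
      = ∫⁻ ω, H ω * ENNReal.ofReal (Real.exp (lam * (0 - q ω)))
          * ENNReal.ofReal (1 - q ω) ∂μ := by
    have hq1' : Measurable[m] fun ω => 1 - q ω := measurable_const.sub hq'
    rw [← setLIntegral_eq_of_condExp hm0 μ hA.compl hq1'
      (fun ω => sub_nonneg.mpr (hq1 ω)) (condExp_indicator_compl hm0 μ hA hc) (hK 0)]
    refine setLIntegral_congr_fun hA.compl fun ω h => ?_
    have : ω ∉ A := h
    simp [this]
  have hm1 : Measurable[m0] fun ω => H ω * ENNReal.ofReal (Real.exp (lam * (1 - q ω)))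
      * ENNReal.ofReal (q ω) := ((hK 1).mul hq'.ennreal_ofReal).mono hm0 le_rfl
  rw [← lintegral_add_compl _ hA, e1, e2, ← lintegral_add_left hm1, ← lintegral_const_mul _ (hH.mono hm le_rfl)]
  refine lintegral_mono fun ω => ?_
  rw [mul_assoc, mul_assoc, ← mul_add, ← ENNReal.ofReal_mul (Real.exp_pos _).le,
    ← ENNReal.ofReal_mul (Real.exp_pos _).le,
    ← ENNReal.ofReal_add (mul_nonneg (Real.exp_pos _).le (hq0 ω))
      (mul_nonneg (Real.exp_pos _).le (sub_nonneg.mpr (hq1 ω))), mul_comm]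
  gcongr
  have := bernoulli_exp_le (hq0 ω) (hq1 ω) hl
  linarith

end Step

/-! ### Concentration -/

section Concentration

variable {Ω : Type*} [m0 : MeasurableSpace Ω] {μ : Measure Ω} [IsProbabilityMeasure μ]

/-- `hstep` is a conditional bound on the moment generating function, tested against all weights `H`
from the past. Taking for `H` the exponential of the previous partial sum peels off one increment at
a time. -/
theorem lintegral_exp_sum_le {m : ℕ → MeasurableSpace Ω} (hmono : Monotone m)
    {T : ℕ} {D : ℕ → Ω → ℝ}
    (hD : ∀ j ∈ Finset.Icc 1 T, Measurable[m j] (D j)) {lam v : ℝ}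
    (hstep : ∀ j ∈ Finset.Icc 1 T, ∀ H : Ω → ENNReal, Measurable[m (j - 1)] H →
      ∫⁻ ω, H ω * ENNReal.ofReal (Real.exp (lam * D j ω)) ∂μ
        ≤ ENNReal.ofReal (Real.exp v) * ∫⁻ ω, H ω ∂μ) :
    ∀ n ≤ T, ∫⁻ ω, ENNReal.ofReal (Real.exp (lam * ∑ j ∈ Finset.Icc 1 n, D j ω)) ∂μ
      ≤ ENNReal.ofReal (Real.exp (n * v)) := by
  intro n
  induction n with
  | zero => intro _; simp
  | succ n ih =>
    intro hn
    have hsum : Measurable[m n] fun ω => ∑ j ∈ Finset.Icc 1 n, D j ω :=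
      Finset.measurable_sum _ fun j hj =>
        (hD j (Finset.mem_Icc.mpr ⟨(Finset.mem_Icc.mp hj).1, (Finset.mem_Icc.mp hj).2.trans (by omega)⟩)).mono
          (hmono (Finset.mem_Icc.mp hj).2) le_rfl
    have h1 := hstep (n + 1) (Finset.mem_Icc.mpr ⟨by omega, hn⟩)
      (fun ω => ENNReal.ofReal (Real.exp (lam * ∑ j ∈ Finset.Icc 1 n, D j ω)))
      (Real.measurable_exp.comp (hsum.const_mul lam)).ennreal_ofReal
    calc ∫⁻ ω, ENNReal.ofReal (Real.exp (lam * ∑ j ∈ Finset.Icc 1 (n + 1), D j ω)) ∂μ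
        = ∫⁻ ω, ENNReal.ofReal (Real.exp (lam * ∑ j ∈ Finset.Icc 1 n, D j ω))
            * ENNReal.ofReal (Real.exp (lam * D (n + 1) ω)) ∂μ := by
          refine lintegral_congr fun ω => ?_
          rw [← ENNReal.ofReal_mul (Real.exp_pos _).le, ← Real.exp_add,
            Finset.sum_Icc_succ_top (by omega), mul_add]
      _ ≤ ENNReal.ofReal (Real.exp v)
            * ∫⁻ ω, ENNReal.ofReal (Real.exp (lam * ∑ j ∈ Finset.Icc 1 n, D j ω)) ∂μ := h1
      _ ≤ ENNReal.ofReal (Real.exp v) * ENNReal.ofReal (Real.exp (n * v)) := by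
          gcongr; exact ih (by omega)
      _ = _ := by
          rw [← ENNReal.ofReal_mul (Real.exp_pos _).le, ← Real.exp_add]
          congr 2; push_cast; ring

omit [IsProbabilityMeasure μ] in
theorem measure_ge_le_of_lintegral_exp_le {f : Ω → ℝ} (hf : Measurable f) {lam s v : ℝ} (hl : 0 ≤ lam)
    (h : ∫⁻ ω, ENNReal.ofReal (Real.exp (lam * f ω)) ∂μ ≤ ENNReal.ofReal (Real.exp v)) :
    μ {ω | s ≤ f ω} ≤ ENNReal.ofReal (Real.exp (v - lam * s)) := by
  have hmeas : Measurable fun ω => ENNReal.ofReal (Real.exp (lam * f ω)) :=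
    (Real.measurable_exp.comp (hf.const_mul lam)).ennreal_ofReal
  have h1 := meas_ge_le_lintegral_div (μ := μ) hmeas.aemeasurable
    (ε := ENNReal.ofReal (Real.exp (lam * s)))
    (by simp [Real.exp_pos]) ENNReal.ofReal_ne_top
  calc μ {ω | s ≤ f ω}
      ≤ μ {ω | ENNReal.ofReal (Real.exp (lam * s)) ≤ ENNReal.ofReal (Real.exp (lam * f ω))} := by
        refine measure_mono fun ω hω => ?_
        have : s ≤ f ω := hω
        exact ENNReal.ofReal_le_ofReal (Real.exp_le_exp.mpr (mul_le_mul_of_nonneg_left this hl))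
    _ ≤ _ := h1
    _ ≤ ENNReal.ofReal (Real.exp v) / ENNReal.ofReal (Real.exp (lam * s)) := by gcongr
    _ = _ := by
        rw [← ENNReal.ofReal_div_of_pos (Real.exp_pos _), ← Real.exp_sub]

/-- A Bernstein type tail bound at the level `κ √(n L)`. -/
theorem measure_sqrt_le_abs_sum_le {m : ℕ → MeasurableSpace Ω} (hmono : Monotone m)
    {T : ℕ} (hm : ∀ j ≤ T, m j ≤ m0) {D : ℕ → Ω → ℝ}
    (hD : ∀ j ∈ Finset.Icc 1 T, Measurable[m j] (D j)) {V lam₀ : ℝ}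
    (hstep : ∀ lam : ℝ, |lam| ≤ lam₀ → ∀ j ∈ Finset.Icc 1 T, ∀ H : Ω → ENNReal,
      Measurable[m (j - 1)] H →
      ∫⁻ ω, H ω * ENNReal.ofReal (Real.exp (lam * D j ω)) ∂μ
        ≤ ENNReal.ofReal (Real.exp (V * lam ^ 2)) * ∫⁻ ω, H ω ∂μ)
    {n : ℕ} (hn0 : 0 < n) (hn : n ≤ T) {L κ : ℝ} (hL : 0 ≤ L) (hnL : √(L / n) ≤ lam₀) :
    μ {ω | κ * √(n * L) ≤ |∑ j ∈ Finset.Icc 1 n, D j ω|}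
      ≤ 2 * ENNReal.ofReal (Real.exp (-((κ - V) * L))) := by
  have hn' : (0 : ℝ) < n := by exact_mod_cast hn0
  have hsum : Measurable fun ω => ∑ j ∈ Finset.Icc 1 n, D j ω :=
    Finset.measurable_sum _ fun j hj => by
      have := Finset.mem_Icc.mp hj
      exact (hD j (Finset.mem_Icc.mpr ⟨this.1, this.2.trans hn⟩)).mono (hm j (this.2.trans hn)) le_rfl
  -- With `lam = √(L / n)` the exponent `n V lam²` becomes `V L` and the threshold term `lam κ √(n
  -- L)` becomes `κ L`.
  have hsq : √(L / n) * √(n * L) = L := by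
    rw [← Real.sqrt_mul (by positivity), show L / n * (n * L) = L ^ 2 by field_simp,
      Real.sqrt_sq hL]
  have hsq2 : √(L / n) ^ 2 = L / n := Real.sq_sqrt (by positivity)
  have hA : ∀ lam : ℝ, |lam| ≤ lam₀ → lam ^ 2 = L / n →
      ∫⁻ ω, ENNReal.ofReal (Real.exp (lam * ∑ j ∈ Finset.Icc 1 n, D j ω)) ∂μ
        ≤ ENNReal.ofReal (Real.exp (V * L)) := by
    intro lam h1 h2
    have := lintegral_exp_sum_le hmono hD (hstep lam h1) n hn
    rwa [h2, show (n : ℝ) * (V * (L / n)) = V * L by field_simp] at this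
  have hexp : V * L - √(L / n) * (κ * √(n * L)) = -((κ - V) * L) := by
    rw [show √(L / n) * (κ * √(n * L)) = κ * (√(L / n) * √(n * L)) by ring, hsq]; ring
  have u1 := measure_ge_le_of_lintegral_exp_le (s := κ * √(n * L)) hsum (Real.sqrt_nonneg (L / n))
    (hA _ (by rwa [abs_of_nonneg (Real.sqrt_nonneg _)]) hsq2)
  have u2 := measure_ge_le_of_lintegral_exp_le (f := fun ω => -∑ j ∈ Finset.Icc 1 n, D j ω)
    (s := κ * √(n * L)) hsum.neg (Real.sqrt_nonneg (L / n)) (v := V * L) (by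
      have := hA (-√(L / n)) (by rwa [abs_neg, abs_of_nonneg (Real.sqrt_nonneg _)])
        (by rw [neg_sq, hsq2])
      simpa [mul_neg, neg_mul] using this)
  rw [hexp] at u1 u2
  calc _ ≤ μ ({ω | κ * √(n * L) ≤ ∑ j ∈ Finset.Icc 1 n, D j ω}
        ∪ {ω | κ * √(n * L) ≤ -∑ j ∈ Finset.Icc 1 n, D j ω}) := by
        refine measure_mono fun ω hω => ?_
        have h : κ * √(n * L) ≤ |∑ j ∈ Finset.Icc 1 n, D j ω| := hω
        exact le_abs.mp h
    _ ≤ _ := measure_union_le _ _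
    _ ≤ _ := by rw [two_mul]; exact add_le_add u1 u2

end Concentration

/-! ### Square-exponential moments -/

/-- `exp (b f²)` is integrable for some `b > 0`. -/
def HasSqExp {α : Type*} [MeasurableSpace α] (P : Measure α) (f : α → ℝ) : Prop :=
  ∃ b : ℝ, 0 < b ∧ Integrable (fun w => Real.exp (b * f w ^ 2)) P

section SqExp

variable {α : Type*} [MeasurableSpace α] {P : Measure α} {f g : α → ℝ}

theorem HasSqExp.memLp (hf : AEMeasurable f P) (h : HasSqExp P f) : MemLp f 2 P := by
  obtain ⟨b, hb, hi⟩ := h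
  rw [memLp_two_iff_integrable_sq hf.aestronglyMeasurable]
  refine Integrable.mono' (hi.const_mul (1 / b)) (hf.pow_const 2).aestronglyMeasurable
    (ae_of_all _ fun w => ?_)
  have h1 := Real.add_one_le_exp (b * f w ^ 2)
  rw [Real.norm_of_nonneg (sq_nonneg _), div_mul_eq_mul_div, one_mul, le_div_iff₀ hb]
  linarith

/-- Products of sub-Gaussian variables are sub-exponential, because `|f g| ≤ max (f²) (g²)`. The
shift `m` will be the mean of the product. -/
theorem HasSqExp.exists_exp_mul (hf : AEMeasurable f P) (hg : AEMeasurable g P)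
    (h : HasSqExp P f) (h' : HasSqExp P g) (m : ℝ) :
    ∃ b : ℝ, 0 < b ∧ Integrable (fun w => Real.exp (b * |f w * g w - m|)) P := by
  obtain ⟨b, hb, hi⟩ := h
  obtain ⟨c, hc, hj⟩ := h'
  refine ⟨min b c, lt_min hb hc, ?_⟩
  refine Integrable.mono' ((hi.add hj).const_mul (Real.exp (min b c * |m|)))
    (by fun_prop) (ae_of_all _ fun w => ?_)
  rw [Real.norm_of_nonneg (Real.exp_pos _).le]
  have hm0 : 0 < min b c := lt_min hb hc
  have h1 : |f w * g w - m| ≤ |f w * g w| + |m| := abs_sub _ _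
  have h2 : |f w * g w| ≤ max (f w ^ 2) (g w ^ 2) := by
    rw [abs_mul]
    rcases le_total |f w| |g w| with h | h
    · refine le_max_of_le_right ?_
      rw [← sq_abs (g w)]; nlinarith [abs_nonneg (f w)]
    · refine le_max_of_le_left ?_
      rw [← sq_abs (f w)]; nlinarith [abs_nonneg (g w)]
  have h3 : Real.exp (min b c * |f w * g w|)
      ≤ Real.exp (b * f w ^ 2) + Real.exp (c * g w ^ 2) := by
    rcases le_max_iff.mp h2 with h | h
    · have : min b c * |f w * g w| ≤ b * f w ^ 2 :=
        mul_le_mul (min_le_left _ _) h (abs_nonneg _) hb.le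
      linarith [Real.exp_le_exp.mpr this, Real.exp_pos (c * g w ^ 2)]
    · have : min b c * |f w * g w| ≤ c * g w ^ 2 :=
        mul_le_mul (min_le_right _ _) h (abs_nonneg _) hc.le
      linarith [Real.exp_le_exp.mpr this, Real.exp_pos (b * f w ^ 2)]
  calc Real.exp (min b c * |f w * g w - m|)
      ≤ Real.exp (min b c * |m| + min b c * |f w * g w|) := by
        apply Real.exp_le_exp.mpr; nlinarith
    _ = Real.exp (min b c * |m|) * Real.exp (min b c * |f w * g w|) := Real.exp_add _ _
    _ ≤ _ := mul_le_mul_of_nonneg_left h3 (Real.exp_pos _).le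

end SqExp

/-! ### Orthogonality and second moments from conditional moments -/

section CondExp

variable {α : Type*}

theorem integral_mul_eq_zero_of_condExp {m : MeasurableSpace α} {m0 : MeasurableSpace α}
    {P : Measure α} [IsProbabilityMeasure P] (hm : m ≤ m0) {h e : α → ℝ}
    (hh : Measurable[m] h) (h2 : MemLp h 2 P) (e2 : MemLp e 2 P)
    (hc : P[e | m] =ᵐ[P] fun _ => 0) : ∫ w, h w * e w ∂P = 0 := by
  have h1 := condExp_mul_of_stronglyMeasurable_left (m := m) (μ := P) hh.stronglyMeasurable
    (h2.integrable_mul e2) (e2.integrable one_le_two)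
  have h3 : ∫ w, (P[h * e | m]) w ∂P = 0 := by
    rw [integral_congr_ae (g := fun _ => (0 : ℝ))]
    · simp
    · filter_upwards [h1, hc] with w a b
      simp [a, b]
  rwa [integral_condExp hm] at h3

theorem integral_sq_eq_of_condVar {m : MeasurableSpace α} {m0 : MeasurableSpace α}
    {P : Measure α} [IsProbabilityMeasure P] (hm : m ≤ m0) {e : α → ℝ} {c : ℝ}
    (hc : P[e | m] =ᵐ[P] fun _ => 0) (hv : Var[e; P | m] =ᵐ[P] fun _ => c) :
    ∫ w, e w ^ 2 ∂P = c := by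
  have h1 : ∫ w, (Var[e; P | m]) w ∂P = c := by rw [integral_congr_ae hv]; simp
  rw [condVar, integral_condExp hm] at h1
  rw [← h1]
  refine integral_congr_ae ?_
  filter_upwards [hc] with w a
  simp [a]

end CondExp

/-! ### Features of a unit and their second moments -/

section Features

variable {d : ℕ}

/-- The covariates, the two surrogate errors, and the outcome error of arm `z`. -/
def obsFeature (θ : Params d) (z : Fin 2) (o : Obs d) : Fin d ⊕ Fin 3 → ℝ :=
  Sum.elim o.1 ![o.2.2.1 0 - θ.αS 0 ⬝ᵥ o.1, o.2.2.1 1 - θ.αS 1 ⬝ᵥ o.1, o.2.2.2 - θ.αY z ⬝ᵥ o.1]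

/-- The features of a unit assigned to arm `z`. -/
def feature (θ : Params d) (z : Fin 2) (w : Subject d) : Fin d ⊕ Fin 3 → ℝ :=
  obsFeature θ z (observe w z)

/-- Second moments of the features. -/
noncomputable def featureMoment (P : Measure (Subject d)) (θ : Params d) (z : Fin 2)
    (a b : Fin d ⊕ Fin 3) : ℝ :=
  ∫ w, feature θ z w a * feature θ z w b ∂P

@[fun_prop]
theorem measurable_x : Measurable fun w : Subject d => w.x := measurable_fst

@[fun_prop]
theorem measurable_s : Measurable fun w : Subject d => w.s := measurable_fst.comp measurable_snd

@[fun_prop]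
theorem measurable_y : Measurable fun w : Subject d => w.y := measurable_snd.comp measurable_snd

theorem measurable_dotProduct {α : Type*} [MeasurableSpace α] {u v : α → Fin d → ℝ}
    (hu : Measurable u) (hv : Measurable v) : Measurable fun a => u a ⬝ᵥ v a := by
  unfold dotProduct; fun_prop

/-- In `obsFeature` the last coordinate is a model error only for an observation from arm `z`; the
other coordinates do not depend on `z`, so sums over both arms can be pooled. -/
theorem measurable_obsFeature (θ : Params d) (z : Fin 2) (a : Fin d ⊕ Fin 3) :
    Measurable fun o : Obs d => obsFeature θ z o a := by
  have h : ∀ v : Fin d → ℝ, Measurable fun o : Obs d => v ⬝ᵥ o.1 :=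
    fun v => measurable_dotProduct measurable_const measurable_fst
  rcases a with a | a
  · simp only [obsFeature, Sum.elim_inl]; fun_prop
  · fin_cases a <;> simp [obsFeature] <;> refine Measurable.sub (by fun_prop) (h _)

theorem measurable_observe (z : Fin 2) : Measurable fun w : Subject d => observe w z := by
  unfold observe; fun_prop

theorem measurable_feature (θ : Params d) (z : Fin 2) (a : Fin d ⊕ Fin 3) :
    Measurable fun w => feature θ z w a :=
  (measurable_obsFeature θ z a).comp (measurable_observe z)

theorem feature_inl (θ : Params d) (z : Fin 2) (w : Subject d) (i : Fin d) :
    feature θ z w (Sum.inl i) = w.x i := rfl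

theorem feature_εS (θ : Params d) (z z' : Fin 2) (w : Subject d) :
    feature θ z w (Sum.inr (Fin.castSucc z')) = θ.εS z' w := by
  fin_cases z' <;> rfl

theorem feature_εY (θ : Params d) (z : Fin 2) (w : Subject d) :
    feature θ z w (Sum.inr 2) = θ.εY z w := rfl

variable {P : Measure (Subject d)} [IsProbabilityMeasure P] {θ : Params d}

omit [IsProbabilityMeasure P] in
theorem hasSqExp_of_finitePsiTwo {e : Subject d → ℝ} (he : Measurable e)
    (h : FinitePsiTwo P e) : HasSqExp P e := by
  obtain ⟨K, hK, h⟩ := h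
  refine ⟨1 / K ^ 2, by positivity, ?_, ?_⟩
  · fun_prop
  · rw [hasFiniteIntegral_iff_ofReal (ae_of_all _ fun w => (Real.exp_pos _).le)]
    refine lt_of_le_of_lt (le_trans (le_of_eq ?_) h) (by simp)
    refine lintegral_congr fun w => ?_
    congr 2; ring

omit [IsProbabilityMeasure P] in
theorem exists_abs_x_le (hcov : CovariateCondition P) :
    ∃ B : ℝ, 0 ≤ B ∧ ∀ᵐ w ∂P, ∀ i, |w.x i| ≤ B := by
  obtain ⟨K, hK, h⟩ := hcov.compact
  obtain ⟨B, hB⟩ := hK.isBounded.exists_norm_le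
  refine ⟨max B 0, le_max_right _ _, h.mono fun w hw i => ?_⟩
  exact (norm_le_pi_norm w.x i).trans ((hB _ hw).trans (le_max_left _ _))

theorem hasSqExp_feature (herr : SubGaussianErrors P θ) (hcov : CovariateCondition P)
    (z : Fin 2) (a : Fin d ⊕ Fin 3) : HasSqExp P fun w => feature θ z w a := by
  rcases a with i | k
  · obtain ⟨B, hB0, hB⟩ := exists_abs_x_le hcov
    refine ⟨1, one_pos, Integrable.mono' (integrable_const (Real.exp (B ^ 2))) ?_ ?_⟩
    · have := measurable_feature θ z (Sum.inl i); fun_prop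
    · filter_upwards [hB] with w hw
      rw [Real.norm_of_nonneg (Real.exp_pos _).le, one_mul, feature_inl, ← sq_abs]
      have := hw i
      gcongr
  · refine Fin.lastCases ?_ (fun z' => ?_) k
    · exact hasSqExp_of_finitePsiTwo (measurable_feature θ z (Sum.inr 2)) (herr.psi_εY z)
    · have := hasSqExp_of_finitePsiTwo (by
        have := measurable_feature θ z (Sum.inr (Fin.castSucc z'))
        simpa only [feature_εS] using this) (herr.psi_εS z')
      simpa only [feature_εS] using this

theorem memLp_feature (herr : SubGaussianErrors P θ) (hcov : CovariateCondition P)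
    (z : Fin 2) (a : Fin d ⊕ Fin 3) : MemLp (fun w => feature θ z w a) 2 P :=
  (hasSqExp_feature herr hcov z a).memLp (measurable_feature θ z a).aemeasurable

theorem memLp_x (herr : SubGaussianErrors P θ) (hcov : CovariateCondition P) (i : Fin d) :
    MemLp (fun w : Subject d => w.x i) 2 P :=
  memLp_feature herr hcov 0 (Sum.inl i)

theorem memLp_εY (herr : SubGaussianErrors P θ) (hcov : CovariateCondition P) (z : Fin 2) :
    MemLp (θ.εY z) 2 P :=
  memLp_feature herr hcov z (Sum.inr 2)

theorem memLp_εS (herr : SubGaussianErrors P θ) (hcov : CovariateCondition P) (z : Fin 2) :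
    MemLp (θ.εS z) 2 P := by
  simpa only [feature_εS] using memLp_feature herr hcov z (Sum.inr (Fin.castSucc z))

theorem memLp_ε (herr : SubGaussianErrors P θ) (hcov : CovariateCondition P) (z : Fin 2) :
    MemLp (θ.ε z) 2 P :=
  (memLp_εY herr hcov z).sub ((memLp_εS herr hcov z).const_mul (θ.γ z))

theorem memLp_dotProduct_x (herr : SubGaussianErrors P θ) (hcov : CovariateCondition P)
    (v : Fin d → ℝ) : MemLp (fun w : Subject d => v ⬝ᵥ w.x) 2 P := by
  have := memLp_finsetSum Finset.univ fun i (_ : i ∈ Finset.univ) =>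
    (memLp_x herr hcov i).const_mul (v i)
  exact this

theorem memLp_y (herr : SubGaussianErrors P θ) (hcov : CovariateCondition P) (z : Fin 2) :
    MemLp (fun w : Subject d => w.y z) 2 P := by
  have := (memLp_εY herr hcov z).add (memLp_dotProduct_x herr hcov (θ.αY z))
  convert this using 1
  ext w; simp [Params.εY]

theorem memLp_s (herr : SubGaussianErrors P θ) (hcov : CovariateCondition P) (z : Fin 2) :
    MemLp (fun w : Subject d => w.s z) 2 P := by
  have := (memLp_εS herr hcov z).add (memLp_dotProduct_x herr hcov (θ.αS z))
  convert this using 1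
  ext w; simp [Params.εS]

omit [IsProbabilityMeasure P] in
theorem sigmaX_le : sigmaX d ≤ (inferInstance : MeasurableSpace (Subject d)) :=
  measurable_x.comap_le

theorem sigmaXS_le : sigmaXS d ≤ (inferInstance : MeasurableSpace (Subject d)) :=
  (measurable_x.prodMk measurable_s).comap_le

theorem sigmaXSz_le_sigmaXS (z : Fin 2) : sigmaXSz d z ≤ sigmaXS d := by
  have h : Measurable fun p : (Fin d → ℝ) × (Fin 2 → ℝ) => (p.1, p.2 z) := by fun_prop
  have := (h.comp (comap_measurable (fun w : Subject d => (w.x, w.s)))).comap_le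
  exact this

theorem measurable_sigmaXS_of_comp {f : (Fin d → ℝ) × (Fin 2 → ℝ) → ℝ} (hf : Measurable f) :
    Measurable[sigmaXS d] fun w : Subject d => f (w.x, w.s) :=
  hf.comp (comap_measurable (fun w : Subject d => (w.x, w.s)))

section Moments

variable (hmodel : LinearModel P θ) (herr : SubGaussianErrors P θ) (hcov : CovariateCondition P)

include hmodel

theorem integral_εY_sq (z : Fin 2) : ∫ w, θ.εY z w ^ 2 ∂P = θ.σY z ^ 2 :=
  integral_sq_eq_of_condVar sigmaX_le (hmodel.mean_εY z) (hmodel.var_εY z)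

theorem integral_εS_sq (z : Fin 2) : ∫ w, θ.εS z w ^ 2 ∂P = θ.σS z ^ 2 :=
  integral_sq_eq_of_condVar sigmaX_le (hmodel.mean_εS z) (hmodel.var_εS z)

theorem integral_ε_sq (z : Fin 2) : ∫ w, θ.ε z w ^ 2 ∂P = θ.σ z ^ 2 := by
  refine integral_sq_eq_of_condVar ((sigmaXSz_le_sigmaXS z).trans sigmaXS_le) ?_ (hmodel.var_ε z)
  -- The mean is given conditionally on `(X, S)` and the variance on `(X, S(z))`; the tower property
  -- brings the mean to the smaller σ-algebra.
  refine (condExp_condExp_of_le (sigmaXSz_le_sigmaXS z) sigmaXS_le).symm.trans ?_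
  refine (condExp_congr_ae (hmodel.mean_ε z)).trans ?_
  rw [condExp_const ((sigmaXSz_le_sigmaXS z).trans sigmaXS_le)]

include herr hcov

theorem integral_mul_ε (z : Fin 2) {f : (Fin d → ℝ) × (Fin 2 → ℝ) → ℝ} (hf : Measurable f)
    (hf2 : MemLp (fun w : Subject d => f (w.x, w.s)) 2 P) :
    ∫ w, f (w.x, w.s) * θ.ε z w ∂P = 0 :=
  integral_mul_eq_zero_of_condExp sigmaXS_le (measurable_sigmaXS_of_comp hf) hf2
    (memLp_ε herr hcov z) (hmodel.mean_ε z)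

theorem integral_x_mul_εY (z : Fin 2) (i : Fin d) : ∫ w, w.x i * θ.εY z w ∂P = 0 :=
  integral_mul_eq_zero_of_condExp sigmaX_le
    ((measurable_pi_apply i).comp (comap_measurable (fun w : Subject d => w.x)))
    (memLp_x herr hcov i) (memLp_εY herr hcov z) (hmodel.mean_εY z)

theorem integral_x_mul_εS (z : Fin 2) (i : Fin d) : ∫ w, w.x i * θ.εS z w ∂P = 0 :=
  integral_mul_eq_zero_of_condExp sigmaX_le
    ((measurable_pi_apply i).comp (comap_measurable (fun w : Subject d => w.x)))
    (memLp_x herr hcov i) (memLp_εS herr hcov z) (hmodel.mean_εS z)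

theorem integral_εS_mul_ε (z : Fin 2) : ∫ w, θ.εS z w * θ.ε z w ∂P = 0 := by
  refine integral_mul_ε hmodel herr hcov z (f := fun p => p.2 z - θ.αS z ⬝ᵥ p.1) ?_ ?_
  · exact Measurable.sub (by fun_prop) (measurable_dotProduct measurable_const measurable_fst)
  · exact memLp_εS herr hcov z

theorem integral_εY_mul_εS (z : Fin 2) :
    ∫ w, θ.εY z w * θ.εS z w ∂P = θ.γ z * θ.σS z ^ 2 := by
  have h : ∀ w, θ.εY z w * θ.εS z w = θ.εS z w * θ.ε z w + θ.γ z * θ.εS z w ^ 2 := fun w => by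
    simp only [Params.ε]; ring
  simp_rw [h]
  rw [integral_add, integral_const_mul, integral_εS_mul_ε hmodel herr hcov,
    integral_εS_sq hmodel, zero_add]
  · exact (memLp_εS herr hcov z).integrable_mul (memLp_ε herr hcov z)
  · exact (memLp_εS herr hcov z).integrable_sq.const_mul _

/-- Pythagoras for `ε_Y = γ ε_S + ε` with `ε_S ⟂ ε`. It identifies the limit of the residual
variance in `exists_arm_accuracy`. -/
theorem σY_sq_eq (z : Fin 2) : θ.σY z ^ 2 = θ.γ z ^ 2 * θ.σS z ^ 2 + θ.σ z ^ 2 := by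
  have h : ∀ w, θ.εY z w ^ 2
      = θ.ε z w ^ 2 + 2 * θ.γ z * (θ.εS z w * θ.ε z w) + θ.γ z ^ 2 * θ.εS z w ^ 2 := fun w => by
    simp only [Params.ε]; ring
  have i1 := (memLp_ε herr hcov z).integrable_sq
  have i2 : Integrable (fun w => 2 * θ.γ z * (θ.εS z w * θ.ε z w)) P :=
    ((memLp_εS herr hcov z).integrable_mul (memLp_ε herr hcov z)).const_mul _
  have i12 : Integrable (fun w => θ.ε z w ^ 2 + 2 * θ.γ z * (θ.εS z w * θ.ε z w)) P := i1.add i2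
  have i3 := (memLp_εS herr hcov z).integrable_sq.const_mul (θ.γ z ^ 2)
  rw [← integral_εY_sq hmodel z]
  simp_rw [h]
  rw [integral_add i12 i3, integral_add i1 i2, integral_const_mul, integral_const_mul,
    integral_εS_mul_ε hmodel herr hcov, integral_εS_sq hmodel, integral_ε_sq hmodel]
  ring

end Moments

omit [IsProbabilityMeasure P] in
/-- The second moment matrix is bounded below on the `ℓ₁` sphere. -/
theorem exists_secondMoment_lower (hcov : CovariateCondition P) :
    ∃ l : ℝ, 0 < l ∧ ∀ v : Fin d → ℝ,
      l * (∑ i, |v i|) ^ 2 ≤ ∑ i, ∑ j, v i * v j * secondMoment P i j := by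
  have hpos : (secondMoment P).PosDef := by
    rw [(secondMoment_isHermitian P).posDef_iff_eigenvalues_pos]
    intro i
    exact hcov.lambdaMin_pos.trans_le (ciInf_le (Set.finite_range _).bddBelow i)
  set Qf : (Fin d → ℝ) → ℝ := fun v => ∑ i, ∑ j, v i * v j * secondMoment P i j with hQ
  have hcont : Continuous Qf := by fun_prop
  have hQpos : ∀ v, v ≠ 0 → 0 < Qf v := by
    intro v hv
    have := hpos.dotProduct_mulVec_pos hv
    simp only [star_trivial, dotProduct, Matrix.mulVec, Finset.mul_sum] at this
    exact this.trans_eq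
      (Finset.sum_congr rfl fun i _ => Finset.sum_congr rfl fun j _ => by ring)
  by_cases hd : ∃ v : Fin d → ℝ, ‖v‖ = 1
  · have hcomp : IsCompact (Metric.sphere (0 : Fin d → ℝ) 1) := isCompact_sphere _ _
    obtain ⟨v0, hv0, hmin⟩ := hcomp.exists_isMinOn (by
      obtain ⟨v, hv⟩ := hd; exact ⟨v, by simpa using hv⟩) hcont.continuousOn
    have hv0' : v0 ≠ 0 := by
      rintro rfl; simp at hv0
    -- `Qf v0` is the minimum on the sup-norm sphere, and the `ℓ₁` norm is at most `d + 1` times the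
    -- sup norm.
    refine ⟨Qf v0 / (d + 1) ^ 2, div_pos (hQpos _ hv0') (by positivity), fun v => ?_⟩
    by_cases hv : v = 0
    · subst hv; simp
    have hn : 0 < ‖v‖ := norm_pos_iff.mpr hv
    have h1 : Qf v0 ≤ Qf (‖v‖⁻¹ • v) := hmin (by
      simp [norm_smul, hn.ne'])
    have h2 : Qf (‖v‖⁻¹ • v) = Qf v / ‖v‖ ^ 2 := by
      simp only [hQ, Pi.smul_apply, smul_eq_mul, Finset.sum_div]
      refine Finset.sum_congr rfl fun i _ => Finset.sum_congr rfl fun j _ => ?_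
      field_simp
    have h3 : ∑ i, |v i| ≤ (d + 1) * ‖v‖ := by
      calc ∑ i, |v i| ≤ ∑ _i : Fin d, ‖v‖ := Finset.sum_le_sum fun i _ => norm_le_pi_norm v i
        _ = d * ‖v‖ := by simp
        _ ≤ _ := by nlinarith
    have h4 : 0 ≤ ∑ i, |v i| := Finset.sum_nonneg fun i _ => abs_nonneg _
    rw [h2, le_div_iff₀ (by positivity)] at h1
    calc Qf v0 / (d + 1) ^ 2 * (∑ i, |v i|) ^ 2
        ≤ Qf v0 / (d + 1) ^ 2 * ((d + 1) * ‖v‖) ^ 2 := by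
          have := (hQpos _ hv0').le
          gcongr
      _ = Qf v0 * ‖v‖ ^ 2 := by field_simp
      _ ≤ _ := h1
  · refine ⟨1, one_pos, fun v => ?_⟩
    have hv : v = 0 := by
      by_contra hv
      exact hd ⟨‖v‖⁻¹ • v, by simp [norm_smul, norm_ne_zero_iff.mpr hv]⟩
    subst hv; simp

end Features

/-! ### The loss and its excess over the oracle -/

section Loss

variable {d : ℕ}

/-- A pair of mean functions that are linear in the covariates and the surrogate of the arm. -/
def linMean (β : Fin 2 → Fin d → ℝ) (g : Fin 2 → ℝ) (z : Fin 2) (x : Fin d → ℝ) (s : Fin 2 → ℝ) : ℝ :=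
  β z ⬝ᵥ x + g z * s z

theorem measurable_linMean (β : Fin 2 → Fin d → ℝ) (g : Fin 2 → ℝ) (z : Fin 2) :
    Measurable fun p : (Fin d → ℝ) × (Fin 2 → ℝ) => linMean β g z p.1 p.2 := by
  unfold linMean
  exact (measurable_dotProduct measurable_const measurable_fst).add (by fun_prop)

theorem prod_assignLaw (P : Measure (Subject d)) [IsProbabilityMeasure P] (p : ℝ) :
    P.prod (assignLaw p) = ENNReal.ofReal p • P.map (fun w => (w, (1 : Fin 2)))
      + ENNReal.ofReal (1 - p) • P.map (fun w => (w, (0 : Fin 2))) := by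
  have h1 : IsFiniteMeasure (ENNReal.ofReal p • Measure.dirac (1 : Fin 2)) :=
    Measure.smul_finite _ ENNReal.ofReal_ne_top
  have h2 : IsFiniteMeasure (ENNReal.ofReal (1 - p) • Measure.dirac (0 : Fin 2)) :=
    Measure.smul_finite _ ENNReal.ofReal_ne_top
  rw [assignLaw, Measure.prod_add, Measure.prod_smul_right, Measure.prod_smul_right,
    Measure.prod_dirac, Measure.prod_dirac]

theorem integral_prod_assignLaw (P : Measure (Subject d)) [IsProbabilityMeasure P] {p : ℝ}
    (h0 : 0 ≤ p) (h1 : p ≤ 1) {f : Subject d × Fin 2 → ℝ} (hf : Measurable f)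
    (i1 : Integrable (fun w => f (w, 1)) P) (i0 : Integrable (fun w => f (w, 0)) P) :
    ∫ q, f q ∂(P.prod (assignLaw p)) = p * ∫ w, f (w, 1) ∂P + (1 - p) * ∫ w, f (w, 0) ∂P := by
  have m1 : AEMeasurable (fun w : Subject d => (w, (1 : Fin 2))) P := by fun_prop
  have m0 : AEMeasurable (fun w : Subject d => (w, (0 : Fin 2))) P := by fun_prop
  have j1 : Integrable f (P.map (fun w => (w, (1 : Fin 2)))) :=
    (integrable_map_measure hf.aestronglyMeasurable m1).mpr i1
  have j0 : Integrable f (P.map (fun w => (w, (0 : Fin 2)))) :=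
    (integrable_map_measure hf.aestronglyMeasurable m0).mpr i0
  rw [prod_assignLaw, integral_add_measure (j1.smul_measure ENNReal.ofReal_ne_top)
    (j0.smul_measure ENNReal.ofReal_ne_top), integral_smul_measure, integral_smul_measure,
    integral_map m1 hf.aestronglyMeasurable, integral_map m0 hf.aestronglyMeasurable,
    ENNReal.toReal_ofReal h0, ENNReal.toReal_ofReal (by linarith), smul_eq_mul, smul_eq_mul]

theorem phi_one (a : Action d) (w : Subject d) :
    phi a w 1 = a.mean 1 w.x w.s - a.mean 0 w.x w.s + (w.y 1 - a.mean 1 w.x w.s) / a.prob := by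
  simp [phi]

theorem phi_zero (a : Action d) (w : Subject d) :
    phi a w 0 = a.mean 1 w.x w.s - a.mean 0 w.x w.s
      - (w.y 0 - a.mean 0 w.x w.s) / (1 - a.prob) := by
  simp [phi]

/-- Law of total variance given the unit. The conditional mean of `phi` is `y 1 - y 0` whatever the
mean functions are, and its conditional variance is `p (1 - p) (phi a w 1 - phi a w 0)²`. -/
theorem loss_eq {P : Measure (Subject d)} [IsProbabilityMeasure P] {a : Action d}
    (h0 : 0 < a.prob) (h1 : a.prob < 1)
    (hm : ∀ z, Measurable fun w : Subject d => a.mean z w.x w.s)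
    (hL : ∀ z, MemLp (fun w : Subject d => a.mean z w.x w.s) 2 P)
    (hy : ∀ z, MemLp (fun w : Subject d => w.y z) 2 P) :
    loss P a = Var[fun w => w.y 1 - w.y 0; P]
      + (∫ w, ((1 - a.prob) * (w.y 1 - a.mean 1 w.x w.s)
          + a.prob * (w.y 0 - a.mean 0 w.x w.s)) ^ 2 ∂P) / (a.prob * (1 - a.prob)) := by
  set p := a.prob with hp
  have hp1 : 0 < 1 - p := by linarith
  have hφ : Measurable fun q : Subject d × Fin 2 => phi a q.1 q.2 := by
    apply measurable_from_prod_countable_left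
    intro z
    fin_cases z
    · have e : (fun w : Subject d => phi a w 0) = _ := funext (phi_zero a)
      change Measurable fun w : Subject d => phi a w 0
      rw [e]; fun_prop
    · have e : (fun w : Subject d => phi a w 1) = _ := funext (phi_one a)
      change Measurable fun w : Subject d => phi a w 1
      rw [e]; fun_prop
  have L1 : MemLp (fun w => phi a w 1) 2 P := by
    simp_rw [phi_one, div_eq_mul_inv]
    exact ((hL 1).sub (hL 0)).add (((hy 1).sub (hL 1)).mul_const _)
  have L0 : MemLp (fun w => phi a w 0) 2 P := by
    simp_rw [phi_zero, div_eq_mul_inv]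
    exact ((hL 1).sub (hL 0)).sub (((hy 0).sub (hL 0)).mul_const _)
  have hmean : ∫ q, phi a q.1 q.2 ∂(P.prod (assignLaw p)) = ∫ w, (w.y 1 - w.y 0) ∂P := by
    rw [integral_prod_assignLaw P h0.le h1.le hφ (L1.integrable one_le_two)
      (L0.integrable one_le_two), ← integral_const_mul, ← integral_const_mul,
      ← integral_add ((L1.integrable one_le_two).const_mul _)
        ((L0.integrable one_le_two).const_mul _)]
    refine integral_congr_ae (ae_of_all _ fun w => ?_)
    simp only [phi_one, phi_zero, ← hp]
    field_simp
    ring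
  set M := ∫ w, (w.y 1 - w.y 0) ∂P with hM
  have S1 : Integrable (fun w => (phi a w 1 - M) ^ 2) P :=
    (L1.sub (memLp_const M)).integrable_sq
  have S0 : Integrable (fun w => (phi a w 0 - M) ^ 2) P :=
    (L0.sub (memLp_const M)).integrable_sq
  have T1 : Integrable (fun w : Subject d => (w.y 1 - w.y 0 - M) ^ 2) P :=
    (((hy 1).sub (hy 0)).sub (memLp_const M)).integrable_sq
  have T2 : Integrable (fun w : Subject d => ((1 - p) * (w.y 1 - a.mean 1 w.x w.s)
      + p * (w.y 0 - a.mean 0 w.x w.s)) ^ 2) P :=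
    ((((hy 1).sub (hL 1)).const_mul (1 - p)).add
      (((hy 0).sub (hL 0)).const_mul p)).integrable_sq
  rw [loss, ← hp, variance_eq_integral hφ.aemeasurable, hmean,
    integral_prod_assignLaw P h0.le h1.le ((hφ.sub_const M).pow_const 2) S1 S0,
    variance_eq_integral (by fun_prop), ← hM, ← integral_const_mul, ← integral_const_mul,
    ← integral_add (S1.const_mul _) (S0.const_mul _), ← integral_div,
    ← integral_add T1 (T2.div_const _)]
  refine integral_congr_ae (ae_of_all _ fun w => ?_)
  simp only [phi_one, phi_zero, ← hp]
  field_simp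
  ring

variable {P : Measure (Subject d)} [IsProbabilityMeasure P] {θ : Params d}

theorem memLp_linMean (herr : SubGaussianErrors P θ) (hcov : CovariateCondition P)
    (β : Fin 2 → Fin d → ℝ) (g : Fin 2 → ℝ) (z : Fin 2) :
    MemLp (fun w : Subject d => linMean β g z w.x w.s) 2 P :=
  (memLp_dotProduct_x herr hcov (β z)).add ((memLp_s herr hcov z).const_mul (g z))

theorem measurable_linMean_comp (β : Fin 2 → Fin d → ℝ) (g : Fin 2 → ℝ) (z : Fin 2) :
    Measurable fun w : Subject d => linMean β g z w.x w.s :=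
  (measurable_linMean β g z).comp (measurable_x.prodMk measurable_s)

theorem condMean_eq_linMean (θ : Params d) :
    θ.condMean = linMean (fun z => θ.αY z - θ.γ z • θ.αS z) θ.γ := rfl

theorem y_sub_condMean (θ : Params d) (z : Fin 2) (w : Subject d) :
    w.y z - θ.condMean z w.x w.s = θ.ε z w := by
  simp only [Params.condMean, Params.ε, Params.εY, Params.εS, sub_dotProduct, smul_dotProduct,
    smul_eq_mul]
  ring

/-- The loss as a function of the allocation and the deviation of the mean functions. -/
theorem loss_linMean (hmodel : LinearModel P θ) (herr : SubGaussianErrors P θ)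
    (hcov : CovariateCondition P) {p : ℝ} (h0 : 0 < p) (h1 : p < 1)
    (β : Fin 2 → Fin d → ℝ) (g : Fin 2 → ℝ) :
    loss P ⟨p, linMean β g⟩ = Var[fun w => w.y 1 - w.y 0; P] + 2 * ∫ w, θ.ε 1 w * θ.ε 0 w ∂P
      + (1 - p) / p * θ.σ 1 ^ 2 + p / (1 - p) * θ.σ 0 ^ 2
      + (∫ w, ((1 - p) * (linMean β g 1 w.x w.s - θ.condMean 1 w.x w.s)
          + p * (linMean β g 0 w.x w.s - θ.condMean 0 w.x w.s)) ^ 2 ∂P) / (p * (1 - p)) := by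
  have hp1 : 0 < 1 - p := by linarith
  rw [loss_eq h0 h1 (measurable_linMean_comp β g) (memLp_linMean herr hcov β g)
    (memLp_y herr hcov)]
  set f : (Fin d → ℝ) × (Fin 2 → ℝ) → ℝ := fun q =>
    (1 - p) * (linMean β g 1 q.1 q.2 - θ.condMean 1 q.1 q.2)
      + p * (linMean β g 0 q.1 q.2 - θ.condMean 0 q.1 q.2) with hf
  have hfm : Measurable f := by
    rw [hf, condMean_eq_linMean]
    have := measurable_linMean β g
    have := measurable_linMean (fun z => θ.αY z - θ.γ z • θ.αS z) θ.γ
    fun_prop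
  have hfL : MemLp (fun w : Subject d => f (w.x, w.s)) 2 P := by
    simp only [hf, condMean_eq_linMean]
    exact (((memLp_linMean herr hcov _ _ 1).sub (memLp_linMean herr hcov _ _ 1)).const_mul _).add
      (((memLp_linMean herr hcov _ _ 0).sub (memLp_linMean herr hcov _ _ 0)).const_mul _)
  -- `f` collects the errors of the mean functions. It depends on `(x, s)` only, so its products
  -- with the noises integrate to zero. The product of the two noises survives, but with a
  -- coefficient that cancels `p (1 - p)`, so it does not depend on the action.
  have e : ∀ w : Subject d, ((1 - p) * (w.y 1 - linMean β g 1 w.x w.s)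
      + p * (w.y 0 - linMean β g 0 w.x w.s)) ^ 2
      = (1 - p) ^ 2 * θ.ε 1 w ^ 2 + p ^ 2 * θ.ε 0 w ^ 2
        + 2 * (p * (1 - p)) * (θ.ε 1 w * θ.ε 0 w) + f (w.x, w.s) ^ 2
        - 2 * (1 - p) * (f (w.x, w.s) * θ.ε 1 w) - 2 * p * (f (w.x, w.s) * θ.ε 0 w) := by
    intro w
    rw [← y_sub_condMean θ 1 w, ← y_sub_condMean θ 0 w]
    simp only [hf]
    ring
  have ε1 := memLp_ε herr hcov 1 (P := P)
  have ε0 := memLp_ε herr hcov 0 (P := P)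
  have I1 := ε1.integrable_sq.const_mul ((1 - p) ^ 2)
  have I2 := ε0.integrable_sq.const_mul (p ^ 2)
  have I3 : Integrable (fun w => 2 * (p * (1 - p)) * (θ.ε 1 w * θ.ε 0 w)) P :=
    (ε1.integrable_mul ε0).const_mul _
  have I4 := hfL.integrable_sq
  have I5 : Integrable (fun w => 2 * (1 - p) * (f (w.x, w.s) * θ.ε 1 w)) P :=
    (hfL.integrable_mul ε1).const_mul _
  have I6 : Integrable (fun w => 2 * p * (f (w.x, w.s) * θ.ε 0 w)) P :=
    (hfL.integrable_mul ε0).const_mul _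
  simp_rw [e]
  rw [integral_sub _ I6, integral_sub _ I5, integral_add _ I4, integral_add _ I3,
    integral_add I1 I2, integral_const_mul, integral_const_mul, integral_const_mul,
    integral_const_mul, integral_const_mul, integral_mul_ε hmodel herr hcov 1 hfm hfL,
    integral_mul_ε hmodel herr hcov 0 hfm hfL, integral_ε_sq hmodel, integral_ε_sq hmodel]
  · field_simp
    ring
  · exact I1.add I2
  · exact (I1.add I2).add I3
  · exact ((I1.add I2).add I3).add I4
  · exact (((I1.add I2).add I3).add I4).sub I5

omit [IsProbabilityMeasure P] in
theorem πStar_pos (hmodel : LinearModel P θ) : 0 < θ.πStar :=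
  div_pos (hmodel.σ_pos 1) (add_pos (hmodel.σ_pos 0) (hmodel.σ_pos 1))

omit [IsProbabilityMeasure P] in
theorem one_sub_πStar (hmodel : LinearModel P θ) : 1 - θ.πStar = θ.σ 0 / (θ.σ 0 + θ.σ 1) := by
  have := hmodel.σ_pos 0
  have := hmodel.σ_pos 1
  unfold Params.πStar
  field_simp
  ring

omit [IsProbabilityMeasure P] in
theorem πStar_lt_one (hmodel : LinearModel P θ) : θ.πStar < 1 := by
  have := div_pos (hmodel.σ_pos 0) (add_pos (hmodel.σ_pos 0) (hmodel.σ_pos 1))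
  rw [← one_sub_πStar hmodel] at this
  linarith

omit [IsProbabilityMeasure P] in
theorem πLow_pos (hmodel : LinearModel P θ) : 0 < θ.πLow :=
  lt_min (πStar_pos hmodel) (sub_pos.mpr (πStar_lt_one hmodel))

omit [IsProbabilityMeasure P] in
theorem πLow_le_half : θ.πLow ≤ 1 / 2 := by
  have h1 : θ.πLow ≤ θ.πStar := min_le_left _ _
  have h2 : θ.πLow ≤ 1 - θ.πStar := min_le_right _ _
  linarith

theorem loss_optAction (hmodel : LinearModel P θ) (herr : SubGaussianErrors P θ)
    (hcov : CovariateCondition P) :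
    loss P (optAction θ) = Var[fun w => w.y 1 - w.y 0; P] + 2 * ∫ w, θ.ε 1 w * θ.ε 0 w ∂P
      + 2 * (θ.σ 0 * θ.σ 1) := by
  have h := loss_linMean hmodel herr hcov (πStar_pos hmodel) (πStar_lt_one hmodel)
    (fun z => θ.αY z - θ.γ z • θ.αS z) θ.γ
  rw [optAction, condMean_eq_linMean, h, condMean_eq_linMean]
  have e0 := hmodel.σ_pos 0
  have e1 := hmodel.σ_pos 1
  simp only [sub_self, mul_zero, add_zero, ne_eq, OfNat.ofNat_ne_zero, not_false_eq_true, zero_pow,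
    integral_zero, zero_div, one_sub_πStar hmodel]
  unfold Params.πStar
  field_simp
  ring

/-- Substituting `s(z) = α_Sᵀ x + ε_S(z)` splits the error into a bounded covariate part and a
surrogate-error part. This is why accuracy is measured by the combination `β z + g z • θ.αS z - θ.αY
z`. -/
theorem linMean_sub_condMean (θ : Params d) (β : Fin 2 → Fin d → ℝ) (g : Fin 2 → ℝ) (z : Fin 2)
    (w : Subject d) :
    linMean β g z w.x w.s - θ.condMean z w.x w.s
      = (β z + g z • θ.αS z - θ.αY z) ⬝ᵥ w.x + (g z - θ.γ z) * θ.εS z w := by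
  simp only [linMean, Params.condMean, Params.εS, sub_dotProduct, add_dotProduct, smul_dotProduct,
    smul_eq_mul]
  ring

theorem abs_dotProduct_le (u v : Fin d → ℝ) {A B : ℝ} (hu : ∑ i, |u i| ≤ A) (hB : 0 ≤ B)
    (hv : ∀ i, |v i| ≤ B) : |u ⬝ᵥ v| ≤ A * B := by
  calc |u ⬝ᵥ v| ≤ ∑ i, |u i * v i| := Finset.abs_sum_le_sum_abs _ _
    _ ≤ ∑ i, |u i| * B := Finset.sum_le_sum fun i _ => by
        rw [abs_mul]; exact mul_le_mul_of_nonneg_left (hv i) (abs_nonneg _)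
    _ = (∑ i, |u i|) * B := by rw [Finset.sum_mul]
    _ ≤ A * B := by gcongr

/-- The excess loss is quadratic in the errors of the allocation and of the coefficients. -/
theorem exists_loss_sub_le (hmodel : LinearModel P θ) (herr : SubGaussianErrors P θ)
    (hcov : CovariateCondition P) :
    ∃ C : ℝ, 0 ≤ C ∧ ∀ (p : ℝ) (β : Fin 2 → Fin d → ℝ) (g : Fin 2 → ℝ) (ρ : ℝ), 0 ≤ ρ →
      θ.πLow / 2 ≤ p → θ.πLow / 2 ≤ 1 - p → |p - θ.πStar| ≤ ρ →
      (∀ z, ∑ i, |(β z + g z • θ.αS z - θ.αY z) i| ≤ ρ) → (∀ z, |g z - θ.γ z| ≤ ρ) →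
      loss P ⟨p, linMean β g⟩ - loss P (optAction θ) ≤ C * ρ ^ 2 := by
  obtain ⟨B, hB0, hB⟩ := exists_abs_x_le hcov
  have hl := πLow_pos hmodel
  set E : ℝ := ∫ w, (4 * B ^ 2 + 2 * θ.εS 0 w ^ 2 + 2 * θ.εS 1 w ^ 2) ∂P with hE
  have hE0 : 0 ≤ E := integral_nonneg fun w => by positivity
  refine ⟨((θ.σ 0 + θ.σ 1) ^ 2 + E) / (θ.πLow / 2) ^ 2, by positivity, ?_⟩
  intro p β g ρ hρ hp hp' hpi hβ hg
  have h0 : 0 < p := by linarith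
  have h1 : 0 < 1 - p := by linarith
  have e0 := hmodel.σ_pos 0
  have e1 := hmodel.σ_pos 1
  rw [loss_linMean hmodel herr hcov h0 (by linarith), loss_optAction hmodel herr hcov]
  set R : ℝ := ∫ w, ((1 - p) * (linMean β g 1 w.x w.s - θ.condMean 1 w.x w.s)
          + p * (linMean β g 0 w.x w.s - θ.condMean 0 w.x w.s)) ^ 2 ∂P with hR
  have hint : Integrable (fun w => 4 * B ^ 2 + 2 * θ.εS 0 w ^ 2 + 2 * θ.εS 1 w ^ 2) P :=
    ((integrable_const _).add ((memLp_εS herr hcov 0).integrable_sq.const_mul 2)).add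
      ((memLp_εS herr hcov 1).integrable_sq.const_mul 2)
  have hRle : R ≤ E * ρ ^ 2 := by
    rw [hR, hE, ← integral_mul_const]
    refine integral_mono_of_nonneg (ae_of_all _ fun w => sq_nonneg _) (hint.mul_const _) ?_
    filter_upwards [hB] with w hw
    have hh : ∀ z, (linMean β g z w.x w.s - θ.condMean z w.x w.s) ^ 2
        ≤ (2 * B ^ 2 + 2 * θ.εS z w ^ 2) * ρ ^ 2 := by
      intro z
      rw [linMean_sub_condMean]
      have a1 := abs_dotProduct_le _ w.x (hβ z) hB0 hw
      have a2 : |(g z - θ.γ z) * θ.εS z w| ≤ ρ * |θ.εS z w| := by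
        rw [abs_mul]; exact mul_le_mul_of_nonneg_right (hg z) (abs_nonneg _)
      have b1 := sq_le_sq' (abs_le.mp a1).1 (abs_le.mp a1).2
      have b2 := sq_le_sq' (abs_le.mp a2).1 (abs_le.mp a2).2
      rw [mul_pow ρ, sq_abs] at b2
      nlinarith [sq_nonneg ((β z + g z • θ.αS z - θ.αY z) ⬝ᵥ w.x - (g z - θ.γ z) * θ.εS z w)]
    have c1 := hh 1
    have c0 := hh 0
    set u := linMean β g 1 w.x w.s - θ.condMean 1 w.x w.s
    set v := linMean β g 0 w.x w.s - θ.condMean 0 w.x w.s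
    -- Convexity of the square, with both weights then bounded by one.
    have : ((1 - p) * u + p * v) ^ 2 ≤ u ^ 2 + v ^ 2 := by
      have : ((1 - p) * u + p * v) ^ 2 = (1 - p) * u ^ 2 + p * v ^ 2 - p * (1 - p) * (u - v) ^ 2 := by
        ring
      nlinarith [mul_nonneg (mul_pos h0 h1).le (sq_nonneg (u - v)),
        mul_nonneg h0.le (sq_nonneg u), mul_nonneg h1.le (sq_nonneg v)]
    nlinarith
  have hpp : (θ.πLow / 2) ^ 2 ≤ p * (1 - p) := by
    rw [sq]; exact mul_le_mul hp hp' (by positivity) h0.le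
  -- The Neyman objective is minimal at `π*`, so its excess is an exact square.
  have key : (1 - p) / p * θ.σ 1 ^ 2 + p / (1 - p) * θ.σ 0 ^ 2 - 2 * (θ.σ 0 * θ.σ 1)
      = (θ.σ 0 + θ.σ 1) ^ 2 * (p - θ.πStar) ^ 2 / (p * (1 - p)) := by
    unfold Params.πStar
    field_simp
    ring
  have hsq : (p - θ.πStar) ^ 2 ≤ ρ ^ 2 := sq_le_sq' (abs_le.mp hpi).1 (abs_le.mp hpi).2
  have : (θ.σ 0 + θ.σ 1) ^ 2 * (p - θ.πStar) ^ 2 / (p * (1 - p)) + R / (p * (1 - p))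
      ≤ ((θ.σ 0 + θ.σ 1) ^ 2 + E) / (θ.πLow / 2) ^ 2 * ρ ^ 2 := by
    rw [← add_div, div_mul_eq_mul_div]
    have hn : 0 ≤ ((θ.σ 0 + θ.σ 1) ^ 2 + E) * ρ ^ 2 := by positivity
    refine div_le_div₀ hn ?_ (by positivity) hpp
    nlinarith [mul_le_mul_of_nonneg_left hsq (sq_nonneg (θ.σ 0 + θ.σ 1))]
  linarith

end Loss

/-! ### Accuracy of the estimators when the empirical moments are accurate -/

section Estimation

variable {d : ℕ}

theorem abs_sum_sum_mul_le (u v : Fin d → ℝ) (E : Fin d → Fin d → ℝ) {B : ℝ}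
    (hE : ∀ i j, |E i j| ≤ B) :
    |∑ i, ∑ j, u i * v j * E i j| ≤ B * ((∑ i, |u i|) * ∑ j, |v j|) := by
  calc |∑ i, ∑ j, u i * v j * E i j| ≤ ∑ i, |∑ j, u i * v j * E i j| :=
        Finset.abs_sum_le_sum_abs _ _
    _ ≤ ∑ i, ∑ j, |u i * v j * E i j| := Finset.sum_le_sum fun i _ =>
        Finset.abs_sum_le_sum_abs _ _
    _ ≤ ∑ i, ∑ j, B * (|u i| * |v j|) := by
        refine Finset.sum_le_sum fun i _ => Finset.sum_le_sum fun j _ => ?_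
        rw [abs_mul, abs_mul, mul_comm B]
        exact mul_le_mul_of_nonneg_left (hE i j) (by positivity)
    _ = _ := by rw [Finset.sum_mul_sum, Finset.mul_sum]; simp_rw [Finset.mul_sum]

theorem abs_dotProduct_le' (u v : Fin d → ℝ) {B : ℝ} (hv : ∀ i, |v i| ≤ B) :
    |u ⬝ᵥ v| ≤ B * ∑ i, |u i| := by
  calc |u ⬝ᵥ v| ≤ ∑ i, |u i * v i| := Finset.abs_sum_le_sum_abs _ _
    _ ≤ ∑ i, B * |u i| := Finset.sum_le_sum fun i _ => by
        rw [abs_mul, mul_comm]; exact mul_le_mul_of_nonneg_right (hv i) (abs_nonneg _)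
    _ = _ := by rw [Finset.mul_sum]

theorem dotProduct_gram_mulVec (D : ℕ → Obs d) (I : Finset ℕ) (u v : Fin d → ℝ) :
    u ⬝ᵥ ((∑ j ∈ I, Matrix.vecMulVec (xAt D j) (xAt D j)) *ᵥ v)
      = ∑ i, ∑ k, u i * v k * ∑ j ∈ I, xAt D j i * xAt D j k := by
  simp only [dotProduct, Matrix.mulVec, Finset.mul_sum, Matrix.sum_apply, Matrix.vecMulVec_apply,
    Finset.sum_mul]
  refine Finset.sum_congr rfl fun i _ => Finset.sum_congr rfl fun k _ =>
    Finset.sum_congr rfl fun j _ => by ring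

/-- The Gram matrix `A` keeps half of the coercivity of `N S`, so it is invertible. With `v` the
coefficient error, the normal equations turn `vᵀ A v` into a pairing of `v` with the small vector of
covariate-residual sums; comparing with the quadratic lower bound gives a linear one. -/
theorem ols_sub_le {S : Matrix (Fin d) (Fin d) ℝ} {l : ℝ} (hl : 0 < l)
    (hS : ∀ v : Fin d → ℝ, l * (∑ i, |v i|) ^ 2 ≤ ∑ i, ∑ j, v i * v j * S i j)
    (D : ℕ → Obs d) (I : Finset ℕ) (r : ℕ → ℝ) (α : Fin d → ℝ) {N ρ : ℝ} (hN : 0 < N)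
    (hρl : ρ ≤ l / 2)
    (hA : ∀ i k, |∑ j ∈ I, xAt D j i * xAt D j k - N * S i k| ≤ N * ρ)
    (hb : ∀ i, |∑ j ∈ I, xAt D j i * (r j - α ⬝ᵥ xAt D j)| ≤ N * ρ) (hρ : 0 ≤ ρ) :
    ∑ i, |(ols D I r - α) i| ≤ 2 / l * ρ := by
  set A : Matrix (Fin d) (Fin d) ℝ := ∑ j ∈ I, Matrix.vecMulVec (xAt D j) (xAt D j) with hAdef
  have hlow : ∀ v : Fin d → ℝ, N * (l / 2) * (∑ i, |v i|) ^ 2 ≤ v ⬝ᵥ (A *ᵥ v) := by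
    intro v
    rw [hAdef, dotProduct_gram_mulVec]
    have h1 := abs_sum_sum_mul_le v v
      (fun i k => ∑ j ∈ I, xAt D j i * xAt D j k - N * S i k) hA
    have h2 : ∑ i, ∑ k, v i * v k * (∑ j ∈ I, xAt D j i * xAt D j k - N * S i k)
        = ∑ i, ∑ k, v i * v k * (∑ j ∈ I, xAt D j i * xAt D j k)
          - N * ∑ i, ∑ k, v i * v k * S i k := by
      simp_rw [mul_sub, Finset.sum_sub_distrib, Finset.mul_sum]
      congr 1
      refine Finset.sum_congr rfl fun i _ => Finset.sum_congr rfl fun k _ => by ring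
    rw [h2] at h1
    have h3 := (abs_le.mp h1).1
    have h4 := mul_le_mul_of_nonneg_left (hS v) hN.le
    have h5 : N * ρ * ((∑ i, |v i|) * ∑ i, |v i|) ≤ N * (l / 2) * ((∑ i, |v i|) * ∑ i, |v i|) := by
      have : 0 ≤ (∑ i, |v i|) * ∑ i, |v i| := mul_self_nonneg _
      gcongr
    nlinarith
  have hNl : 0 < N * (l / 2) := by positivity
  have hunit : IsUnit A := by
    rw [← Matrix.mulVec_injective_iff_isUnit]
    intro v w hvw
    have h0 : A *ᵥ (v - w) = 0 := by rw [Matrix.mulVec_sub, sub_eq_zero]; exact hvw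
    have h1 := hlow (v - w)
    rw [h0, dotProduct_zero] at h1
    have h2 : (∑ i, |(v - w) i|) ^ 2 ≤ 0 := by
      by_contra h
      push Not at h
      nlinarith [mul_pos hNl h]
    have h3 : ∑ i, |(v - w) i| = 0 := by
      have := le_antisymm h2 (sq_nonneg _)
      exact pow_eq_zero_iff (two_ne_zero) |>.mp this
    rw [Finset.sum_eq_zero_iff_of_nonneg fun i _ => abs_nonneg _] at h3
    ext i
    have := h3 i (Finset.mem_univ i)
    simpa [sub_eq_zero] using this
  have hdet : IsUnit A.det := (Matrix.isUnit_iff_isUnit_det A).mp hunit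
  set v := ols D I r - α with hv
  have hAv : A *ᵥ v = fun i => ∑ j ∈ I, xAt D j i * (r j - α ⬝ᵥ xAt D j) := by
    have h1 : A *ᵥ ols D I r = ∑ j ∈ I, r j • xAt D j := by
      rw [ols, ← hAdef, Matrix.mulVec_mulVec, Matrix.mul_nonsing_inv _ hdet, Matrix.one_mulVec]
    ext i
    rw [hv, Matrix.mulVec_sub, h1]
    simp only [Pi.sub_apply, Finset.sum_apply, Pi.smul_apply, smul_eq_mul, hAdef, Matrix.mulVec,
      dotProduct, Matrix.sum_apply, Matrix.vecMulVec_apply, Finset.sum_mul, mul_sub, Finset.mul_sum,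
      Finset.sum_sub_distrib]
    rw [Finset.sum_comm]
    congr 1
    · exact Finset.sum_congr rfl fun j _ => by ring
    · exact Finset.sum_congr rfl fun j _ => Finset.sum_congr rfl fun k _ => by ring
  have h1 := hlow v
  have h2 : v ⬝ᵥ (A *ᵥ v) ≤ N * ρ * ∑ i, |v i| := by
    refine (le_abs_self _).trans (abs_dotProduct_le' _ _ fun i => ?_)
    rw [hAv]
    exact hb i
  have hs : 0 ≤ ∑ i, |v i| := Finset.sum_nonneg fun i _ => abs_nonneg _
  rcases hs.eq_or_lt with h | h
  · rw [← h]; positivity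
  · have h3 : N * (l / 2) * (∑ i, |v i|) ≤ N * ρ := by
      refine le_of_mul_le_mul_right ?_ h
      nlinarith
    have h4 : l / 2 * (∑ i, |v i|) ≤ ρ := by
      refine le_of_mul_le_mul_left ?_ hN
      linarith
    rw [div_mul_eq_mul_div, le_div_iff₀ hl]
    linarith

/-- Replacing errors by fitted residuals changes the product sum by two terms linear and one term
bilinear in the coefficient errors `a`, `b`; `ρ ≤ 1` makes all of them `O(N ρ)`. -/
theorem residual_sum_sub_le {S : Matrix (Fin d) (Fin d) ℝ} {B : ℝ}
    (hB0 : 0 ≤ B) (hB : ∀ i k, |S i k| ≤ B)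
    (D : ℕ → Obs d) (I : Finset ℕ) (e f : ℕ → ℝ) (a b : Fin d → ℝ) {N ρ C m : ℝ} (hN : 0 < N)
    (hρ : 0 ≤ ρ) (hρ1 : ρ ≤ 1) (hC : 0 ≤ C)
    (hA : ∀ i k, |∑ j ∈ I, xAt D j i * xAt D j k - N * S i k| ≤ N * ρ)
    (he : ∀ i, |∑ j ∈ I, xAt D j i * e j| ≤ N * ρ)
    (hf : ∀ i, |∑ j ∈ I, xAt D j i * f j| ≤ N * ρ)
    (hef : |∑ j ∈ I, e j * f j - N * m| ≤ N * ρ)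
    (ha : ∑ i, |a i| ≤ C * ρ) (hb : ∑ i, |b i| ≤ C * ρ) :
    |∑ j ∈ I, (e j - a ⬝ᵥ xAt D j) * (f j - b ⬝ᵥ xAt D j) - N * m|
      ≤ N * ((1 + 2 * C + C ^ 2 * (B + 1)) * ρ) := by
  have ha0 : 0 ≤ ∑ i, |a i| := Finset.sum_nonneg fun i _ => abs_nonneg _
  have hb0 : 0 ≤ ∑ i, |b i| := Finset.sum_nonneg fun i _ => abs_nonneg _
  have expand : ∑ j ∈ I, (e j - a ⬝ᵥ xAt D j) * (f j - b ⬝ᵥ xAt D j)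
      = ∑ j ∈ I, e j * f j - a ⬝ᵥ (fun i => ∑ j ∈ I, xAt D j i * f j)
        - b ⬝ᵥ (fun i => ∑ j ∈ I, xAt D j i * e j)
        + ∑ i, ∑ k, a i * b k * ∑ j ∈ I, xAt D j i * xAt D j k := by
    have h1 : a ⬝ᵥ (fun i => ∑ j ∈ I, xAt D j i * f j) = ∑ j ∈ I, (a ⬝ᵥ xAt D j) * f j := by
      simp only [dotProduct, Finset.mul_sum, Finset.sum_mul]
      rw [Finset.sum_comm]
      exact Finset.sum_congr rfl fun j _ => Finset.sum_congr rfl fun i _ => by ring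
    have h2 : b ⬝ᵥ (fun i => ∑ j ∈ I, xAt D j i * e j) = ∑ j ∈ I, (b ⬝ᵥ xAt D j) * e j := by
      simp only [dotProduct, Finset.mul_sum, Finset.sum_mul]
      rw [Finset.sum_comm]
      exact Finset.sum_congr rfl fun j _ => Finset.sum_congr rfl fun i _ => by ring
    have h3 : ∑ i, ∑ k, a i * b k * ∑ j ∈ I, xAt D j i * xAt D j k
        = ∑ j ∈ I, (a ⬝ᵥ xAt D j) * (b ⬝ᵥ xAt D j) := by
      have h4 : ∀ j, (a ⬝ᵥ xAt D j) * (b ⬝ᵥ xAt D j)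
          = ∑ i, ∑ k, a i * b k * (xAt D j i * xAt D j k) := fun j => by
        rw [dotProduct, dotProduct, Finset.sum_mul_sum]
        exact Finset.sum_congr rfl fun i _ => Finset.sum_congr rfl fun k _ => by ring
      simp_rw [h4, Finset.mul_sum]
      simp_rw [fun i => Finset.sum_comm (s := (Finset.univ : Finset (Fin d))) (t := I)
        (f := fun k j => a i * b k * (xAt D j i * xAt D j k))]
      rw [Finset.sum_comm]
    rw [h1, h2, h3, ← Finset.sum_sub_distrib, ← Finset.sum_sub_distrib, ← Finset.sum_add_distrib]
    exact Finset.sum_congr rfl fun j _ => by ring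
  have hNρ : 0 ≤ N * ρ := by positivity
  have b1 := abs_dotProduct_le' a _ hf
  have b2 := abs_dotProduct_le' b _ he
  have hG : ∀ i k, |∑ j ∈ I, xAt D j i * xAt D j k| ≤ N * (B + 1) := by
    intro i k
    have h1 : |∑ j ∈ I, xAt D j i * xAt D j k|
        ≤ |∑ j ∈ I, xAt D j i * xAt D j k - N * S i k| + |N * S i k| := by
      simpa using abs_add_le (∑ j ∈ I, xAt D j i * xAt D j k - N * S i k) (N * S i k)
    have h2 : |N * S i k| ≤ N * B := by
      rw [abs_mul, abs_of_pos hN]; exact mul_le_mul_of_nonneg_left (hB i k) hN.le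
    have h3 := hA i k
    nlinarith
  have b3 := abs_sum_sum_mul_le a b (fun i k => ∑ j ∈ I, xAt D j i * xAt D j k) hG
  have c1 : N * ρ * ∑ i, |a i| ≤ N * (C * ρ) := by
    have : ρ * ∑ i, |a i| ≤ 1 * (C * ρ) := mul_le_mul hρ1 ha ha0 zero_le_one
    nlinarith
  have c2 : N * ρ * ∑ i, |b i| ≤ N * (C * ρ) := by
    have : ρ * ∑ i, |b i| ≤ 1 * (C * ρ) := mul_le_mul hρ1 hb hb0 zero_le_one
    nlinarith
  have c3 : N * (B + 1) * ((∑ i, |a i|) * ∑ i, |b i|) ≤ N * (B + 1) * (C ^ 2 * ρ) := by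
    have h1 : (∑ i, |a i|) * ∑ i, |b i| ≤ C * ρ * (C * ρ) := mul_le_mul ha hb hb0 (by positivity)
    have h2 : C * ρ * (C * ρ) ≤ C ^ 2 * ρ := by
      have : C ^ 2 * (ρ * ρ) ≤ C ^ 2 * (ρ * 1) := by gcongr
      nlinarith
    have := h1.trans h2
    gcongr
  rw [expand]
  have t1 := abs_le.mp hef
  have t2 := abs_le.mp b1
  have t3 := abs_le.mp b2
  have t4 := abs_le.mp b3
  rw [abs_le]
  constructor <;> nlinarith

/-- Perturbation of the regression of one residual on another. -/
theorem regression_perturbation {γ s σ2 mY U R V ρ : ℝ} (hs : 0 < s) (hρ : 0 ≤ ρ)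
    (hρs : ρ ≤ s / 2) (hρ1 : ρ ≤ 1) (hmY : mY = γ ^ 2 * s + σ2) (hU : |U - mY| ≤ ρ)
    (hR : |R - γ * s| ≤ ρ) (hV : |V - s| ≤ ρ) :
    |R / V - γ| ≤ 2 * (1 + |γ|) / s * ρ ∧
      |U - R / V * R - σ2| ≤ (1 + 2 * (1 + |γ|) / s * (|γ| * s + 1) + |γ|) * ρ := by
  have hVs : s / 2 ≤ V := by linarith [(abs_le.mp hV).1]
  have hV0 : 0 < V := by linarith
  have h1 : |R / V - γ| ≤ 2 * (1 + |γ|) / s * ρ := by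
    have e : R / V - γ = ((R - γ * s) - γ * (V - s)) / V := by field_simp; ring
    rw [e, abs_div, abs_of_pos hV0, div_le_iff₀ hV0]
    have a1 : |R - γ * s - γ * (V - s)| ≤ (1 + |γ|) * ρ := by
      refine (abs_sub _ _).trans ?_
      rw [abs_mul]
      nlinarith [mul_le_mul_of_nonneg_left hV (abs_nonneg γ)]
    have a2 : (1 + |γ|) * ρ ≤ 2 * (1 + |γ|) / s * ρ * V := by
      have : 2 * (1 + |γ|) / s * ρ * V = (1 + |γ|) * ρ * (V / (s / 2)) := by field_simp
      rw [this]
      refine le_mul_of_one_le_right (by positivity) ?_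
      rw [one_le_div (by positivity)]
      exact hVs
    exact a1.trans a2
  refine ⟨h1, ?_⟩
  have hRb : |R| ≤ |γ| * s + 1 := by
    have : |R| ≤ |R - γ * s| + |γ * s| := by simpa using abs_add_le (R - γ * s) (γ * s)
    rw [abs_mul, abs_of_pos hs] at this
    linarith
  -- The mean squared residual `U - 2 γ̂ R + γ̂² V` equals `U - γ̂ R` for `γ̂ = R / V`.
  have e : U - R / V * R - σ2 = (U - mY) - (R / V - γ) * R - γ * (R - γ * s) := by
    rw [hmY]; ring
  rw [e]
  have a1 : |(R / V - γ) * R| ≤ 2 * (1 + |γ|) / s * ρ * (|γ| * s + 1) := by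
    rw [abs_mul]; exact mul_le_mul h1 hRb (abs_nonneg _) (by positivity)
  have a2 : |γ * (R - γ * s)| ≤ |γ| * ρ := by
    rw [abs_mul]; exact mul_le_mul_of_nonneg_left hR (abs_nonneg _)
  have b0 := abs_le.mp hU
  have b1 := abs_le.mp a1
  have b2 := abs_le.mp a2
  rw [abs_le]
  constructor <;> nlinarith

theorem abs_sqrt_sub_le {x σ ρ : ℝ} (hσ : 0 < σ) (h : |x - σ ^ 2| ≤ ρ) :
    |√x - σ| ≤ ρ / σ := by
  rw [le_div_iff₀ hσ]
  rcases le_or_gt 0 x with hx | hx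
  · have h1 : |√x - σ| * (√x + σ) = |x - σ ^ 2| := by
      rw [← abs_of_nonneg (add_nonneg (Real.sqrt_nonneg x) hσ.le), ← abs_mul]
      congr 1
      nlinarith [Real.sq_sqrt hx]
    have h2 : |√x - σ| * σ ≤ |√x - σ| * (√x + σ) := by
      gcongr
      linarith [Real.sqrt_nonneg x]
    linarith
  -- For negative `x` the root is `0`, and `h` then forces `σ² ≤ ρ`.
  · rw [Real.sqrt_eq_zero_of_nonpos hx.le, zero_sub, abs_neg, abs_of_pos hσ]
    rw [abs_of_neg (by nlinarith)] at h
    nlinarith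

theorem abs_ratio_sub_le {a0 a1 s0 s1 ρ : ℝ} (h0 : 0 < s0) (h1 : 0 < s1)
    (e0 : |a0 - s0| ≤ ρ) (e1 : |a1 - s1| ≤ ρ) (hρ : ρ ≤ (s0 + s1) / 4) :
    |a1 / (a1 + a0) - s1 / (s0 + s1)| ≤ 2 / (s0 + s1) * ρ := by
  have b0 := abs_le.mp e0
  have b1 := abs_le.mp e1
  have ha : (s0 + s1) / 2 ≤ a1 + a0 := by linarith
  have ha0 : 0 < a1 + a0 := by linarith
  have hs : 0 < s0 + s1 := by linarith
  have hρ0 : 0 ≤ ρ := (abs_nonneg _).trans e0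
  have e : a1 / (a1 + a0) - s1 / (s0 + s1)
      = ((a1 - s1) * s0 - s1 * (a0 - s0)) / ((a1 + a0) * (s0 + s1)) := by
    field_simp; ring
  rw [e, abs_div, abs_of_pos (mul_pos ha0 hs), div_le_iff₀ (mul_pos ha0 hs)]
  have c1 : |(a1 - s1) * s0 - s1 * (a0 - s0)| ≤ ρ * (s0 + s1) := by
    rw [abs_le]
    constructor <;> nlinarith
  refine c1.trans ?_
  have : 2 / (s0 + s1) * ρ * ((a1 + a0) * (s0 + s1)) = ρ * (2 * (a1 + a0)) := by field_simp
  rw [this]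
  gcongr
  linarith

end Estimation

/-! ### From close empirical moments to accurate estimators -/

section Accuracy

variable {d : ℕ}

/-- The empirical moments of the features of both arms at time `t` are within `ρ` of the
population moments. -/
def MomentsClose (P : Measure (Subject d)) (θ : Params d) (D : ℕ → Obs d) (t : ℕ) (ρ : ℝ) : Prop :=
  ∀ z a b, |∑ j ∈ arm D z t, obsFeature θ z (D j) a * obsFeature θ z (D j) b
    - (arm D z t).card * featureMoment P θ z a b| ≤ (arm D z t).card * ρ

theorem sum_arm_zero_add_sum_arm_one (D : ℕ → Obs d) (t : ℕ) (f : ℕ → ℝ) :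
    ∑ j ∈ arm D 0 t, f j + ∑ j ∈ arm D 1 t, f j = ∑ j ∈ Finset.Icc 1 t, f j := by
  rw [← Finset.sum_filter_add_sum_filter_not (Finset.Icc 1 t) fun j => zAt D j = 0]
  congr 1
  refine Finset.sum_congr ?_ fun _ _ => rfl
  ext j
  simp only [arm, Finset.mem_filter, and_congr_right_iff]
  intro _
  omega

theorem card_arm_zero_add_card_arm_one (D : ℕ → Obs d) (t : ℕ) :
    ((arm D 0 t).card : ℝ) + (arm D 1 t).card = t := by
  have := sum_arm_zero_add_sum_arm_one D t fun _ => 1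
  simpa using this

variable {P : Measure (Subject d)} {θ : Params d}

/-- Adding the bounds of the two arms serves `αSHat`, which is fitted on all stages rather than on
one arm. -/
theorem MomentsClose.sum_Icc_le {D : ℕ → Obs d} {t : ℕ} {ρ : ℝ} (h : MomentsClose P θ D t ρ)
    {f : ℕ → ℝ} {m : ℝ} {a b : Fin d ⊕ Fin 3} (hm : ∀ z, featureMoment P θ z a b = m)
    (hf : ∀ z j, obsFeature θ z (D j) a * obsFeature θ z (D j) b = f j) :
    |∑ j ∈ Finset.Icc 1 t, f j - t * m| ≤ t * ρ := by
  have h0 := h 0 a b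
  have h1 := h 1 a b
  simp only [hf, hm] at h0 h1
  rw [← sum_arm_zero_add_sum_arm_one D t f, ← card_arm_zero_add_card_arm_one D t]
  rw [abs_le] at *
  constructor <;> linarith [h0.1, h0.2, h1.1, h1.2]

theorem σHat_sq_sum (D : ℕ → Obs d) (z : Fin 2) (t : ℕ) :
    ∑ j ∈ arm D z t, (yAt D j - μHat D z t (xAt D j) (sAt D j)) ^ 2
      = ∑ j ∈ arm D z t, (yAt D j - αYHat D z t ⬝ᵥ xAt D j) * (yAt D j - αYHat D z t ⬝ᵥ xAt D j)
        - 2 * γHat D z t * ∑ j ∈ arm D z t,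
            (yAt D j - αYHat D z t ⬝ᵥ xAt D j) * (sAt D j z - αSHat D z t ⬝ᵥ xAt D j)
        + γHat D z t ^ 2 * ∑ j ∈ arm D z t,
            (sAt D j z - αSHat D z t ⬝ᵥ xAt D j) * (sAt D j z - αSHat D z t ⬝ᵥ xAt D j) := by
  rw [Finset.mul_sum, Finset.mul_sum, ← Finset.sum_sub_distrib, ← Finset.sum_add_distrib]
  refine Finset.sum_congr rfl fun j _ => ?_
  simp only [μHat, sub_dotProduct, smul_dotProduct, smul_eq_mul]
  ring

variable [IsProbabilityMeasure P] (hmodel : LinearModel P θ) (herr : SubGaussianErrors P θ)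
  (hcov : CovariateCondition P)

include hmodel herr hcov

/-- Accuracy of the estimators of one arm. -/
theorem exists_arm_accuracy (z : Fin 2) :
    ∃ C ρ₀ : ℝ, 0 < C ∧ 0 < ρ₀ ∧ ∀ (D : ℕ → Obs d) (t : ℕ) (ρ : ℝ), 0 ≤ ρ → ρ ≤ ρ₀ →
      0 < (arm D z t).card → MomentsClose P θ D t ρ →
      ∑ i, |(αYHat D z t - γHat D z t • αSHat D z t + γHat D z t • θ.αS z - θ.αY z) i| ≤ C * ρ ∧
      |γHat D z t - θ.γ z| ≤ C * ρ ∧ |σHat D z t - θ.σ z| ≤ C * ρ := by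
  obtain ⟨l, hl, hS⟩ := exists_secondMoment_lower hcov
  obtain ⟨B, hB0, hB⟩ : ∃ B : ℝ, 0 ≤ B ∧ ∀ i k, |secondMoment P i k| ≤ B := by
    refine ⟨∑ i, ∑ k, |secondMoment P i k|, by positivity, fun i k => ?_⟩
    refine (Finset.single_le_sum (f := fun k => |secondMoment P i k|)
      (fun _ _ => abs_nonneg _) (Finset.mem_univ k)).trans ?_
    exact Finset.single_le_sum (f := fun i => ∑ k, |secondMoment P i k|)
      (fun _ _ => Finset.sum_nonneg fun _ _ => abs_nonneg _) (Finset.mem_univ i)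
  have hσ := hmodel.σ_pos z
  have hσS := hmodel.σS_pos z
  set s := θ.σS z ^ 2 with hs
  have hs0 : 0 < s := by positivity
  -- Error constants: `C1` for least squares, `C2` for residual moments, `C3` for the slope, `C4`
  -- for the residual variance, and below `C5` for the combined covariate coefficient. The threshold
  -- on `ρ` keeps the Gram matrices coercive and makes `C2 * ρ` admissible in
  -- `regression_perturbation`.
  set C1 := 2 / l with hC1
  set C2 := 1 + 2 * C1 + C1 ^ 2 * (B + 1) with hC2
  have hC1p : 0 < C1 := by positivity
  have hC2p : 1 ≤ C2 := by
    have : 0 ≤ C1 ^ 2 * (B + 1) := by positivity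
    linarith
  set C3 := 2 * (1 + |θ.γ z|) / s with hC3
  have hC3p : 0 < C3 := by positivity
  set C4 := 1 + C3 * (|θ.γ z| * s + 1) + |θ.γ z| with hC4
  have hC4p : 0 < C4 := by positivity
  set C5 := C1 + (|θ.γ z| + C3 * C2) * C1 with hC5
  have hC2p' : 0 < C2 := by linarith
  have hC5p : 0 < C5 := by positivity
  refine ⟨C5 + C3 * C2 + C4 * C2 / θ.σ z, min 1 (min (l / 2) (min (s / 2 / C2) (1 / C2))),
    by positivity, by positivity, ?_⟩
  intro D t ρ hρ hρ0 hn hclose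
  have hρ1 : ρ ≤ 1 := hρ0.trans (min_le_left _ _)
  have hρl : ρ ≤ l / 2 := hρ0.trans ((min_le_right _ _).trans (min_le_left _ _))
  have hρs : C2 * ρ ≤ s / 2 := by
    have := hρ0.trans ((min_le_right _ _).trans ((min_le_right _ _).trans (min_le_left _ _)))
    rw [le_div_iff₀ hC2p'] at this
    linarith
  have hρ2 : C2 * ρ ≤ 1 := by
    have := hρ0.trans ((min_le_right _ _).trans ((min_le_right _ _).trans (min_le_right _ _)))
    rw [le_div_iff₀ hC2p'] at this
    linarith
  have hC2ρ : 0 ≤ C2 * ρ := by positivity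
  set n : ℝ := ((arm D z t).card : ℝ) with hndef
  have hn' : 0 < n := Nat.cast_pos.mpr hn
  have htpos : (0 : ℝ) < t := by
    rw [← card_arm_zero_add_card_arm_one D t]
    have h0 : (0 : ℝ) ≤ (arm D 0 t).card := by positivity
    have h1 : (0 : ℝ) ≤ (arm D 1 t).card := by positivity
    fin_cases z
    · exact add_pos_of_pos_of_nonneg hn' h1
    · exact add_pos_of_nonneg_of_pos h0 hn'
  set eY : ℕ → ℝ := fun j => yAt D j - θ.αY z ⬝ᵥ xAt D j with heY
  set eS : ℕ → ℝ := fun j => sAt D j z - θ.αS z ⬝ᵥ xAt D j with heS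
  have fS : ∀ z' j, obsFeature θ z' (D j) (Sum.inr (Fin.castSucc z)) = eS j := by
    intro z' j; fin_cases z <;> rfl
  have fY : ∀ j, obsFeature θ z (D j) (Sum.inr 2) = eY j := fun j => rfl
  have fX : ∀ z' j i, obsFeature θ z' (D j) (Sum.inl i) = xAt D j i := fun _ _ _ => rfl
  have mXX : ∀ z' i k, featureMoment P θ z' (Sum.inl i) (Sum.inl k) = secondMoment P i k :=
    fun _ _ _ => rfl
  have mXS : ∀ z' i, featureMoment P θ z' (Sum.inl i) (Sum.inr (Fin.castSucc z)) = 0 := by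
    intro z' i
    simp only [featureMoment, feature_εS, feature_inl]
    exact integral_x_mul_εS hmodel herr hcov z i
  have mXY : ∀ i, featureMoment P θ z (Sum.inl i) (Sum.inr 2) = 0 :=
    integral_x_mul_εY hmodel herr hcov z
  have mYY : featureMoment P θ z (Sum.inr 2) (Sum.inr 2) = θ.σY z ^ 2 := by
    rw [← integral_εY_sq hmodel z]
    exact integral_congr_ae (ae_of_all _ fun w => (sq _).symm)
  have mYS : featureMoment P θ z (Sum.inr 2) (Sum.inr (Fin.castSucc z)) = θ.γ z * s := by
    rw [hs, ← integral_εY_mul_εS hmodel herr hcov z]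
    simp only [featureMoment, feature_εS, feature_εY]
  have mSS : featureMoment P θ z (Sum.inr (Fin.castSucc z)) (Sum.inr (Fin.castSucc z)) = s := by
    rw [hs, ← integral_εS_sq hmodel z]
    simp only [featureMoment, feature_εS, sq]
  have aXX : ∀ i k, |∑ j ∈ arm D z t, xAt D j i * xAt D j k - n * secondMoment P i k| ≤ n * ρ :=
    fun i k => hclose z (Sum.inl i) (Sum.inl k)
  have aXY : ∀ i, |∑ j ∈ arm D z t, xAt D j i * eY j| ≤ n * ρ := fun i => by
    simpa only [fX, fY, mXY, mul_zero, sub_zero] using hclose z (Sum.inl i) (Sum.inr 2)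
  have aXS : ∀ i, |∑ j ∈ arm D z t, xAt D j i * eS j| ≤ n * ρ := fun i => by
    simpa only [fX, fS, mXS, mul_zero, sub_zero] using
      hclose z (Sum.inl i) (Sum.inr (Fin.castSucc z))
  have aYY : |∑ j ∈ arm D z t, eY j * eY j - n * θ.σY z ^ 2| ≤ n * ρ := by
    simpa only [fY, mYY] using hclose z (Sum.inr 2) (Sum.inr 2)
  have aYS : |∑ j ∈ arm D z t, eY j * eS j - n * (θ.γ z * s)| ≤ n * ρ := by
    simpa only [fY, fS, mYS] using hclose z (Sum.inr 2) (Sum.inr (Fin.castSucc z))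
  have aSS : |∑ j ∈ arm D z t, eS j * eS j - n * s| ≤ n * ρ := by
    simpa only [fS, mSS] using hclose z (Sum.inr (Fin.castSucc z)) (Sum.inr (Fin.castSucc z))
  have tXX : ∀ i k, |∑ j ∈ Finset.Icc 1 t, xAt D j i * xAt D j k - t * secondMoment P i k|
      ≤ t * ρ := fun i k => hclose.sum_Icc_le (fun z' => mXX z' i k) fun z' j => rfl
  have tXS : ∀ i, |∑ j ∈ Finset.Icc 1 t, xAt D j i * eS j| ≤ t * ρ := fun i => by
    have := hclose.sum_Icc_le (f := fun j => xAt D j i * eS j) (fun z' => mXS z' i)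
      fun z' j => by rw [fX, fS]
    simpa only [mul_zero, sub_zero] using this
  set a := αYHat D z t - θ.αY z with ha
  set b := αSHat D z t - θ.αS z with hb
  have ha1 : ∑ i, |a i| ≤ C1 * ρ :=
    ols_sub_le hl hS D (arm D z t) (yAt D) (θ.αY z) hn' hρl aXX aXY hρ
  have hb1 : ∑ i, |b i| ≤ C1 * ρ :=
    ols_sub_le hl hS D (Finset.Icc 1 t) (fun j => sAt D j z) (θ.αS z) htpos hρl tXX tXS hρ
  have eu : ∀ j, yAt D j - αYHat D z t ⬝ᵥ xAt D j = eY j - a ⬝ᵥ xAt D j := fun j => by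
    simp only [heY, ha, sub_dotProduct]; ring
  have ev : ∀ j, sAt D j z - αSHat D z t ⬝ᵥ xAt D j = eS j - b ⬝ᵥ xAt D j := fun j => by
    simp only [heS, hb, sub_dotProduct]; ring
  set SU := ∑ j ∈ arm D z t, (eY j - a ⬝ᵥ xAt D j) * (eY j - a ⬝ᵥ xAt D j) with hSU
  set SR := ∑ j ∈ arm D z t, (eY j - a ⬝ᵥ xAt D j) * (eS j - b ⬝ᵥ xAt D j) with hSR
  set SV := ∑ j ∈ arm D z t, (eS j - b ⬝ᵥ xAt D j) * (eS j - b ⬝ᵥ xAt D j) with hSV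
  have hdiv : ∀ S m : ℝ, |S - n * m| ≤ n * (C2 * ρ) → |S / n - m| ≤ C2 * ρ := by
    intro S m h
    have e : S / n - m = (S - n * m) / n := by field_simp
    rw [e, abs_div, abs_of_pos hn', div_le_iff₀ hn']
    linarith
  have hU := hdiv _ _ (residual_sum_sub_le hB0 hB D (arm D z t) eY eY a a hn' hρ hρ1 hC1p.le
    aXX aXY aXY aYY ha1 ha1)
  have hR := hdiv _ _ (residual_sum_sub_le hB0 hB D (arm D z t) eY eS a b hn' hρ hρ1 hC1p.le
    aXX aXY aXS aYS ha1 hb1)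
  have hV := hdiv _ _ (residual_sum_sub_le hB0 hB D (arm D z t) eS eS b b hn' hρ hρ1 hC1p.le
    aXX aXS aXS aSS hb1 hb1)
  rw [← hSU] at hU
  rw [← hSR] at hR
  rw [← hSV] at hV
  obtain ⟨q1, q2⟩ := regression_perturbation hs0 hC2ρ hρs hρ2 (σY_sq_eq hmodel herr hcov z)
    hU hR hV
  have hVpos : 0 < SV / n := by linarith [(abs_le.mp hV).1]
  have hSVpos : 0 < SV := by
    have := mul_pos hVpos hn'
    rwa [div_mul_cancel₀ _ hn'.ne'] at this
  have hγ : γHat D z t = SR / n / (SV / n) := by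
    rw [div_div_div_cancel_right₀ hn'.ne', γHat]
    simp only [eu, ev, hSR, hSV, sq]
  have hγerr : |γHat D z t - θ.γ z| ≤ C3 * C2 * ρ := by
    rw [hγ, mul_assoc]; exact q1
  have hσsq : |(∑ j ∈ arm D z t, (yAt D j - μHat D z t (xAt D j) (sAt D j)) ^ 2)
      / (arm D z t).card - θ.σ z ^ 2| ≤ C4 * (C2 * ρ) := by
    refine le_trans (le_of_eq ?_) q2
    rw [σHat_sq_sum]
    simp only [eu, ev, ← hSU, ← hSR, ← hSV, ← hndef]
    rw [hγ]
    congr 2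
    field_simp
    ring
  have hσerr := abs_sqrt_sub_le hσ hσsq
  have e1 : ∑ i, |(αYHat D z t - γHat D z t • αSHat D z t + γHat D z t • θ.αS z - θ.αY z) i|
      ≤ C5 * ρ := by
    have hγb : |γHat D z t| ≤ |θ.γ z| + C3 * C2 := by
      have h1 : |γHat D z t| ≤ |γHat D z t - θ.γ z| + |θ.γ z| := by
        simpa using abs_add_le (γHat D z t - θ.γ z) (θ.γ z)
      have h2 : C3 * C2 * ρ ≤ C3 * C2 * 1 := by gcongr
      linarith
    -- The vector equals `a - γ̂ b`, in which the error of `γ̂` itself no longer appears separately.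
    calc ∑ i, |(αYHat D z t - γHat D z t • αSHat D z t + γHat D z t • θ.αS z - θ.αY z) i|
        ≤ ∑ i, (|a i| + |γHat D z t| * |b i|) := by
          refine Finset.sum_le_sum fun i _ => ?_
          have : (αYHat D z t - γHat D z t • αSHat D z t + γHat D z t • θ.αS z - θ.αY z) i
              = a i - γHat D z t * b i := by
            simp only [ha, hb, Pi.sub_apply, Pi.add_apply, Pi.smul_apply, smul_eq_mul]; ring
          rw [this, ← abs_mul]
          exact abs_sub _ _
      _ = ∑ i, |a i| + |γHat D z t| * ∑ i, |b i| := by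
          rw [Finset.sum_add_distrib, Finset.mul_sum]
      _ ≤ C1 * ρ + (|θ.γ z| + C3 * C2) * (C1 * ρ) := by
          have : 0 ≤ ∑ i, |b i| := Finset.sum_nonneg fun i _ => abs_nonneg _
          gcongr
      _ = C5 * ρ := by rw [hC5]; ring
  have g1 : 0 ≤ C5 * ρ := by positivity
  have g2 : 0 ≤ C3 * C2 * ρ := by positivity
  have g3 : 0 ≤ C4 * C2 / θ.σ z * ρ := by positivity
  have hsum : (C5 + C3 * C2 + C4 * C2 / θ.σ z) * ρ
      = C5 * ρ + C3 * C2 * ρ + C4 * C2 / θ.σ z * ρ := by ring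
  refine ⟨by linarith, by linarith, ?_⟩
  have : C4 * (C2 * ρ) / θ.σ z = C4 * C2 / θ.σ z * ρ := by ring
  rw [this] at hσerr
  exact hσerr.trans (by linarith)

/-- Accuracy of the plug-in allocation and of the estimated mean functions. -/
theorem exists_accuracy :
    ∃ C ρ₀ : ℝ, 0 < C ∧ 0 < ρ₀ ∧ ∀ (D : ℕ → Obs d) (t : ℕ) (ρ : ℝ), 0 ≤ ρ → ρ ≤ ρ₀ →
      (∀ z, 0 < (arm D z t).card) → MomentsClose P θ D t ρ →
      (∀ z, ∑ i, |(αYHat D z t - γHat D z t • αSHat D z t + γHat D z t • θ.αS z - θ.αY z) i|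
        ≤ C * ρ) ∧
      (∀ z, |γHat D z t - θ.γ z| ≤ C * ρ) ∧ |πTilde D (t + 1) - θ.πStar| ≤ C * ρ := by
  obtain ⟨A, r, hA, hr, h0⟩ := exists_arm_accuracy hmodel herr hcov 0
  obtain ⟨A', r', hA', hr', h1⟩ := exists_arm_accuracy hmodel herr hcov 1
  have e0 := hmodel.σ_pos 0
  have e1 := hmodel.σ_pos 1
  refine ⟨(A + A') * (1 + 2 / (θ.σ 0 + θ.σ 1)),
    min (min r r') ((θ.σ 0 + θ.σ 1) / 4 / (A + A')), by positivity, by positivity, ?_⟩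
  intro D t ρ hρ hρ0 hn hclose
  obtain ⟨a1, a2, a3⟩ := h0 D t ρ hρ (hρ0.trans ((min_le_left _ _).trans (min_le_left _ _))) (hn 0)
    hclose
  obtain ⟨b1, b2, b3⟩ := h1 D t ρ hρ (hρ0.trans ((min_le_left _ _).trans (min_le_right _ _))) (hn 1)
    hclose
  have c0 : A * ρ ≤ (A + A') * ρ := by gcongr; linarith
  have c1 : A' * ρ ≤ (A + A') * ρ := by gcongr; linarith
  have c2 : 0 ≤ (A + A') * ρ := by positivity
  have c3 : 0 ≤ 2 / (θ.σ 0 + θ.σ 1) * ((A + A') * ρ) := by positivity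
  have c4 : (A + A') * (1 + 2 / (θ.σ 0 + θ.σ 1)) * ρ
      = (A + A') * ρ + 2 / (θ.σ 0 + θ.σ 1) * ((A + A') * ρ) := by ring
  have c5 : (A + A') * ρ ≤ (θ.σ 0 + θ.σ 1) / 4 := by
    have := hρ0.trans (min_le_right _ _)
    rw [le_div_iff₀ (by positivity)] at this
    linarith
  refine ⟨fun z => ?_, fun z => ?_, ?_⟩
  · fin_cases z
    · exact a1.trans (by linarith)
    · exact b1.trans (by linarith)
  · fin_cases z
    · exact a2.trans (by linarith)
    · exact b2.trans (by linarith)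
  · have := abs_ratio_sub_le e0 e1 (a3.trans c0) (b3.trans c1) c5
    rw [πTilde, Nat.add_sub_cancel, Params.πStar]
    exact this.trans (by linarith)

end Accuracy

/-! ### Measurability of the estimators -/

section Measurability

variable {d : ℕ} {Ω : Type*} [MeasurableSpace Ω] {D : Ω → ℕ → Obs d} {n : ℕ}

theorem measurable_sum_arm (hD : ∀ j ∈ Finset.Icc 1 n, Measurable fun ω => D ω j) (z : Fin 2)
    {f : Ω → ℕ → ℝ} (hf : ∀ j ∈ Finset.Icc 1 n, Measurable fun ω => f ω j) :
    Measurable fun ω => ∑ j ∈ arm (D ω) z n, f ω j := by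
  simp only [arm, Finset.sum_filter]
  refine Finset.measurable_sum _ fun j hj => Measurable.ite ?_ (hf j hj) measurable_const
  have : Measurable fun ω => zAt (D ω) j := measurable_fst.comp (measurable_snd.comp (hD j hj))
  exact this (measurableSet_singleton z)

theorem measurable_card_arm (hD : ∀ j ∈ Finset.Icc 1 n, Measurable fun ω => D ω j) (z : Fin 2) :
    Measurable fun ω => ((arm (D ω) z n).card : ℝ) := by
  have := measurable_sum_arm hD z (f := fun _ _ => 1) fun _ _ => measurable_const
  simpa using this

/-- The inverse is `det⁻¹ • adjugate`, with entries built from polynomials and a real inverse. Since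
`0⁻¹ = 0`, the formula also covers singular matrices. -/
theorem measurable_matrix_inv {A : Ω → Matrix (Fin d) (Fin d) ℝ}
    (hA : ∀ i k, Measurable fun ω => A ω i k) (i k : Fin d) :
    Measurable fun ω => (A ω)⁻¹ i k := by
  have hA' : Measurable fun ω => (fun i k => A ω i k : Fin d → Fin d → ℝ) := by
    rw [measurable_pi_iff]; intro i; rw [measurable_pi_iff]; exact hA i
  have h1 : Measurable fun ω => (A ω).det := by
    have : Continuous fun M : Fin d → Fin d → ℝ => Matrix.det (Matrix.of M) :=
      Continuous.matrix_det continuous_id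
    exact this.measurable.comp hA'
  have h2 : Measurable fun ω => (A ω).adjugate i k := by
    have : Continuous fun M : Fin d → Fin d → ℝ => Matrix.adjugate (Matrix.of M) i k :=
      (Continuous.matrix_adjugate continuous_id).matrix_elem i k
    exact this.measurable.comp hA'
  simp only [Matrix.inv_def, Ring.inverse_eq_inv', Matrix.smul_apply, smul_eq_mul]
  exact h1.inv.mul h2

theorem measurable_αSHat (hD : ∀ j ∈ Finset.Icc 1 n, Measurable fun ω => D ω j) (z : Fin 2) :
    Measurable fun ω => αSHat (D ω) z n := by
  rw [measurable_pi_iff]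
  intro i
  have hx : ∀ j ∈ Finset.Icc 1 n, ∀ i, Measurable fun ω => xAt (D ω) j i := fun j hj i =>
    (measurable_pi_apply i).comp (measurable_fst.comp (hD j hj))
  have hs : ∀ j ∈ Finset.Icc 1 n, Measurable fun ω => sAt (D ω) j z := fun j hj =>
    (measurable_pi_apply z).comp (measurable_fst.comp (measurable_snd.comp
      (measurable_snd.comp (hD j hj))))
  simp only [αSHat, ols, Matrix.mulVec, dotProduct, Finset.sum_apply, Pi.smul_apply, smul_eq_mul]
  refine Finset.measurable_sum _ fun k _ => Measurable.mul (measurable_matrix_inv ?_ i k) ?_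
  · intro i k
    simp only [Matrix.sum_apply, Matrix.vecMulVec_apply]
    exact Finset.measurable_sum _ fun j hj => (hx j hj i).mul (hx j hj k)
  · exact Finset.measurable_sum _ fun j hj => (hs j hj).mul (hx j hj k)

theorem measurable_αYHat (hD : ∀ j ∈ Finset.Icc 1 n, Measurable fun ω => D ω j) (z : Fin 2) :
    Measurable fun ω => αYHat (D ω) z n := by
  rw [measurable_pi_iff]
  intro i
  have hx : ∀ j ∈ Finset.Icc 1 n, ∀ i, Measurable fun ω => xAt (D ω) j i := fun j hj i =>
    (measurable_pi_apply i).comp (measurable_fst.comp (hD j hj))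
  have hy : ∀ j ∈ Finset.Icc 1 n, Measurable fun ω => yAt (D ω) j := fun j hj =>
    measurable_snd.comp (measurable_snd.comp (measurable_snd.comp (hD j hj)))
  simp only [αYHat, ols, Matrix.mulVec, dotProduct, Finset.sum_apply, Pi.smul_apply, smul_eq_mul]
  refine Finset.measurable_sum _ fun k _ => Measurable.mul (measurable_matrix_inv ?_ i k) ?_
  · intro i k
    simp only [Matrix.sum_apply, Matrix.vecMulVec_apply]
    exact measurable_sum_arm hD z fun j hj => (hx j hj i).mul (hx j hj k)
  · exact measurable_sum_arm hD z fun j hj => (hy j hj).mul (hx j hj k)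

theorem measurable_γHat (hD : ∀ j ∈ Finset.Icc 1 n, Measurable fun ω => D ω j) (z : Fin 2) :
    Measurable fun ω => γHat (D ω) z n := by
  have hx : ∀ j ∈ Finset.Icc 1 n, Measurable fun ω => xAt (D ω) j := fun j hj =>
    measurable_fst.comp (hD j hj)
  have hy : ∀ j ∈ Finset.Icc 1 n, Measurable fun ω => yAt (D ω) j := fun j hj =>
    measurable_snd.comp (measurable_snd.comp (measurable_snd.comp (hD j hj)))
  have hs : ∀ j ∈ Finset.Icc 1 n, Measurable fun ω => sAt (D ω) j z := fun j hj =>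
    (measurable_pi_apply z).comp (measurable_fst.comp (measurable_snd.comp
      (measurable_snd.comp (hD j hj))))
  have h1 : ∀ j ∈ Finset.Icc 1 n, Measurable fun ω => yAt (D ω) j - αYHat (D ω) z n ⬝ᵥ xAt (D ω) j :=
    fun j hj => (hy j hj).sub (measurable_dotProduct (measurable_αYHat hD z) (hx j hj))
  have h2 : ∀ j ∈ Finset.Icc 1 n,
      Measurable fun ω => sAt (D ω) j z - αSHat (D ω) z n ⬝ᵥ xAt (D ω) j :=
    fun j hj => (hs j hj).sub (measurable_dotProduct (measurable_αSHat hD z) (hx j hj))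
  exact (measurable_sum_arm hD z fun j hj => (h1 j hj).mul (h2 j hj)).div
    (measurable_sum_arm hD z fun j hj => (h2 j hj).pow_const 2)

theorem measurable_σHat (hD : ∀ j ∈ Finset.Icc 1 n, Measurable fun ω => D ω j) (z : Fin 2) :
    Measurable fun ω => σHat (D ω) z n := by
  have hx : ∀ j ∈ Finset.Icc 1 n, Measurable fun ω => xAt (D ω) j := fun j hj =>
    measurable_fst.comp (hD j hj)
  have hy : ∀ j ∈ Finset.Icc 1 n, Measurable fun ω => yAt (D ω) j := fun j hj =>
    measurable_snd.comp (measurable_snd.comp (measurable_snd.comp (hD j hj)))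
  have hs : ∀ j ∈ Finset.Icc 1 n, Measurable fun ω => sAt (D ω) j z := fun j hj =>
    (measurable_pi_apply z).comp (measurable_fst.comp (measurable_snd.comp
      (measurable_snd.comp (hD j hj))))
  have hβ : Measurable fun ω => αYHat (D ω) z n - γHat (D ω) z n • αSHat (D ω) z n :=
    (measurable_αYHat hD z).sub ((measurable_γHat hD z).smul (measurable_αSHat hD z))
  refine Measurable.sqrt ((measurable_sum_arm hD z fun j hj => ?_).div (measurable_card_arm hD z))
  exact ((hy j hj).sub ((measurable_dotProduct hβ (hx j hj)).add
    ((measurable_γHat hD z).mul (hs j hj)))).pow_const 2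

theorem measurable_πClip (hD : ∀ j ∈ Finset.Icc 1 n, Measurable fun ω => D ω j) (η : ℝ) :
    Measurable fun ω => πClip (D ω) η (n + 1) := by
  unfold πClip πTilde
  simp only [Nat.add_sub_cancel]
  have h0 := measurable_σHat hD 0
  have h1 := measurable_σHat hD 1
  fun_prop

end Measurability

/-! ### Clipping -/

section Clip

variable {d : ℕ}

theorem ζ_pos (η : ℝ) {t : ℕ} (ht : 1 ≤ t) : 0 < ζ η t := by
  have : (0 : ℝ) < t := by exact_mod_cast ht
  unfold ζ; positivity

theorem ζ_le_half {η : ℝ} (hη : 0 < η) {t : ℕ} (ht : 1 ≤ t) : ζ η t ≤ 1 / 2 := by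
  have h1 : (1 : ℝ) ≤ t := by exact_mod_cast ht
  have := Real.rpow_le_one_of_one_le_of_nonpos h1 (neg_nonpos.mpr hη.le)
  unfold ζ; linarith

theorem πClip_pos (D : ℕ → Obs d) (η : ℝ) {t : ℕ} (ht : 1 ≤ t) : 0 < πClip D η t :=
  (ζ_pos η ht).trans_le (le_max_left _ _)

theorem πClip_lt_one (D : ℕ → Obs d) {η : ℝ} (hη : 0 < η) {t : ℕ} (ht : 1 ≤ t) :
    πClip D η t < 1 := by
  have h1 := ζ_pos η ht
  have h2 := ζ_le_half hη ht
  refine max_lt (by linarith) ((min_le_right _ _).trans_lt (by linarith))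

/-- Projection onto `[l, u]` is a contraction fixing `y`. -/
theorem abs_clip_sub_le {x y l u : ℝ} (h1 : l ≤ y) (h2 : y ≤ u) :
    |max l (min x u) - y| ≤ |x - y| := by
  have h3 := neg_abs_le (x - y)
  have h4 := le_abs_self (x - y)
  rw [abs_le]
  rcases max_cases l (min x u) with ⟨e, h⟩ | ⟨e, h⟩ <;> rcases min_cases x u with ⟨e', h'⟩ | ⟨e', h'⟩ <;>
    constructor <;> linarith [abs_nonneg (x - y)]

/-- Once the clipping threshold is below the oracle allocation, clipping can only help. -/
theorem abs_πClip_sub_le (D : ℕ → Obs d) (θ : Params d) {η : ℝ} {t : ℕ} (h : ζ η t ≤ θ.πLow) :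
    |πClip D η t - θ.πStar| ≤ |πTilde D t - θ.πStar| := by
  have h1 : θ.πLow ≤ θ.πStar := min_le_left _ _
  have h2 : θ.πLow ≤ 1 - θ.πStar := min_le_right _ _
  exact abs_clip_sub_le (h.trans h1) (by linarith)

/-- Raising `t ≥ (2p)^(-1/η)` to the power `η` gives `t^(-η) ≤ 2p`; this explains the last term in
`initLength`. -/
theorem ζ_le_of_le {η p : ℝ} (hη : 0 < η) (hp : 0 < p) {t : ℕ} (ht : 1 ≤ t)
    (h : 1 / (2 * p) ^ (1 / η) ≤ t) : ζ η t ≤ p := by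
  have ht0 : (0 : ℝ) < t := by exact_mod_cast ht
  have hq : 0 < (2 * p) ^ (1 / η) := Real.rpow_pos_of_pos (by linarith) _
  rw [div_le_iff₀ hq] at h
  have h1 : 1 ≤ (t * (2 * p) ^ (1 / η)) ^ η := Real.one_le_rpow h hη.le
  rw [Real.mul_rpow ht0.le hq.le, ← Real.rpow_mul (by linarith), one_div_mul_cancel hη.ne',
    Real.rpow_one] at h1
  have h2 : 0 < (t : ℝ) ^ η := Real.rpow_pos_of_pos ht0 _
  unfold ζ
  rw [Real.rpow_neg ht0.le]
  have h3 : ((t : ℝ) ^ η)⁻¹ ≤ 2 * p := by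
    rw [inv_le_iff_one_le_mul₀ h2]; linarith
  linarith

end Clip

/-! ### The design as an adapted process -/

section Design

variable {d : ℕ} {Ω : Type*} {W : ℕ → Ω → Subject d} {Z : ℕ → Ω → Fin 2}

theorem history_mono (W : ℕ → Ω → Subject d) (Z : ℕ → Ω → Fin 2) : Monotone (history W Z) := by
  intro s t hst
  exact biSup_mono fun j hj => Finset.Icc_subset_Icc_right hst hj

theorem measurable_data_history {j t : ℕ} (hj : j ∈ Finset.Icc 1 t) :
    Measurable[history W Z t] fun ω => data W Z ω j := by
  have h : MeasurableSpace.comap (fun ω => data W Z ω j) inferInstance ≤ history W Z t :=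
    le_iSup₂_of_le (f := fun j (_ : j ∈ Finset.Icc 1 t) =>
      MeasurableSpace.comap (fun ω => data W Z ω j) inferInstance) j hj le_rfl
  exact (comap_measurable _).mono h le_rfl

/-- The conditional probability of treatment at stage `t`. -/
noncomputable def treatProb (W : ℕ → Ω → Subject d) (Z : ℕ → Ω → Fin 2) (η : ℝ) (T₀ t : ℕ)
    (ω : Ω) : ℝ :=
  if t ≤ T₀ then (if Odd t then 0 else 1) else πClip (data W Z ω) η t

/-- The conditional probability of arm `z` at stage `t`. -/
noncomputable def armProb (W : ℕ → Ω → Subject d) (Z : ℕ → Ω → Fin 2) (η : ℝ) (T₀ : ℕ) (z : Fin 2)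
    (t : ℕ) (ω : Ω) : ℝ :=
  if z = 1 then treatProb W Z η T₀ t ω else 1 - treatProb W Z η T₀ t ω

theorem treatProb_mem {η : ℝ} (hη : 0 < η) (T₀ : ℕ) {t : ℕ} (ht : 1 ≤ t) (ω : Ω) :
    0 ≤ treatProb W Z η T₀ t ω ∧ treatProb W Z η T₀ t ω ≤ 1 := by
  unfold treatProb
  split_ifs
  · norm_num
  · norm_num
  · exact ⟨(πClip_pos _ η ht).le, (πClip_lt_one _ hη ht).le⟩

theorem armProb_mem {η : ℝ} (hη : 0 < η) (T₀ : ℕ) (z : Fin 2) {t : ℕ} (ht : 1 ≤ t) (ω : Ω) :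
    0 ≤ armProb W Z η T₀ z t ω ∧ armProb W Z η T₀ z t ω ≤ 1 := by
  have := treatProb_mem (W := W) (Z := Z) hη T₀ ht ω
  unfold armProb
  split_ifs
  · exact this
  · constructor <;> linarith

theorem measurable_treatProb {η : ℝ} (T₀ : ℕ) {t : ℕ} (ht : 1 ≤ t) :
    Measurable[history W Z (t - 1)] (treatProb W Z η T₀ t) := by
  obtain ⟨n, rfl⟩ : ∃ n, t = n + 1 := ⟨t - 1, by omega⟩
  unfold treatProb
  split_ifs
  · exact measurable_const
  · exact measurable_const
  · rw [Nat.add_sub_cancel]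
    exact @measurable_πClip d Ω (history W Z n) _ n (fun j hj => measurable_data_history hj) η

theorem measurable_armProb {η : ℝ} (T₀ : ℕ) (z : Fin 2) {t : ℕ} (ht : 1 ≤ t) :
    Measurable[history W Z (t - 1)] (armProb W Z η T₀ z t) := by
  have := measurable_treatProb (W := W) (Z := Z) (η := η) T₀ ht
  unfold armProb
  split_ifs
  · exact this
  · exact measurable_const.sub this

variable [m0 : MeasurableSpace Ω] {μ : Measure Ω} {P : Measure (Subject d)} {η : ℝ} {T T₀ : ℕ}

theorem IsDesign.measurable_data (h : IsDesign μ P η T T₀ W Z) {j : ℕ} (hj : j ∈ Finset.Icc 1 T) :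
    Measurable fun ω => data W Z ω j := by
  have hW := h.meas_W j hj
  have hZ := h.meas_Z j hj
  unfold data observe
  refine (measurable_x.comp hW).prodMk (hZ.prodMk ((measurable_s.comp hW).prodMk ?_))
  have hm : Measurable fun p : Subject d × Fin 2 => p.1.y p.2 := by
    apply measurable_from_prod_countable_left
    intro z
    change Measurable fun w : Subject d => w.y z
    fun_prop
  exact hm.comp (hW.prodMk hZ)

theorem IsDesign.history_le (h : IsDesign μ P η T T₀ W Z) {t : ℕ} (ht : t ≤ T) :
    history W Z t ≤ m0 :=
  iSup₂_le fun _ hj => (h.measurable_data (Finset.Icc_subset_Icc_right ht hj)).comap_le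

theorem IsDesign.sup_le (h : IsDesign μ P η T T₀ W Z) {t : ℕ} (ht : t ∈ Finset.Icc 1 T) :
    history W Z (t - 1) ⊔ MeasurableSpace.comap (W t) inferInstance ≤ m0 :=
  _root_.sup_le (h.history_le ((Nat.sub_le _ _).trans (Finset.mem_Icc.mp ht).2))
    (h.meas_W t ht).comap_le

variable [IsProbabilityMeasure μ]

theorem IsDesign.condExp_treat (h : IsDesign μ P η T T₀ W Z) {t : ℕ} (ht : t ∈ Finset.Icc 1 T) :
    μ[(Z t ⁻¹' {1}).indicator (fun _ => (1 : ℝ)) |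
      history W Z (t - 1) ⊔ MeasurableSpace.comap (W t) inferInstance]
      =ᵐ[μ] treatProb W Z η T₀ t := by
  by_cases h0 : t ≤ T₀
  · have hZ := h.init t ht h0
    -- In the initialization the assignment is deterministic, so the actual probability is `0` or
    -- `1`, not the nominal `1 / 2` of the action.
    have e : (Z t ⁻¹' {1}).indicator (fun _ => (1 : ℝ)) = treatProb W Z η T₀ t := by
      ext ω
      by_cases ho : Odd t <;> simp [Set.indicator, treatProb, h0, hZ ω, ho]
    have e2 : treatProb W Z η T₀ t = fun _ => (if Odd t then (0 : ℝ) else 1) := by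
      ext ω; simp [treatProb, h0]
    rw [e, e2, condExp_const (h.sup_le ht)]
  · have := h.assign t ht (not_le.mp h0)
    refine this.trans (ae_of_all _ fun ω => ?_)
    simp [action, treatProb, h0]

theorem IsDesign.condExp_arm (h : IsDesign μ P η T T₀ W Z) {t : ℕ} (ht : t ∈ Finset.Icc 1 T)
    (z : Fin 2) :
    μ[(Z t ⁻¹' {z}).indicator (fun _ => (1 : ℝ)) |
      history W Z (t - 1) ⊔ MeasurableSpace.comap (W t) inferInstance]
      =ᵐ[μ] armProb W Z η T₀ z t := by
  have hA : MeasurableSet (Z t ⁻¹' {1}) := h.meas_Z t ht (measurableSet_singleton 1)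
  by_cases hz : z = 1
  · subst hz
    exact (h.condExp_treat ht).trans (ae_of_all _ fun ω => by simp [armProb])
  · have hz0 : z = 0 := by omega
    subst hz0
    have e : Z t ⁻¹' {0} = (Z t ⁻¹' {1})ᶜ := by
      ext ω
      simp only [Set.mem_preimage, Set.mem_singleton_iff, Set.mem_compl_iff]
      omega
    rw [e]
    refine (condExp_indicator_compl (h.sup_le ht) μ hA (h.condExp_treat ht)).trans ?_
    exact ae_of_all _ fun ω => by simp [armProb]

/-- The centered product of two features in arm `z` at stage `j`. -/
noncomputable def momentIncrement (P : Measure (Subject d)) (θ : Params d) (W : ℕ → Ω → Subject d)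
    (Z : ℕ → Ω → Fin 2) (z : Fin 2) (a b : Fin d ⊕ Fin 3) (j : ℕ) (ω : Ω) : ℝ :=
  if zAt (data W Z ω) j = z then
    obsFeature θ z (data W Z ω j) a * obsFeature θ z (data W Z ω j) b - featureMoment P θ z a b
  else 0

/-- The centered indicator of arm `z` at stage `j`. -/
noncomputable def armIncrement (W : ℕ → Ω → Subject d) (Z : ℕ → Ω → Fin 2) (η : ℝ) (T₀ : ℕ)
    (z : Fin 2) (j : ℕ) (ω : Ω) : ℝ :=
  (if zAt (data W Z ω) j = z then 1 else 0) - armProb W Z η T₀ z j ω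

omit m0 in
theorem measurable_momentIncrement (θ : Params d) (z : Fin 2) (a b : Fin d ⊕ Fin 3) {j : ℕ}
    (hj : 1 ≤ j) : Measurable[history W Z j] (momentIncrement P θ W Z z a b j) := by
  have hd : Measurable[history W Z j] fun ω => data W Z ω j :=
    measurable_data_history (Finset.mem_Icc.mpr ⟨hj, le_rfl⟩)
  have hf : Measurable fun o : Obs d => if o.2.1 = z then
      obsFeature θ z o a * obsFeature θ z o b - featureMoment P θ z a b else 0 := by
    refine Measurable.ite ?_ (((measurable_obsFeature θ z a).mul
      (measurable_obsFeature θ z b)).sub_const _) measurable_const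
    exact (measurable_fst.comp measurable_snd) (measurableSet_singleton z)
  exact hf.comp hd

omit m0 in
theorem measurable_armIncrement (z : Fin 2) {j : ℕ} (hj : 1 ≤ j) :
    Measurable[history W Z j] (armIncrement W Z η T₀ z j) := by
  have hd : Measurable[history W Z j] fun ω => data W Z ω j :=
    measurable_data_history (Finset.mem_Icc.mpr ⟨hj, le_rfl⟩)
  have hf : Measurable fun o : Obs d => if o.2.1 = z then (1 : ℝ) else 0 := by
    refine Measurable.ite ?_ measurable_const measurable_const
    exact (measurable_fst.comp measurable_snd) (measurableSet_singleton z)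
  exact (hf.comp hd).sub
    ((measurable_armProb T₀ z hj).mono (history_mono W Z (Nat.sub_le _ _)) le_rfl)

/-- When stage `j` goes to arm `z`, its observed features are those of a fresh unit with law `P`;
otherwise the increment vanishes. So a bound under `P` transfers to the adaptive sum. -/
theorem IsDesign.momentIncrement_step (h : IsDesign μ P η T T₀ W Z) (hη : 0 < η) (θ : Params d)
    {z : Fin 2} {a b : Fin d ⊕ Fin 3} {lam c : ℝ} (hc : 0 ≤ c)
    (hmgf : ∫⁻ w, ENNReal.ofReal (Real.exp (lam *
      (feature θ z w a * feature θ z w b - featureMoment P θ z a b))) ∂P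
        ≤ ENNReal.ofReal (Real.exp c))
    {j : ℕ} (hj : j ∈ Finset.Icc 1 T) {H : Ω → ENNReal} (hH : Measurable[history W Z (j - 1)] H) :
    ∫⁻ ω, H ω * ENNReal.ofReal (Real.exp (lam * momentIncrement P θ W Z z a b j ω)) ∂μ
      ≤ ENNReal.ofReal (Real.exp c) * ∫⁻ ω, H ω ∂μ := by
  classical
  have hj1 := (Finset.mem_Icc.mp hj).1
  have hG : Measurable fun w : Subject d => ENNReal.ofReal (Real.exp (lam *
      (feature θ z w a * feature θ z w b - featureMoment P θ z a b))) := by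
    have := measurable_feature θ z a
    have := measurable_feature θ z b
    fun_prop
  have := lintegral_mul_ite_le (μ := μ) (q := armProb W Z η T₀ z j)
    (h.history_le ((Nat.sub_le j 1).trans (Finset.mem_Icc.mp hj).2)) (h.meas_W j hj)
    (h.indep_history j hj) (h.meas_Z j hj (measurableSet_singleton z))
    (measurable_armProb T₀ z hj1) (fun ω => (armProb_mem hη T₀ z hj1 ω).1)
    (fun ω => (armProb_mem hη T₀ z hj1 ω).2) (h.condExp_arm hj z) hG
    (c := ENNReal.ofReal (Real.exp c))
    (by rw [ENNReal.one_le_ofReal]; exact Real.one_le_exp hc) (by rwa [h.law j hj]) hH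
  refine le_trans (le_of_eq (lintegral_congr fun ω => ?_)) this
  by_cases hz : Z j ω = z
  · simp only [momentIncrement, zAt, data, observe, Set.mem_preimage, Set.mem_singleton_iff, hz,
      if_true, feature]
  · simp [momentIncrement, zAt, data, observe, hz]

theorem IsDesign.armIncrement_step (h : IsDesign μ P η T T₀ W Z) (hη : 0 < η)
    {z : Fin 2} {lam : ℝ} (hl : |lam| ≤ 1)
    {j : ℕ} (hj : j ∈ Finset.Icc 1 T) {H : Ω → ENNReal} (hH : Measurable[history W Z (j - 1)] H) :
    ∫⁻ ω, H ω * ENNReal.ofReal (Real.exp (lam * armIncrement W Z η T₀ z j ω)) ∂μ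
      ≤ ENNReal.ofReal (Real.exp (1 * lam ^ 2)) * ∫⁻ ω, H ω ∂μ := by
  classical
  have hj1 := (Finset.mem_Icc.mp hj).1
  have := lintegral_mul_exp_indicator_sub_le (μ := μ) (q := armProb W Z η T₀ z j)
    (h.history_le ((Nat.sub_le j 1).trans (Finset.mem_Icc.mp hj).2))
    (h.meas_Z j hj (measurableSet_singleton z)) le_sup_left (h.sup_le hj)
    (measurable_armProb T₀ z hj1) (fun ω => (armProb_mem hη T₀ z hj1 ω).1)
    (fun ω => (armProb_mem hη T₀ z hj1 ω).2) (h.condExp_arm hj z) hH hl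
  refine le_trans (le_of_eq (lintegral_congr fun ω => ?_)) this
  by_cases hz : Z j ω = z <;> simp [armIncrement, zAt, data, observe, hz]

/-- All moment and arm-size martingales are within `κ √(n L)` at time `n`. -/
def Concentrated (P : Measure (Subject d)) (θ : Params d) (η : ℝ) (T₀ : ℕ) (W : ℕ → Ω → Subject d)
    (Z : ℕ → Ω → Fin 2) (κ L : ℝ) (n : ℕ) (ω : Ω) : Prop :=
  (∀ z a b, |∑ j ∈ Finset.Icc 1 n, momentIncrement P θ W Z z a b j ω| < κ * √(n * L)) ∧
    ∀ z, |∑ j ∈ Finset.Icc 1 n, armIncrement W Z η T₀ z j ω| < κ * √(n * L)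

end Design

/-! ### Uniform concentration of moments and arm sizes -/

section Mgf

variable {d : ℕ} {P : Measure (Subject d)} [IsProbabilityMeasure P] {θ : Params d}

theorem exists_feature_mgf (herr : SubGaussianErrors P θ) (hcov : CovariateCondition P) :
    ∃ V lam₀ : ℝ, 1 ≤ V ∧ 0 < lam₀ ∧ lam₀ ≤ 1 ∧ ∀ z a b, ∀ lam : ℝ, |lam| ≤ lam₀ →
      ∫⁻ w, ENNReal.ofReal (Real.exp (lam *
        (feature θ z w a * feature θ z w b - featureMoment P θ z a b))) ∂P
        ≤ ENNReal.ofReal (Real.exp (V * lam ^ 2)) := by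
  have h : ∀ i : Fin 2 × (Fin d ⊕ Fin 3) × (Fin d ⊕ Fin 3), ∃ V r : ℝ, 0 < r ∧ ∀ lam : ℝ,
      |lam| ≤ r → ∫⁻ w, ENNReal.ofReal (Real.exp (lam *
        (feature θ i.1 w i.2.1 * feature θ i.1 w i.2.2 - featureMoment P θ i.1 i.2.1 i.2.2))) ∂P
        ≤ ENNReal.ofReal (Real.exp (V * lam ^ 2)) := by
    rintro ⟨z, a, b⟩
    have ma := measurable_feature θ z a
    have mb := measurable_feature θ z b
    obtain ⟨r, hr, hi⟩ := (hasSqExp_feature herr hcov z a).exists_exp_mul ma.aemeasurable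
      mb.aemeasurable (hasSqExp_feature herr hcov z b) (featureMoment P θ z a b)
    obtain ⟨V, -, hV⟩ := exists_lintegral_exp_le P
      (g := fun w => feature θ z w a * feature θ z w b - featureMoment P θ z a b)
      (by fun_prop) hr hi (by
        have hi' : Integrable (fun w => feature θ z w a * feature θ z w b) P :=
          (memLp_feature herr hcov z a).integrable_mul (memLp_feature herr hcov z b)
        rw [integral_sub hi' (integrable_const _)]
        simp [featureMoment])
    exact ⟨V, r / 2, by linarith, hV⟩
  -- There are finitely many pairs of features and arms, so the constants can be made uniform.
  -- Taking `V ≥ 1` and `lam₀ ≤ 1` lets them also serve the arm indicators.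
  choose V r hr hV using h
  obtain ⟨V', hV'⟩ := (Set.finite_range V).bddAbove
  obtain ⟨r', hr'⟩ := (Set.finite_range fun i => (r i)⁻¹).bddAbove
  refine ⟨max 1 V', (max 1 r')⁻¹, le_max_left _ _, by positivity,
    inv_le_one_of_one_le₀ (le_max_left _ _), fun z a b lam hl => ?_⟩
  have h1 : (r (z, a, b))⁻¹ ≤ max 1 r' := (hr' ⟨_, rfl⟩).trans (le_max_right _ _)
  have h2 : (max 1 r')⁻¹ ≤ r (z, a, b) := inv_le_of_inv_le₀ (hr _) h1
  refine (hV (z, a, b) lam (hl.trans h2)).trans ?_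
  have h3 : V (z, a, b) ≤ max 1 V' := (hV' ⟨_, rfl⟩).trans (le_max_right _ _)
  gcongr

/-- All the martingales stay within `κ √(n L)`, `L = log T`, with probability `1 - 2 / T`. -/
theorem exists_concentration (herr : SubGaussianErrors P θ) (hcov : CovariateCondition P) :
    ∃ κ lam₀ : ℝ, 0 < κ ∧ 0 < lam₀ ∧ ∀ {Ω : Type*} [MeasurableSpace Ω] (μ : Measure Ω)
      [IsProbabilityMeasure μ] (W : ℕ → Ω → Subject d) (Z : ℕ → Ω → Fin 2) (η : ℝ) (T T₀ : ℕ),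
      0 < η → 3 ≤ T → 0 < T₀ → √(Real.log T / T₀) ≤ lam₀ → IsDesign μ P η T T₀ W Z →
      μ {ω | ∃ n ∈ Finset.Icc T₀ T, ¬ Concentrated P θ η T₀ W Z κ (Real.log T) n ω}
        ≤ ENNReal.ofReal (2 / T) := by
  obtain ⟨V, lam₀, hV, hl0, hl1, hmgf⟩ := exists_feature_mgf herr hcov
  set ι := (Fin 2 × (Fin d ⊕ Fin 3) × (Fin d ⊕ Fin 3)) ⊕ Fin 2
  set N : ℕ := Fintype.card ι with hN
  -- This `κ` makes each tail `2 T^(-(N+2))`. The union bound runs over at most `T` times and `N`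
  -- processes, and `N ≤ T^N`, so `2 / T` remains.
  refine ⟨V + (N + 2 : ℕ), lam₀, by positivity, hl0, ?_⟩
  intro Ω _ μ _ W Z η T T₀ hη hT hT₀ hlam h
  set κ : ℝ := V + (N + 2 : ℕ) with hκ
  set L := Real.log T with hL
  have hT1 : (1 : ℝ) < T := by exact_mod_cast (by omega : 1 < T)
  have hT0 : (0 : ℝ) < T := by linarith
  have hL0 : 0 ≤ L := (Real.log_pos hT1).le
  set S : ι → ℕ → Ω → ℝ := fun i j ω => Sum.elim
    (fun k => momentIncrement P θ W Z k.1 k.2.1 k.2.2 j ω) (fun z => armIncrement W Z η T₀ z j ω) i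
    with hS
  have hbad : {ω | ∃ n ∈ Finset.Icc T₀ T, ¬ Concentrated P θ η T₀ W Z κ L n ω}
      ⊆ ⋃ n ∈ Finset.Icc T₀ T, ⋃ i ∈ (Finset.univ : Finset ι),
        {ω | κ * √(n * L) ≤ |∑ j ∈ Finset.Icc 1 n, S i j ω|} := by
    rintro ω ⟨n, hn, hω⟩
    simp only [Set.mem_iUnion]
    refine ⟨n, hn, ?_⟩
    rw [Concentrated, not_and_or] at hω
    rcases hω with hω | hω
    · push Not at hω
      obtain ⟨z, a, b, hω⟩ := hω
      exact ⟨Sum.inl (z, a, b), Finset.mem_univ _, hω⟩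
    · push Not at hω
      obtain ⟨z, hω⟩ := hω
      exact ⟨Sum.inr z, Finset.mem_univ _, hω⟩
  have htail : ∀ n ∈ Finset.Icc T₀ T, ∀ i : ι,
      μ {ω | κ * √(n * L) ≤ |∑ j ∈ Finset.Icc 1 n, S i j ω|}
        ≤ 2 * ENNReal.ofReal (Real.exp (-((κ - V) * L))) := by
    intro n hn i
    obtain ⟨hn1, hn2⟩ := Finset.mem_Icc.mp hn
    have hnL : √(L / n) ≤ lam₀ := by
      refine le_trans (Real.sqrt_le_sqrt ?_) hlam
      have : (0 : ℝ) < T₀ := by exact_mod_cast hT₀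
      have : (T₀ : ℝ) ≤ n := by exact_mod_cast hn1
      gcongr
    refine measure_sqrt_le_abs_sum_le (history_mono W Z) (fun j hj => h.history_le hj)
      (T := T) (lam₀ := lam₀) (V := V) (D := S i) ?_ ?_ (by omega) hn2 hL0 hnL
    · intro j hj
      have hj1 := (Finset.mem_Icc.mp hj).1
      rcases i with ⟨z, a, b⟩ | z
      · exact measurable_momentIncrement θ z a b hj1
      · exact measurable_armIncrement z hj1
    · intro lam hlam' j hj H hH
      rcases i with ⟨z, a, b⟩ | z
      · exact h.momentIncrement_step hη θ (by positivity) (hmgf z a b lam hlam') hj hH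
      · refine (h.armIncrement_step hη (hlam'.trans hl1) hj hH).trans ?_
        gcongr
  have hexp : Real.exp (-((κ - V) * L)) = ((T : ℝ) ^ (N + 2))⁻¹ := by
    rw [hκ, add_sub_cancel_left, Real.exp_neg, ← Real.rpow_natCast, Real.rpow_def_of_pos hT0,
      mul_comm]
  calc _ ≤ _ := measure_mono hbad
    _ ≤ ∑ n ∈ Finset.Icc T₀ T, ∑ i : ι, 2 * ENNReal.ofReal (Real.exp (-((κ - V) * L))) := by
        refine (measure_biUnion_finset_le _ _).trans (Finset.sum_le_sum fun n hn => ?_)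
        exact (measure_biUnion_finset_le _ _).trans (Finset.sum_le_sum fun i _ => htail n hn i)
    _ ≤ T * (N * (2 * ENNReal.ofReal (Real.exp (-((κ - V) * L))))) := by
        simp only [Finset.sum_const, nsmul_eq_mul, Finset.card_univ, Nat.card_Icc]
        rw [← hN]
        gcongr
        omega
    _ = ENNReal.ofReal (T * (N * (2 * ((T : ℝ) ^ (N + 2))⁻¹))) := by
        rw [hexp, ENNReal.ofReal_mul (by positivity), ENNReal.ofReal_mul (by positivity),
          ENNReal.ofReal_mul (by positivity)]
        simp
    _ ≤ _ := by
        apply ENNReal.ofReal_le_ofReal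
        have h1 : (N : ℝ) ≤ (T : ℝ) ^ N := by
          exact_mod_cast (Nat.lt_pow_self (by omega : 1 < T)).le
        rw [pow_add, le_div_iff₀ hT0]
        have h2 : (0 : ℝ) < (T : ℝ) ^ N := by positivity
        have : (T : ℝ) * (N * (2 * ((T : ℝ) ^ N * (T : ℝ) ^ 2)⁻¹)) * T = 2 * (N / (T : ℝ) ^ N) := by
          field_simp
        rw [this]
        have : (N : ℝ) / (T : ℝ) ^ N ≤ 1 := by rw [div_le_one h2]; exact h1
        linarith

end Mgf

/-! ### Arm growth and accuracy along the trajectory -/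

section Trajectory

variable {d : ℕ} {Ω : Type*} {W : ℕ → Ω → Subject d} {Z : ℕ → Ω → Fin 2}
  {P : Measure (Subject d)} {θ : Params d}

theorem sum_ite_odd_mem (m : ℕ) :
    ((m : ℝ) - 1) / 2 ≤ ∑ j ∈ Finset.Icc 1 m, (if Odd j then (0 : ℝ) else 1) ∧
      ∑ j ∈ Finset.Icc 1 m, (if Odd j then (0 : ℝ) else 1) ≤ (m : ℝ) / 2 := by
  have h : ∀ m : ℕ, ∑ j ∈ Finset.Icc 1 m, (if Odd j then (0 : ℝ) else 1)
      = ((m : ℝ) - if Odd m then 1 else 0) / 2 := by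
    intro m
    induction m with
    | zero => simp
    | succ m ih =>
      rw [Finset.sum_Icc_succ_top (by omega), ih]
      by_cases h : Odd m
      · have h2 : ¬ Odd (m + 1) := by rw [Nat.odd_add_one]; simpa using h
        simp only [h, h2, if_true, if_false]; push_cast; ring
      · have h2 : Odd (m + 1) := by rw [Nat.odd_add_one]; exact h
        simp only [h, h2, if_true, if_false]; push_cast; ring
  rw [h]
  split_ifs <;> constructor <;> linarith

theorem sum_armProb_init_ge (η : ℝ) (T₀ : ℕ) (z : Fin 2) (ω : Ω) :
    ((T₀ : ℝ) - 1) / 2 ≤ ∑ j ∈ Finset.Icc 1 T₀, armProb W Z η T₀ z j ω := by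
  have h := sum_ite_odd_mem T₀
  have e : ∑ j ∈ Finset.Icc 1 T₀, treatProb W Z η T₀ j ω
      = ∑ j ∈ Finset.Icc 1 T₀, (if Odd j then (0 : ℝ) else 1) :=
    Finset.sum_congr rfl fun j hj => by simp [treatProb, (Finset.mem_Icc.mp hj).2]
  unfold armProb
  split_ifs
  · rw [e]; exact h.1
  · rw [Finset.sum_sub_distrib, e]
    simp only [Finset.sum_const, Nat.card_Icc, Nat.add_sub_cancel, nsmul_eq_mul, mul_one]
    linarith [h.2]

theorem sum_momentIncrement (z : Fin 2) (a b : Fin d ⊕ Fin 3) (n : ℕ) (ω : Ω) :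
    ∑ j ∈ Finset.Icc 1 n, momentIncrement P θ W Z z a b j ω
      = ∑ j ∈ arm (data W Z ω) z n,
          obsFeature θ z (data W Z ω j) a * obsFeature θ z (data W Z ω j) b
        - (arm (data W Z ω) z n).card * featureMoment P θ z a b := by
  simp only [momentIncrement]
  rw [← Finset.sum_filter]
  simp [arm, Finset.sum_sub_distrib]

theorem card_arm_eq (η : ℝ) (T₀ : ℕ) (z : Fin 2) (n : ℕ) (ω : Ω) :
    ((arm (data W Z ω) z n).card : ℝ) = ∑ j ∈ Finset.Icc 1 n, armIncrement W Z η T₀ z j ω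
      + ∑ j ∈ Finset.Icc 1 n, armProb W Z η T₀ z j ω := by
  rw [← Finset.sum_add_distrib]
  simp [armIncrement, arm, Finset.sum_boole]

theorem Concentrated.momentsClose {η : ℝ} {T₀ n : ℕ} {κ L c : ℝ} {ω : Ω} (hc : 0 < c) (hn : 0 < n)
    (hκ : 0 ≤ κ) (h : Concentrated P θ η T₀ W Z κ L n ω)
    (hcard : ∀ z, c * n ≤ (arm (data W Z ω) z n).card) :
    MomentsClose P θ (data W Z ω) n (κ / c * √(L / n)) := by
  intro z a b
  have hn' : (0 : ℝ) < n := by exact_mod_cast hn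
  -- The martingale bound scales with the total `n`, closeness with the arm size; `hcard` converts
  -- one into the other at the cost of `1 / c`.
  have h1 := (h.1 z a b).le
  rw [sum_momentIncrement] at h1
  refine h1.trans ?_
  have e : κ * √(n * L) = c * n * (κ / c * √(L / n)) := by
    have : √((n : ℝ) * L) = n * √(L / n) := by
      rw [show (n : ℝ) * L = n ^ 2 * (L / n) by field_simp, Real.sqrt_mul (by positivity),
        Real.sqrt_sq hn'.le]
    rw [this]; field_simp
  rw [e]
  have := hcard z
  gcongr

variable [IsProbabilityMeasure P]

/-- On the concentration event the plug-in estimators are accurate along the whole trajectory. -/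
theorem exists_trajectory_bound (hmodel : LinearModel P θ) (herr : SubGaussianErrors P θ)
    (hcov : CovariateCondition P) {κ : ℝ} (hκ : 0 < κ) :
    ∃ C ε : ℝ, 0 ≤ C ∧ 0 < ε ∧ ∀ {Ω : Type*} (W : ℕ → Ω → Subject d) (Z : ℕ → Ω → Fin 2)
      (η L : ℝ) (T T₀ : ℕ) (ω : Ω), 0 < η → 0 ≤ L → 2 ≤ T₀ → √(L / T₀) ≤ ε →
      1 / (2 * θ.πLow) ^ (1 / η) ≤ T₀ →
      (∀ n ∈ Finset.Icc T₀ T, Concentrated P θ η T₀ W Z κ L n ω) →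
      ∀ t ∈ Finset.Icc 1 T, T₀ < t →
        loss P (action (data W Z ω) η T₀ t) - loss P (optAction θ) ≤ C * (L / ((t : ℝ) - 1)) := by
  obtain ⟨A, ρ₀, hA, hρ₀, hacc⟩ := exists_accuracy hmodel herr hcov
  obtain ⟨E, hE, hloss⟩ := exists_loss_sub_le hmodel herr hcov
  have hl := πLow_pos hmodel
  have hlh := πLow_le_half (θ := θ)
  set p := θ.πLow with hp
  set c : ℝ := p / 4 with hc
  have hc0 : 0 < c := by positivity
  -- The three thresholds ensure `r n ≤ 1` for the arm-size induction, `r n ≤ ρ₀` for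
  -- `exists_accuracy`, and `A * r n ≤ p / 2` to keep both allocation probabilities above `p / 2`.
  refine ⟨E * (A * (κ / c)) ^ 2, min (c / κ) (min (ρ₀ * c / κ) (p / 2 / A * c / κ)),
    by positivity, by positivity, ?_⟩
  intro Ω W Z η L T T₀ ω hη hL hT₀ hLε hclip hconc
  set D := data W Z ω with hD
  have hT₀' : (2 : ℝ) ≤ T₀ := by exact_mod_cast hT₀
  set r : ℕ → ℝ := fun n => κ / c * √(L / n) with hr
  have hr0 : ∀ n, 0 ≤ r n := fun n => by positivity
  have hrle : ∀ n, T₀ ≤ n → r n ≤ 1 ∧ r n ≤ ρ₀ ∧ A * r n ≤ p / 2 := by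
    intro n hn
    have hn' : (T₀ : ℝ) ≤ n := by exact_mod_cast hn
    have h1 : √(L / n) ≤ min (c / κ) (min (ρ₀ * c / κ) (p / 2 / A * c / κ)) := by
      refine le_trans (Real.sqrt_le_sqrt ?_) hLε
      gcongr
    have e1 := h1.trans (min_le_left _ _)
    have e2 := h1.trans ((min_le_right _ _).trans (min_le_left _ _))
    have e3 := h1.trans ((min_le_right _ _).trans (min_le_right _ _))
    have f : ∀ x, √(L / n) ≤ x * c / κ → r n ≤ x := by
      intro x hx
      calc κ / c * √(L / n) ≤ κ / c * (x * c / κ) := by gcongr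
        _ = x := by field_simp
    refine ⟨f 1 (by rwa [one_mul]), f _ e2, ?_⟩
    have := f _ e3
    rw [le_div_iff₀ hA] at this
    linarith
  have hest : ∀ n, n ∈ Finset.Icc T₀ T → (∀ z, c * n ≤ (arm D z n).card) →
      (∀ z, ∑ i, |(αYHat D z n - γHat D z n • αSHat D z n + γHat D z n • θ.αS z - θ.αY z) i|
        ≤ A * r n) ∧
      (∀ z, |γHat D z n - θ.γ z| ≤ A * r n) ∧ |πClip D η (n + 1) - θ.πStar| ≤ A * r n := by
    intro n hn hcard
    obtain ⟨hn1, hn2⟩ := Finset.mem_Icc.mp hn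
    have hn0 : 0 < n := by omega
    have hn0' : (0 : ℝ) < n := by exact_mod_cast hn0
    obtain ⟨a1, a2, a3⟩ := hacc D n (r n) (hr0 n) (hrle n hn1).2.1 (fun z => by
      have : (0 : ℝ) < (arm D z n).card := lt_of_lt_of_le (by positivity) (hcard z)
      exact_mod_cast this) ((hconc n hn).momentsClose hc0 hn0 hκ.le hcard)
    refine ⟨a1, a2, (abs_πClip_sub_le D θ ?_).trans a3⟩
    refine ζ_le_of_le hη hl (by omega) (hclip.trans ?_)
    exact_mod_cast (by omega : T₀ ≤ n + 1)
  have hpS : p ≤ θ.πStar ∧ p ≤ 1 - θ.πStar := ⟨min_le_left _ _, min_le_right _ _⟩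
  -- Large arms at all earlier times give accurate allocations up to stage `n`, hence a compensator
  -- of at least `2 c n`; the martingale deviation removes at most `c n`.
  have hcard : ∀ n, n ∈ Finset.Icc T₀ T → ∀ z, c * n ≤ (arm D z n).card := by
    intro n
    induction n using Nat.strong_induction_on with
    | _ n ih =>
      intro hn z
      obtain ⟨hn1, hn2⟩ := Finset.mem_Icc.mp hn
      have hn1' : (T₀ : ℝ) ≤ n := by exact_mod_cast hn1
      have hn0' : (0 : ℝ) < n := by linarith
      have hprob : ∀ j ∈ Finset.Ioc T₀ n, p / 2 ≤ armProb W Z η T₀ z j ω := by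
        intro j hj
        obtain ⟨hj1, hj2⟩ := Finset.mem_Ioc.mp hj
        obtain ⟨k, rfl⟩ : ∃ k, j = k + 1 := ⟨j - 1, by omega⟩
        have hk : k ∈ Finset.Icc T₀ T := Finset.mem_Icc.mpr ⟨by omega, by omega⟩
        have h3 := (hest k hk (ih k (by omega) hk)).2.2.trans (hrle k (by omega)).2.2
        have h4 := abs_le.mp h3
        have h5 : ¬ (k + 1 ≤ T₀) := by omega
        simp only [armProb, treatProb, h5, if_false]
        split_ifs <;> linarith [hpS.1, hpS.2, h4.1, h4.2]
      have hsum : p / 2 * n ≤ ∑ j ∈ Finset.Icc 1 n, armProb W Z η T₀ z j ω := by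
        have hsplit : ∑ j ∈ Finset.Icc 1 n, armProb W Z η T₀ z j ω
            = ∑ j ∈ Finset.Icc 1 T₀, armProb W Z η T₀ z j ω
              + ∑ j ∈ Finset.Ioc T₀ n, armProb W Z η T₀ z j ω := by
          rw [← Finset.sum_union]
          · congr 1
            ext j; simp only [Finset.mem_union, Finset.mem_Icc, Finset.mem_Ioc]; omega
          · rw [Finset.disjoint_left]
            intro j; simp only [Finset.mem_Icc, Finset.mem_Ioc]; omega
        have h1 := sum_armProb_init_ge (W := W) (Z := Z) η T₀ z ω
        have h2 : (p / 2) * ((n : ℝ) - T₀) ≤ ∑ j ∈ Finset.Ioc T₀ n, armProb W Z η T₀ z j ω := by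
          have := Finset.card_nsmul_le_sum _ _ _ hprob
          rw [Nat.card_Ioc, nsmul_eq_mul, Nat.cast_sub hn1] at this
          linarith
        rw [hsplit]
        -- For the initialization block, `p ≤ 1 / 2` and `T₀ ≥ 2` give `(p / 2) T₀ ≤ (T₀ - 1) / 2`.
        nlinarith
      have hdev := (abs_le.mp ((hconc n hn).2 z).le).1
      have e : κ * √(n * L) = c * n * r n := by
        have : √((n : ℝ) * L) = n * √(L / n) := by
          rw [show (n : ℝ) * L = n ^ 2 * (L / n) by field_simp, Real.sqrt_mul (by positivity),
            Real.sqrt_sq hn0'.le]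
        rw [this, hr]; field_simp
      have h6 : c * n * r n ≤ c * n * 1 := by
        have := (hrle n hn1).1
        gcongr
      rw [card_arm_eq η T₀ z n ω]
      rw [e] at hdev
      have : p / 2 * (n : ℝ) = 2 * (c * n) := by rw [hc]; ring
      linarith
  intro t ht hlt
  -- The action of stage `t` uses estimates from `t - 1` stages, hence the denominator `t - 1`.
  obtain ⟨n, rfl⟩ : ∃ n, t = n + 1 := ⟨t - 1, by omega⟩
  have hn : n ∈ Finset.Icc T₀ T :=
    Finset.mem_Icc.mpr ⟨by omega, by have := (Finset.mem_Icc.mp ht).2; omega⟩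
  have hn0 : (0 : ℝ) < n := by exact_mod_cast (by omega : 0 < n)
  obtain ⟨a1, a2, a3⟩ := hest n hn (hcard n hn)
  have h4 := abs_le.mp (a3.trans (hrle n (by omega)).2.2)
  have hact : action D η T₀ (n + 1) = ⟨πClip D η (n + 1),
      linMean (fun z => αYHat D z n - γHat D z n • αSHat D z n) (fun z => γHat D z n)⟩ := by
    rw [action, if_neg (by omega)]
    rfl
  rw [hact]
  refine (hloss _ _ _ (A * r n) (mul_nonneg hA.le (hr0 n)) ?_ ?_ a3 a1 a2).trans (le_of_eq ?_)
  · linarith [hpS.1, h4.1]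
  · linarith [hpS.2, h4.2]
  · have : √(L / n) ^ 2 = L / n := Real.sq_sqrt (by positivity)
    push_cast
    rw [add_sub_cancel_right, ← this, hr]
    ring

end Trajectory

/-! ### Measurability of the loss of a random action -/

section LossMeasurability

variable {d : ℕ} {Ω : Type*} [MeasurableSpace Ω] {P : Measure (Subject d)} [IsProbabilityMeasure P]
  {θ : Params d}

theorem measurable_loss_linMean (herr : SubGaussianErrors P θ) (hcov : CovariateCondition P)
    {p : Ω → ℝ} {β : Fin 2 → Ω → Fin d → ℝ} {g : Fin 2 → Ω → ℝ} (hp : Measurable p)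
    (hβ : ∀ z, Measurable (β z)) (hg : ∀ z, Measurable (g z)) (h0 : ∀ ω, 0 < p ω)
    (h1 : ∀ ω, p ω < 1) :
    Measurable fun ω => loss P ⟨p ω, linMean (fun z => β z ω) fun z => g z ω⟩ := by
  -- The measure defining the loss varies with `ω`; the explicit formula replaces it by an integral
  -- over the fixed `P` of a jointly measurable integrand.
  have e : ∀ ω, loss P ⟨p ω, linMean (fun z => β z ω) fun z => g z ω⟩ = _ := fun ω =>
    loss_eq (a := ⟨p ω, linMean (fun z => β z ω) fun z => g z ω⟩) (h0 ω) (h1 ω)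
      (measurable_linMean_comp _ _) (memLp_linMean herr hcov _ _) (memLp_y herr hcov)
  simp_rw [e]
  have hl : ∀ z, Measurable fun q : Ω × Subject d =>
      linMean (fun z => β z q.1) (fun z => g z q.1) z q.2.x q.2.s := by
    intro z
    unfold linMean
    refine (measurable_dotProduct ((hβ z).comp measurable_fst)
      (measurable_x.comp measurable_snd)).add ?_
    have := hg z
    fun_prop
  have hl0 := hl 0
  have hl1 := hl 1
  have hm : Measurable fun q : Ω × Subject d =>
      ((1 - p q.1) * (q.2.y 1 - linMean (fun z => β z q.1) (fun z => g z q.1) 1 q.2.x q.2.s)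
        + p q.1 * (q.2.y 0 - linMean (fun z => β z q.1) (fun z => g z q.1) 0 q.2.x q.2.s)) ^ 2 := by
    fun_prop
  exact measurable_const.add ((hm.stronglyMeasurable.integral_prod_right'.measurable).div
    (hp.mul (measurable_const.sub hp)))

end LossMeasurability

/-! ### Length of the initialization and summation of the regret -/

section Regret

/-- The term `t = 1` is `1 / 0 = 0`, so the sum is the harmonic number of index `n - 1`. -/
theorem sum_inv_sub_one_le {n : ℕ} (hn : 2 ≤ n) :
    ∑ t ∈ Finset.Icc 1 n, 1 / ((t : ℝ) - 1) ≤ 1 + Real.log n := by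
  have h : ∀ m : ℕ, ∑ t ∈ Finset.Icc 1 (m + 1), 1 / ((t : ℝ) - 1) = (harmonic m : ℝ) := by
    intro m
    induction m with
    | zero => simp
    | succ m ih =>
      rw [Finset.sum_Icc_succ_top (by omega), ih, harmonic_succ]
      push_cast
      rw [add_sub_cancel_right, one_div]
  obtain ⟨m, rfl⟩ : ∃ m, n = m + 1 := ⟨n - 1, by omega⟩
  rw [h]
  have hm : (0 : ℝ) < m := by exact_mod_cast (by omega : 0 < m)
  have := Real.log_le_log hm (by linarith : (m : ℝ) ≤ (m : ℝ) + 1)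
  push_cast
  linarith [harmonic_le_one_add_log m]

theorem one_le_log_of_three_le {T : ℕ} (hT : 3 ≤ T) : 1 ≤ Real.log T := by
  have h : (3 : ℝ) ≤ T := by exact_mod_cast hT
  rw [Real.le_log_iff_exp_le (by linarith)]
  linarith [Real.exp_one_lt_d9]

theorem C4Order_inv_sq {T : ℕ} (hT : 3 ≤ T) : C4Order (T : ℝ)⁻¹ T ^ 2 = 3 * Real.log T := by
  have hL := one_le_log_of_three_le hT
  have e : Real.log ((T : ℝ) / (T : ℝ)⁻¹) = 2 * Real.log T := by
    rw [div_inv_eq_mul, ← sq, Real.log_pow]; norm_num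
  rw [C4Order, e, Real.sq_sqrt (by linarith)]
  ring

theorem C0_inv_sq_le {T : ℕ} (hT : 3 ≤ T) : C0 (T : ℝ)⁻¹ T ^ 2 ≤ 6 * Real.log T := by
  have hL := one_le_log_of_three_le hT
  have hT0 : (0 : ℝ) < T := by exact_mod_cast (by omega : 0 < T)
  have e : Real.log (5.2 / (T : ℝ)⁻¹) = Real.log 5.2 + Real.log T := by
    rw [div_inv_eq_mul, Real.log_mul (by norm_num) hT0.ne']
  have h5 : Real.log 5.2 ≤ 5.2 - 1 := Real.log_le_sub_one_of_pos (by norm_num)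
  have h50 : 0 ≤ Real.log 5.2 := Real.log_nonneg (by norm_num)
  have hll0 : 0 ≤ Real.log (Real.log T) := Real.log_nonneg hL
  have hll : Real.log (Real.log T) ≤ Real.log T - 1 := Real.log_le_sub_one_of_pos (by linarith)
  rw [C0, e, mul_pow, Real.sq_sqrt (by positivity)]
  norm_num
  nlinarith

variable {d : ℕ} {P : Measure (Subject d)} [IsProbabilityMeasure P] {θ : Params d}

-- The first term of the maximum suffices: `c4² ≥ 3 (A B + 1)² log T`, and `(A B + 1)² ≥ A B`. Thus
-- any multiple `B` of `log T` is reached by enlarging `c₀`, independently of `η`.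
omit [IsProbabilityMeasure P] in
theorem initLength_lower (hmodel : LinearModel P θ) {A : ℝ}
    (hA : A = min (min (θ.σ 0 ^ 4) (θ.σ 1 ^ 4)) (θ.σ 0 ^ 2 * θ.σ 1 ^ 2 * θ.πLow / 2 ^ 5))
    {B : ℝ} (hB : 0 ≤ B) (η : ℝ) {T : ℕ} (hT : 3 ≤ T) (c0 : ℝ) {c4 : ℝ}
    (h4 : (A * B + 1) * C4Order (T : ℝ)⁻¹ T ≤ c4) :
    B * Real.log T ≤ initLength θ η c0 c4 := by
  have hl := πLow_pos hmodel
  have e0 := hmodel.σ_pos 0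
  have e1 := hmodel.σ_pos 1
  have hA0 : 0 < A := by rw [hA]; positivity
  have hL := one_le_log_of_three_le hT
  refine le_trans ?_ (Nat.le_ceil _)
  refine le_trans ?_ (le_max_left _ _)
  rw [← hA, le_div_iff₀ hA0]
  have h0 : 0 ≤ C4Order (T : ℝ)⁻¹ T := Real.sqrt_nonneg _
  have hAB : 0 ≤ A * B := by positivity
  have h1 : ((A * B + 1) * C4Order (T : ℝ)⁻¹ T) ^ 2 ≤ c4 ^ 2 := by gcongr
  rw [mul_pow, C4Order_inv_sq hT] at h1
  nlinarith [mul_nonneg hAB (by linarith : (0 : ℝ) ≤ Real.log T),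
    mul_nonneg (sq_nonneg (A * B)) (by linarith : (0 : ℝ) ≤ Real.log T)]

-- All three terms of the maximum are `O(log T)`; constants and the rounding are absorbed since `log
-- T ≥ 1` for `T ≥ 3`.
omit [IsProbabilityMeasure P] in
theorem exists_initLength_upper (hmodel : LinearModel P θ) (η c₁ : ℝ) :
    ∃ C : ℝ, 0 ≤ C ∧ ∀ (T : ℕ) (c4 : ℝ), 3 ≤ T → 0 ≤ c4 → c4 ≤ c₁ * C4Order (T : ℝ)⁻¹ T →
      (initLength θ η (C0 (T : ℝ)⁻¹ T) c4 : ℝ) ≤ C * Real.log T := by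
  have hl := πLow_pos hmodel
  have e0 := hmodel.σ_pos 0
  have e1 := hmodel.σ_pos 1
  set A := min (min (θ.σ 0 ^ 4) (θ.σ 1 ^ 4)) (θ.σ 0 ^ 2 * θ.σ 1 ^ 2 * θ.πLow / 2 ^ 5) with hA
  have hA0 : 0 < A := by positivity
  set u := 1 / (2 * θ.πLow) ^ (1 / η) with hu
  have hu0 : 0 ≤ u := by positivity
  refine ⟨24 * c₁ ^ 2 / A + 96 / θ.πLow ^ 2 + u + 1, by positivity, ?_⟩
  intro T c4 hT h0 h4
  have hL := one_le_log_of_three_le hT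
  set L := Real.log T with hLdef
  have h1 : c4 ^ 2 ≤ 3 * c₁ ^ 2 * L := by
    have : c4 ^ 2 ≤ (c₁ * C4Order (T : ℝ)⁻¹ T) ^ 2 := by gcongr
    rw [mul_pow, C4Order_inv_sq hT] at this
    linarith
  have h2 := C0_inv_sq_le hT
  have a1 : 8 * c4 ^ 2 / A ≤ 24 * c₁ ^ 2 / A * L := by
    rw [div_mul_eq_mul_div]
    exact div_le_div_of_nonneg_right (by linarith) hA0.le
  have a2 : 16 * C0 (T : ℝ)⁻¹ T ^ 2 / θ.πLow ^ 2 ≤ 96 / θ.πLow ^ 2 * L := by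
    rw [div_mul_eq_mul_div]
    exact div_le_div_of_nonneg_right (by linarith) (sq_nonneg _)
  have a3 : u ≤ u * L := le_mul_of_one_le_right hu0 hL
  have b1 : 0 ≤ 24 * c₁ ^ 2 / A * L := by positivity
  have b2 : 0 ≤ 96 / θ.πLow ^ 2 * L := by positivity
  have b3 : 0 ≤ u * L := by positivity
  rw [initLength, ← hA, ← hu]
  have hnn : 0 ≤ max (8 * c4 ^ 2 / A) (max (16 * C0 (T : ℝ)⁻¹ T ^ 2 / θ.πLow ^ 2) u) :=
    le_max_of_le_right (le_max_of_le_right hu0)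
  refine (Nat.ceil_lt_add_one hnn).le.trans ?_
  have : max (8 * c4 ^ 2 / A) (max (16 * C0 (T : ℝ)⁻¹ T ^ 2 / θ.πLow ^ 2) u)
      ≤ 24 * c₁ ^ 2 / A * L + 96 / θ.πLow ^ 2 * L + u * L :=
    max_le (by linarith) (max_le (by linarith) (by linarith))
  linarith

omit [IsProbabilityMeasure P] in
theorem loss_nonneg (P : Measure (Subject d)) (a : Action d) : 0 ≤ loss P a :=
  variance_nonneg _ _

omit [IsProbabilityMeasure P] in
theorem regret_eq_sum {Ω : Type*} (η : ℝ) (T T₀ : ℕ) (W : ℕ → Ω → Subject d)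
    (Z : ℕ → Ω → Fin 2) (ω : Ω) :
    regret P θ η T T₀ W Z ω = ∑ t ∈ Finset.Icc 1 T,
      (loss P (action (data W Z ω) η T₀ t) - loss P (optAction θ)) := by
  rw [Finset.sum_sub_distrib, regret]
  simp

omit [IsProbabilityMeasure P] in
/-- A pathwise regret bound from a bound on the excess losses of the second phase. -/
theorem regret_le_of_excess_le {Ω : Type*} {η : ℝ} {T T₀ : ℕ} {W : ℕ → Ω → Subject d}
    {Z : ℕ → Ω → Fin 2} {ω : Ω} {C I L : ℝ} (hT : 2 ≤ T) (hC : 0 ≤ C) (hL : 0 ≤ L)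
    (hI : |loss P ⟨1 / 2, fun _ _ _ => 0⟩ - loss P (optAction θ)| ≤ I)
    (h : ∀ t ∈ Finset.Icc 1 T, T₀ < t →
      loss P (action (data W Z ω) η T₀ t) - loss P (optAction θ) ≤ C * (L / ((t : ℝ) - 1))) :
    regret P θ η T T₀ W Z ω ≤ T₀ * I + C * L * (1 + Real.log T) := by
  have hI0 : 0 ≤ I := (abs_nonneg _).trans hI
  rw [regret_eq_sum]
  calc ∑ t ∈ Finset.Icc 1 T, (loss P (action (data W Z ω) η T₀ t) - loss P (optAction θ))
      ≤ ∑ t ∈ Finset.Icc 1 T, ((if t ≤ T₀ then I else 0) + C * L * (1 / ((t : ℝ) - 1))) := by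
        refine Finset.sum_le_sum fun t ht => ?_
        have ht1 : (1 : ℝ) ≤ t := by exact_mod_cast (Finset.mem_Icc.mp ht).1
        have hnn : 0 ≤ C * L * (1 / ((t : ℝ) - 1)) := by
          have : 0 ≤ (t : ℝ) - 1 := by linarith
          positivity
        by_cases h0 : t ≤ T₀
        · rw [action, if_pos h0, if_pos h0]
          linarith [(abs_le.mp hI).2]
        · rw [if_neg h0, zero_add]
          refine (h t ht (not_le.mp h0)).trans (le_of_eq (by ring))
    _ = ((Finset.Icc 1 T).filter (· ≤ T₀)).card * I
          + C * L * ∑ t ∈ Finset.Icc 1 T, 1 / ((t : ℝ) - 1) := by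
        rw [Finset.sum_add_distrib, ← Finset.mul_sum, ← Finset.sum_filter, Finset.sum_const,
          nsmul_eq_mul]
    _ ≤ T₀ * I + C * L * (1 + Real.log T) := by
        have h1 : ((Finset.Icc 1 T).filter (· ≤ T₀)).card ≤ T₀ := by
          calc _ ≤ (Finset.Icc 1 T₀).card := Finset.card_le_card fun t ht => by
                simp only [Finset.mem_filter, Finset.mem_Icc] at ht ⊢
                exact ⟨ht.1.1, ht.2⟩
            _ = T₀ := by simp
        have h2 : (((Finset.Icc 1 T).filter (· ≤ T₀)).card : ℝ) ≤ T₀ := by exact_mod_cast h1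
        have h3 := sum_inv_sub_one_le hT
        gcongr

theorem IsDesign.measurable_loss {Ω : Type*} [MeasurableSpace Ω] {μ : Measure Ω}
    {η : ℝ} {T T₀ : ℕ} {W : ℕ → Ω → Subject d} {Z : ℕ → Ω → Fin 2}
    (h : IsDesign μ P η T T₀ W Z) (hη : 0 < η) (herr : SubGaussianErrors P θ)
    (hcov : CovariateCondition P) {t : ℕ} (ht : t ∈ Finset.Icc 1 T) :
    Measurable fun ω => loss P (action (data W Z ω) η T₀ t) := by
  obtain ⟨ht1, htT⟩ := Finset.mem_Icc.mp ht
  obtain ⟨n, rfl⟩ : ∃ n, t = n + 1 := ⟨t - 1, by omega⟩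
  unfold action
  split_ifs
  · exact measurable_const
  · have hD : ∀ j ∈ Finset.Icc 1 n, Measurable fun ω => data W Z ω j := fun j hj =>
      h.measurable_data (Finset.Icc_subset_Icc_right (by omega) hj)
    exact measurable_loss_linMean herr hcov
      (p := fun ω => πClip (data W Z ω) η (n + 1))
      (β := fun z ω => αYHat (data W Z ω) z n - γHat (data W Z ω) z n • αSHat (data W Z ω) z n)
      (g := fun z ω => γHat (data W Z ω) z n) (measurable_πClip hD η)
      (fun z => (measurable_αYHat hD z).sub ((measurable_γHat hD z).smul (measurable_αSHat hD z)))
      (fun z => measurable_γHat hD z) (fun ω => πClip_pos _ η ht1)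
      (fun ω => πClip_lt_one _ hη ht1)

theorem IsDesign.integrable_regret {Ω : Type*} [MeasurableSpace Ω] {μ : Measure Ω}
    [IsProbabilityMeasure μ] {η : ℝ} {T T₀ : ℕ} {W : ℕ → Ω → Subject d} {Z : ℕ → Ω → Fin 2}
    (h : IsDesign μ P η T T₀ W Z) (hη : 0 < η) (herr : SubGaussianErrors P θ)
    (hcov : CovariateCondition P) {M : ℝ}
    (hM : ∀ᵐ ω ∂μ, ∀ t ∈ Finset.Icc 1 T, loss P (action (data W Z ω) η T₀ t) ≤ M) :
    Integrable (regret P θ η T T₀ W Z) μ := by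
  refine Integrable.sub (integrable_finsetSum _ fun t ht => ?_) (integrable_const _)
  refine Integrable.mono' (integrable_const M)
    (h.measurable_loss hη herr hcov ht).aestronglyMeasurable ?_
  filter_upwards [hM] with ω hω
  rw [Real.norm_of_nonneg (loss_nonneg _ _)]
  exact hω t ht

/-- An integrable variable bounded by `K` off an event of small probability and by `R` on it. -/
theorem integral_le_of_measure_le {Ω : Type*} [MeasurableSpace Ω] {μ : Measure Ω}
    [IsProbabilityMeasure μ] {f : Ω → ℝ} (hf : Integrable f μ) {K R q : ℝ} (hK : 0 ≤ K) (hR : 0 ≤ R)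
    (hq : 0 ≤ q) {S : Set Ω} (hS : μ S ≤ ENNReal.ofReal q) (h1 : ∀ ω ∉ S, f ω ≤ K)
    (h2 : ∀ᵐ ω ∂μ, f ω ≤ R) : ∫ ω, f ω ∂μ ≤ K + R * q := by
  -- A measurable hull of the same measure avoids proving that the exceptional event is measurable.
  set S' := toMeasurable μ S with hS'
  have hm : MeasurableSet S' := measurableSet_toMeasurable _ _
  have hi : Integrable (S'.indicator fun _ => R) μ := (integrable_const R).indicator hm
  calc ∫ ω, f ω ∂μ ≤ ∫ ω, (K + S'.indicator (fun _ => R) ω) ∂μ := by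
        refine integral_mono_ae hf ((integrable_const K).add hi) ?_
        filter_upwards [h2] with ω hω
        by_cases h : ω ∈ S'
        · simp only [h, Set.indicator_of_mem]; linarith
        · simp only [h, not_false_eq_true, Set.indicator_of_notMem, add_zero]
          exact h1 ω fun hω' => h (subset_toMeasurable μ S hω')
    _ = K + R * μ.real S' := by
        rw [integral_add (integrable_const K) hi, integral_indicator_const R hm]
        simp [mul_comm]
    _ ≤ K + R * q := by
        have : μ.real S' ≤ q := by
          rw [measureReal_def, measure_toMeasurable]
          exact ENNReal.toReal_le_of_le_ofReal hq hS
        gcongr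

end Regret

end SLOACI

/-! ### The expected regret bound -/

theorem theoremS3 {d : ℕ} (P : Measure (SLOACI.Subject d)) [IsProbabilityMeasure P]
    (θ : SLOACI.Params d) (hmodel : SLOACI.LinearModel P θ)
    (herr : SLOACI.SubGaussianErrors P θ) (hcov : SLOACI.CovariateCondition P) :
    ∃ c₀ : ℝ, 0 < c₀ ∧ ∀ η : ℝ, 0 < η → ∀ c₁ : ℝ,
      ∃ (C : ℝ) (k : ℕ), ∀ T : ℕ, 3 ≤ T → ∀ δ : ℝ, δ = (T : ℝ)⁻¹ →
        ∀ C4 : ℝ, c₀ * SLOACI.C4Order δ T ≤ C4 → C4 ≤ c₁ * SLOACI.C4Order δ T →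
        ∀ T₀ : ℕ, T₀ = SLOACI.initLength θ η (SLOACI.C0 δ T) C4 →
        ∀ (Ω : Type*) [MeasurableSpace Ω] (μ : Measure Ω) [IsProbabilityMeasure μ]
          (W : ℕ → Ω → SLOACI.Subject d) (Z : ℕ → Ω → Fin 2),
          SLOACI.IsDesign μ P η T T₀ W Z →
          ∀ ℓmax : ℝ, SLOACI.loss P (SLOACI.optAction θ) ≤ ℓmax →
            (∀ᵐ ω ∂μ, ∀ t ∈ Finset.Icc 1 T,
              SLOACI.loss P (SLOACI.action (SLOACI.data W Z ω) η T₀ t) ≤ ℓmax) →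
            Integrable (SLOACI.regret P θ η T T₀ W Z) μ ∧
              ∫ ω, SLOACI.regret P θ η T T₀ W Z ω ∂μ ≤
                C * (Real.log T ^ 2 * Real.log (Real.log T ^ 2) ^ k)
                  + 2 * (ℓmax - SLOACI.loss P (SLOACI.optAction θ)) := by
  obtain ⟨κ, lam₀, hκ, hlam₀, hconc⟩ := SLOACI.exists_concentration herr hcov
  obtain ⟨C', ε, hC', hε, htraj⟩ := SLOACI.exists_trajectory_bound hmodel herr hcov hκ
  have hl := SLOACI.πLow_pos hmodel
  have e0 := hmodel.σ_pos 0
  have e1 := hmodel.σ_pos 1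
  set A := min (min (θ.σ 0 ^ 4) (θ.σ 1 ^ 4)) (θ.σ 0 ^ 2 * θ.σ 1 ^ 2 * θ.πLow / 2 ^ 5) with hA
  have hA0 : 0 < A := by positivity
  set e := min ε lam₀ with he
  have he0 : 0 < e := lt_min hε hlam₀
  -- In `T₀ ≥ B log T` the summand `2` gives `T₀ ≥ 2`, and `1 / e²` gives `√(log T / T₀) ≤ e`, as
  -- both concentration and trajectory bounds require.
  set B := 2 + 1 / e ^ 2 with hB
  have hB0 : 0 < B := by positivity
  refine ⟨A * B + 1, by positivity, fun η hη c₁ => ?_⟩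
  obtain ⟨K, hK0, hK⟩ := SLOACI.exists_initLength_upper hmodel η c₁
  set I := |SLOACI.loss P ⟨1 / 2, fun _ _ _ => 0⟩ - SLOACI.loss P (SLOACI.optAction θ)| with hI
  have hI0 : 0 ≤ I := abs_nonneg _
  -- No iterated logarithm is lost, so `k = 0`. `K * I` pays for the initialization and `2 * C'` for
  -- the second phase.
  refine ⟨K * I + 2 * C', 0, ?_⟩
  rintro T hT δ rfl C4 h4 h4' T₀ hT₀ Ω _ μ _ W Z hdes ℓmax hℓ hmax
  have hL := SLOACI.one_le_log_of_three_le hT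
  set L := Real.log T with hLdef
  have hTpos : (0 : ℝ) < T := by exact_mod_cast (by omega : 0 < T)
  have hC40 : 0 ≤ C4 := le_trans (mul_nonneg (by positivity) (Real.sqrt_nonneg _)) h4
  have hlow : B * L ≤ T₀ := by
    rw [hT₀]; exact SLOACI.initLength_lower hmodel hA hB0.le η hT _ h4
  have hup : (T₀ : ℝ) ≤ K * L := by
    rw [hT₀]; exact hK T C4 hT hC40 h4'
  have hBL : B ≤ B * L := le_mul_of_one_le_right hB0.le hL
  have h2T₀ : (2 : ℝ) ≤ T₀ := by
    have : (0 : ℝ) < 1 / e ^ 2 := by positivity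
    linarith
  have h2 : 2 ≤ T₀ := by exact_mod_cast h2T₀
  have hsqrt : √(L / T₀) ≤ e := by
    rw [Real.sqrt_le_left he0.le, div_le_iff₀ (by linarith)]
    have h3 : 1 / e ^ 2 * L ≤ T₀ := by
      refine le_trans ?_ hlow
      gcongr
      linarith
    rw [div_mul_eq_mul_div, one_mul, div_le_iff₀ (by positivity)] at h3
    linarith
  have hclip : 1 / (2 * θ.πLow) ^ (1 / η) ≤ T₀ := by
    rw [hT₀]
    exact ((le_max_right _ _).trans (le_max_right _ _)).trans (Nat.le_ceil _)
  have hint := hdes.integrable_regret (θ := θ) hη herr hcov hmax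
  refine ⟨hint, ?_⟩
  set S := {ω | ∃ n ∈ Finset.Icc T₀ T, ¬ SLOACI.Concentrated P θ η T₀ W Z κ L n ω} with hS
  have hPS : μ S ≤ ENNReal.ofReal (2 / T) :=
    hconc μ W Z η T T₀ hη hT (by omega) (hsqrt.trans (min_le_right _ _)) hdes
  have hgood : ∀ ω ∉ S, SLOACI.regret P θ η T T₀ W Z ω ≤ T₀ * I + C' * L * (1 + L) := by
    intro ω hω
    refine SLOACI.regret_le_of_excess_le (by omega) hC' (by linarith) le_rfl ?_
    refine htraj W Z η L T T₀ ω hη (by linarith) h2 (hsqrt.trans (min_le_left _ _)) hclip ?_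
    intro n hn
    by_contra hcon
    exact hω ⟨n, hn, hcon⟩
  -- The crude bound, linear in `T`, is used only on the exceptional event, whose probability `2 /
  -- T` cancels the factor `T`.
  have hall : ∀ᵐ ω ∂μ, SLOACI.regret P θ η T T₀ W Z ω
      ≤ T * (ℓmax - SLOACI.loss P (SLOACI.optAction θ)) := by
    filter_upwards [hmax] with ω hω
    rw [SLOACI.regret_eq_sum]
    refine (Finset.sum_le_card_nsmul _ _ (ℓmax - SLOACI.loss P (SLOACI.optAction θ))
      fun t ht => by linarith [hω t ht]).trans ?_
    simp
  have hfin := SLOACI.integral_le_of_measure_le hint (by positivity)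
    (mul_nonneg hTpos.le (sub_nonneg.mpr hℓ)) (by positivity) hPS hgood hall
  have h5 : (T : ℝ) * (ℓmax - SLOACI.loss P (SLOACI.optAction θ)) * (2 / T)
      = 2 * (ℓmax - SLOACI.loss P (SLOACI.optAction θ)) := by field_simp
  rw [h5] at hfin
  refine hfin.trans ?_
  rw [pow_zero, mul_one]
  have hLL : L ≤ L ^ 2 := by nlinarith
  have h6 : T₀ * I ≤ K * L ^ 2 * I := by
    have : (T₀ : ℝ) ≤ K * L ^ 2 := hup.trans (by gcongr)
    gcongr
  have h7 : C' * L * (1 + L) ≤ C' * (2 * L ^ 2) := by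
    rw [mul_assoc]
    exact mul_le_mul_of_nonneg_left (by nlinarith) hC'
  linarith
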